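/- **Definitions.** For a real vector $u=(u_1,\dots,u_n)$ let $S^-(u)$ be the number of sign changes in $u$ after deleting all zero entries, with $S^-(0)=-1$. The *cyclic variation* is $S^-_c(u)=\max_{1\le i\le n} S^-(u_i,u_{i+1},\dots,u_n,u_1,\dots,u_i)$, and the *strict cyclic variation* $S^+_c(u)$ is the maximum of $S^-_c(p)$ over all vectors $p$ obtained from $u$ by replacing each zero entry by $1$ or $-1$. For a sequence $u:\mathbb Z\to\mathbb R$ with period $T$, $S^\mp_c(u)$ is evaluated on $(u(0),\dots,u(T-1))$. Such a $u$ is *(strictly) $T$-periodically monotone* if $S^-_c(u-c)\le 2$ (respectively $S^+_c(u-c)\le 2$) for all $c\in\mathbb R$. Write $\Delta x(t)=x(t+1)-x(t)$. A real matrix with at least three rows and columns is *(strictly) $3$-sign-consistent* if all its $3\times3$ minors (formed with increasing row and column indices) are $\ge 0$ or all are $\le 0$ (respectively all $>0$ or all $<0$). A sequence $\gamma=(\gamma_1,\gamma_2):\mathbb Z\to\mathbb R^2$ with period $T$ is a *(strict) convex contour* if $S^-_c(\alpha_1\gamma_1+\alpha_2\gamma_2+\alpha_3)\le 2$ (respectively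 $S^+_c(\alpha_1\gamma_1+\alpha_2\gamma_2+\alpha_3)\le 2$) for all $\alpha\in\mathbb R^3\setminus\{0\}$. Let $P_\gamma(t)=(1-t+\lfloor t\rfloor)\,\gamma(\lfloor t\rfloor)+(t-\lfloor t\rfloor)\,\gamma(\lceil t\rceil)$, $t\in\mathbb R$, be the closed polygonal curve through the points $\gamma(t)$. It is *simple* if, whenever $0\le s\le t<T$ and $P_\gamma(s)=P_\gamma(t)$, $P_\gamma$ is constant on $[s,t]$ or on $[t,s+T]$ (so the only repetitions are those coming from repeated consecutive points). The set *enclosed* by $P_\gamma$ is the union of $P_\gamma([0,T))$ and of the bounded connected components of its complement. Let $\tilde T$ be the number of $t\in\{0,\dots,T-1\}$ with $\Delta\gamma(t)\ne0$, and let $\tilde\gamma$ be the sequence with period $\tilde T$ obtained from $\gamma$ by deleting all points $\gamma(t)$ with $\Delta\gamma(t)=0$: $\tilde\gamma(0),\dots,\tilde\gamma(\tilde T-1)$ are the points $\gamma(t)$, $0\le t<T$, $\Delta\gamma(t)\neq 0$, in their order. **Theorem.** Let $T\ge4$, let $\gamma:\mathbb Z\to\mathbb R^2$ satisfy $\gamma(t+T)=\gamma(t)$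 for all $t$, and let $M^\gamma\in\mathbb R^{T\times3}$ be the matrix with rows $(\gamma_1(t),\gamma_2(t),1)$, $t=0,\dots,T-1$. (A) If $\operatorname{rank}M^\gamma=3$, the following are equivalent: 1. $\gamma$ is a convex contour. 2. $M^\gamma$ is $3$-sign-consistent. 3. The determinants of the matrices with rows $(\gamma_1(t_i),\gamma_2(t_i),1)$, $i=1,2,3$, over all integers $t_1<t_2<t_3<t_1+T$, are all $\ge0$ or all $\le0$. 4. $P_\gamma$ is simple and the set it encloses is convex. 5. The determinants $\det\begin{bmatrix}\Delta\tilde\gamma_1(t)&\Delta\tilde\gamma_2(t)\\ \Delta\tilde\gamma_1(t+1)&\Delta\tilde\gamma_2(t+1)\end{bmatrix}$, $t=0,\dots,\tilde T-1$, are all $\ge0$ or all $\le0$; $\tilde\gamma$ does not backtrack, i.e. for $t=0,\dots,\tilde T-1$ the vector $\Delta\tilde\gamma(t+1)$ is not a negative multiple of $\Delta\tilde\gamma(t)$; and $\tilde\gamma_1,\tilde\gamma_2$ are $\tilde T$-periodically monotone. (B) If $\operatorname{rank}M^\gamma=3$, the following are equivalent: 1. $\gamma$ is a strict convex contour. 2.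 $M^\gamma$ is strictly $3$-sign-consistent. 3. The determinants in (A.3) are all $>0$ or all $<0$. 4. $P_\gamma$ is simple, the set it encloses is convex, and for no indices $0\le t_1<t_2<t_3<T$ are $\gamma(t_1),\gamma(t_2),\gamma(t_3)$ collinear. 5. $\Delta\gamma(t)\ne0$ for all $t$ (so that $\tilde\gamma=\gamma$, $\tilde T=T$), the determinants in (A.5) are all $>0$ or all $<0$, and $\tilde\gamma_1,\tilde\gamma_2$ are strictly $\tilde T$-periodically monotone. (C) If $\operatorname{rank}M^\gamma=2$, then $\gamma$ is a convex contour if and only if $\gamma_1$ and $\gamma_2$ are $T$-periodically monotone. -/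

import Mathlib

noncomputable section

/-- The Euclidean plane. -/
abbrev Plane : Type := EuclideanSpace ℝ (Fin 2)

/-- The variation `S⁻` of a finite sequence: the number of sign changes after all zeros have been
deleted, and `-1` if all entries are zero. -/
def variation (l : List ℝ) : ℤ :=
  if l.filter (fun x => x ≠ 0) = [] then -1
  else (((l.filter (fun x => x ≠ 0)).zip (l.filter (fun x => x ≠ 0)).tail).countP
    (fun p => p.1 * p.2 < 0) : ℕ)

/-- The cyclic variation `S⁻_c` of a vector: the largest variation of one of the sequences
`(u_i, u_{i+1}, …, u_n, u_1, …, u_i)`. -/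
def cyclicVariation {n : ℕ} (u : Fin n → ℝ) : ℤ :=
  ⨆ i : Fin n, variation ((List.ofFn u).rotate (i : ℕ) ++ [u i])

/-- The strict cyclic variation `S⁺_c` of a vector: the largest cyclic variation obtained by
replacing each zero entry of `u` by `1` or `-1`. -/
def strictCyclicVariation {n : ℕ} (u : Fin n → ℝ) : ℤ :=
  ⨆ ε : Fin n → ℤˣ, cyclicVariation (fun i => if u i = 0 then (((ε i : ℤˣ) : ℤ) : ℝ) else u i)

/-- The restriction `u(0), …, u(T-1)` of a sequence to one period. -/
def onePeriod (T : ℕ) (u : ℤ → ℝ) : Fin T → ℝ := fun i => u ((i : ℕ) : ℤ)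

/-- The forward difference `Δx(t) = x(t+1) - x(t)`. -/
def forwardDiff {E : Type*} [AddCommGroup E] (x : ℤ → E) (t : ℤ) : E := x (t + 1) - x t

/-- Periodic monotonicity of a sequence with period `T`. -/
def PeriodicallyMonotone (T : ℕ) (u : ℤ → ℝ) : Prop :=
  ∀ c : ℝ, cyclicVariation (onePeriod T (fun t => u t - c)) ≤ 2

/-- Strict periodic monotonicity of a sequence with period `T`. -/
def StrictlyPeriodicallyMonotone (T : ℕ) (u : ℤ → ℝ) : Prop :=
  ∀ c : ℝ, strictCyclicVariation (onePeriod T (fun t => u t - c)) ≤ 2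

/-- Convex contours with period `T`. -/
def IsConvexContour (T : ℕ) (γ : ℤ → Plane) : Prop :=
  ∀ α : Fin 3 → ℝ, α ≠ 0 →
    cyclicVariation (onePeriod T (fun t => α 0 * γ t 0 + α 1 * γ t 1 + α 2)) ≤ 2

/-- Strictly convex contours with period `T`. -/
def IsStrictConvexContour (T : ℕ) (γ : ℤ → Plane) : Prop :=
  ∀ α : Fin 3 → ℝ, α ≠ 0 →
    strictCyclicVariation (onePeriod T (fun t => α 0 * γ t 0 + α 1 * γ t 1 + α 2)) ≤ 2

/-- `X` is `k`-sign consistent: its `k`-minors (the entries of the `k`-th multiplicative compound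
matrix) are all nonnegative or all nonpositive. -/
def SignConsistent {n m : ℕ} (k : ℕ) (X : Matrix (Fin n) (Fin m) ℝ) : Prop :=
  (∀ (I : Fin k ↪o Fin n) (J : Fin k ↪o Fin m), 0 ≤ (X.submatrix I J).det) ∨
  (∀ (I : Fin k ↪o Fin n) (J : Fin k ↪o Fin m), (X.submatrix I J).det ≤ 0)

/-- `X` is strictly `k`-sign consistent: its `k`-minors are all positive or all negative. -/
def StrictlySignConsistent {n m : ℕ} (k : ℕ) (X : Matrix (Fin n) (Fin m) ℝ) : Prop :=
  (∀ (I : Fin k ↪o Fin n) (J : Fin k ↪o Fin m), 0 < (X.submatrix I J).det) ∨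
  (∀ (I : Fin k ↪o Fin n) (J : Fin k ↪o Fin m), (X.submatrix I J).det < 0)

/-- The matrix `M^γ` with rows `(γ₁(t), γ₂(t), 1)`, `t = 0, …, T-1`. -/
def contourMatrix (T : ℕ) (γ : ℤ → Plane) : Matrix (Fin T) (Fin 3) ℝ :=
  Matrix.of fun i => ![γ ((i : ℕ) : ℤ) 0, γ ((i : ℕ) : ℤ) 1, 1]

/-- The determinant with rows `(γ₁(tᵢ), γ₂(tᵢ), 1)`, `i = 1, 2, 3`. -/
def tripleDet (γ : ℤ → Plane) (t₁ t₂ t₃ : ℤ) : ℝ :=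
  Matrix.det !![γ t₁ 0, γ t₁ 1, 1; γ t₂ 0, γ t₂ 1, 1; γ t₃ 0, γ t₃ 1, 1]

/-- The determinant with rows `Δγ(t)` and `Δγ(t+1)`. -/
def consecutiveDet (γ : ℤ → Plane) (t : ℤ) : ℝ :=
  Matrix.det !![forwardDiff γ t 0, forwardDiff γ t 1;
    forwardDiff γ (t + 1) 0, forwardDiff γ (t + 1) 1]

/-- The polygonal curve `P_γ`: sequential linear interpolation of the points `γ(t)`. -/
def polygonCurve (γ : ℤ → Plane) (t : ℝ) : Plane :=
  (1 - Int.fract t) • γ ⌊t⌋ + Int.fract t • γ ⌈t⌉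

/-- A closed curve `P` with period `T` is simple: it does not intersect itself, except that it may
stay at a point for a while (as `P_γ` does if `γ(t) = γ(t+1)`). Thus, if `P s = P t` with
`0 ≤ s ≤ t < T`, then `P` is constant on one of the two arcs of parameters between `s` and `t`. If
`P` is constant on no interval, this says that `P` is injective on `[0, T)`. -/
def IsSimpleClosedCurve (T : ℕ) (P : ℝ → Plane) : Prop :=
  ∀ s t : ℝ, 0 ≤ s → s ≤ t → t < T → P s = P t →
    (∀ r ∈ Set.Icc s t, P r = P s) ∨ (∀ r ∈ Set.Icc t (s + T), P r = P s)

/-- The (closed) set enclosed by a closed curve with image `C`: the points of `C` and those of the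
bounded connected components of the complement of `C`. -/
def enclosedSet (C : Set Plane) : Set Plane :=
  C ∪ {x | x ∉ C ∧ Bornology.IsBounded (connectedComponentIn Cᶜ x)}

/-- `P_γ` is simple and the set enclosed by `P_γ([0,T))` is convex. -/
def HasConvexPolygon (T : ℕ) (γ : ℤ → Plane) : Prop :=
  IsSimpleClosedCurve T (polygonCurve γ) ∧
    Convex ℝ (enclosedSet (polygonCurve γ '' Set.Ico (0 : ℝ) T))

open Classical in
/-- The number `T̃` of indices `t ∈ {0, …, T-1}` with `Δγ(t) ≠ 0`. -/
def reducedPeriod (T : ℕ) (γ : ℤ → Plane) : ℕ :=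
  Nat.count (fun n : ℕ => forwardDiff γ (n : ℤ) ≠ 0) T

/-- The sequence `γ̃` with period `T̃` that results from deleting all points `γ(t)` with
`Δγ(t) = 0`: on `0, …, T̃-1` it lists the points `γ(t)`, `0 ≤ t < T`, with `Δγ(t) ≠ 0` in their
order, and it is extended periodically. -/
def reducedSeq (T : ℕ) (γ : ℤ → Plane) : ℤ → Plane := fun j =>
  γ (Nat.nth (fun n : ℕ => forwardDiff γ (n : ℤ) ≠ 0) (j % (reducedPeriod T γ : ℤ)).toNat : ℤ)

end

/-!
For three points `p, q, r` of the plane let `orient p q r` be twice the signed area of their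
triangle; this is the minor of `M^γ` with the corresponding rows. All conditions of the first two
parts are compared with one of them: `WeaklyOriented σ T γ` (resp. `StrictlyOriented σ T γ`) for
some `σ ≠ 0`, that is, the orientations of the triples in cyclic order within a period all have the
sign of `σ` or vanish (resp. all have the sign of `σ`). Since cyclic permutations of three rows are even, this is the same as (strict) sign
consistency (`forall_minor_iff`, `forall_sorted_iff_forall_cyclic`).

*Convex contours.* The variation conditions say that no affine form takes the signs `+ - + -`, in
this order, along four points of a period (`cyclicVariation_onePeriod_le_two_iff`). The orientations
of the triples among four points are the coefficients of a linear dependence between the values of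
an affine form at these points (`affineForm_dependence`). If they have the same sign, the values can
alternate only when the points are collinear, and this is excluded by a fifth point off the line
(`WeaklyOriented.not_alternates`). Conversely, if two of them have different signs, some affine form
alternates; hence the sign does not change when one point of a triple is exchanged for another, and
by basis exchange any two triples of nonzero orientation are connected in this way
(`vandermondeOrient_exchange`, `vandermondeOrient_nonneg`).

*Polygons.* Weak orientation extends to real parameters, because the orientation is affine in each
point. If `P_γ` passes twice through a point, this forces all points to be collinear unless one of
the two arcs is constant, so `P_γ` is simple. Let `K` be the convex hull of the points. A supporting
line of `K` meets the curve in a single arc, so the curve covers the boundary of `K`, and the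
enclosed set is `K` (`WeaklyOriented.frontier_subset`). Conversely, if the enclosed set is convex,
it is `K`, and the curve covers the boundary of `K`. This boundary is a topological circle; as it
stays connected without any one of its points, a simple closed curve that covers it cannot leave it
(`IsSimpleClosedCurve.mem_of_subset_range`). An alternating affine form would vanish at three
different points of the curve, whereas a line through the interior of `K` meets the boundary at most
twice (`HasConvexPolygon.not_alternates`).

*Local conditions.* Deleting repeated points does not affect weak orientation. For a polygon that
always turns left, without reversals, the slope of the edges increases while the first coordinate
does. If the first coordinate is periodically monotone, the polygon consists of one such lower chain
and one upper chain, and it is convex (`TurnsLeft.weaklyOriented`). If moreover all consecutive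
triples are strictly oriented, all triples are (`WeaklyOriented.orient_pos`).

*Points on a line.* One coordinate is an affine function of the other, and so is every affine form.
-/

/-! ### Variations and alternations -/

/-- The number of sign changes in `x :: l`, by recursion on `l` (meaningful for nonzero entries). -/
noncomputable def signChanges : ℝ → List ℝ → ℕ
  | _, [] => 0
  | x, y :: l => (if x * y < 0 then 1 else 0) + signChanges y l

lemma countP_zip_tail_eq_signChanges (x : ℝ) (l : List ℝ) :
    ((x :: l).zip l).countP (fun p => p.1 * p.2 < 0) = signChanges x l := by
  induction l generalizing x with
  | nil => simp [signChanges]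
  | cons y l ih =>
    rw [List.zip_cons_cons, List.countP_cons, ih, signChanges, add_comm]
    simp

/-- Inserting an entry `y` after `x` does not decrease the number of sign changes. -/
lemma signChanges_le_add {x y : ℝ} (hx : x ≠ 0) (hy : y ≠ 0) (l : List ℝ)
    (hl : ∀ z ∈ l, z ≠ 0) :
    signChanges x l ≤ (if x * y < 0 then 1 else 0) + signChanges y l := by
  cases l with
  | nil => simp [signChanges]
  | cons z l =>
    have hz : z ≠ 0 := hl z (by simp)
    simp only [signChanges]
    have : (if x * z < 0 then 1 else 0 : ℕ) ≤
        (if x * y < 0 then 1 else 0) + (if y * z < 0 then 1 else 0) := by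
      rcases lt_or_gt_of_ne hx with h1 | h1 <;> rcases lt_or_gt_of_ne hy with h2 | h2 <;>
        rcases lt_or_gt_of_ne hz with h3 | h3 <;>
        simp [mul_neg_iff, h1, h2, h3, h1.le, h2.le, h3.le, not_lt.2]
    omega

lemma signChanges_mono {s l : List ℝ} (h : s.Sublist l) (hl : ∀ z ∈ l, z ≠ 0) :
    ∀ x : ℝ, x ≠ 0 → signChanges x s ≤ signChanges x l := by
  induction h with
  | slnil => simp
  | @cons s l a h ih =>
    intro x hx
    have ha : a ≠ 0 := hl a (by simp)
    have hl' : ∀ z ∈ l, z ≠ 0 := fun z hz => hl z (by simp [hz])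
    calc signChanges x s ≤ signChanges x l := ih hl' x hx
      _ ≤ _ := signChanges_le_add hx ha l hl'
      _ = signChanges x (a :: l) := rfl
  | @cons_cons s l a h ih =>
    intro x hx
    have ha : a ≠ 0 := hl a (by simp)
    have := ih (fun z hz => hl z (by simp [hz])) a ha
    simp only [signChanges]
    omega

lemma exists_sublist_of_lt_signChanges {k : ℕ} (l : List ℝ) :
    ∀ x : ℝ, (∀ z ∈ l, z ≠ 0) → x ≠ 0 → k < signChanges x l →
      ∃ y l', (y :: l').Sublist l ∧ x * y < 0 ∧ k ≤ signChanges y l' := by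
  induction l with
  | nil => intro x _ _ h; simp [signChanges] at h
  | cons b l ih =>
    intro x hl hx h
    have hb : b ≠ 0 := hl b (by simp)
    by_cases hxb : x * b < 0
    · refine ⟨b, l, List.Sublist.refl _, hxb, ?_⟩
      simp only [signChanges, hxb, if_true] at h
      omega
    · simp only [signChanges, hxb, if_false, zero_add] at h
      obtain ⟨y, l', hs, hby, hk⟩ := ih b (fun z hz => hl z (by simp [hz])) hb h
      refine ⟨y, l', hs.cons _, ?_, hk⟩
      have hxb' : 0 < x * b := lt_of_le_of_ne (not_lt.1 hxb) (mul_ne_zero hx hb).symm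
      have : 0 < b * b := mul_self_pos.2 hb
      by_contra hxy
      nlinarith [mul_nonneg (not_lt.1 hxy) hxb'.le, mul_pos this this, mul_pos hxb' (neg_pos.2 hby)]

/-- The variation is at least three exactly if the sequence has an alternating subsequence of
length four. -/
lemma two_lt_variation_iff (l : List ℝ) :
    2 < variation l ↔ ∃ x y z w, [x, y, z, w].Sublist l ∧ x * y < 0 ∧ y * z < 0 ∧ z * w < 0 := by
  set f := l.filter (fun x => x ≠ 0) with hf
  have hf0 : ∀ z ∈ f, z ≠ 0 := fun z hz => by simpa using (List.mem_filter.1 hz).2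
  have hfl : f.Sublist l := List.filter_sublist
  constructor
  · intro h
    rw [variation, ← hf] at h
    cases hc : f with
    | nil => simp [hc] at h
    | cons x f' =>
      rw [hc, if_neg (by simp), List.tail_cons, countP_zip_tail_eq_signChanges] at h
      rw [hc] at hf0 hfl
      have h' : 2 < signChanges x f' := by exact_mod_cast h
      have hx : x ≠ 0 := hf0 x (by simp)
      obtain ⟨y, l1, hs1, hxy, h1⟩ :=
        exists_sublist_of_lt_signChanges f' x (fun z hz => hf0 z (by simp [hz])) hx h'
      have hy0 : ∀ z ∈ y :: l1, z ≠ 0 := fun z hz => hf0 z (by simp [hs1.subset hz])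
      obtain ⟨z, l2, hs2, hyz, h2⟩ := exists_sublist_of_lt_signChanges (k := 1) l1 y
        (fun z hz => hy0 z (by simp [hz])) (hy0 y (by simp)) h1
      have hz0 : ∀ t ∈ z :: l2, t ≠ 0 := fun t ht => hy0 t (by simp [hs2.subset ht])
      obtain ⟨w, l3, hs3, hzw, h3⟩ := exists_sublist_of_lt_signChanges (k := 0) l2 z
        (fun t ht => hz0 t (by simp [ht])) (hz0 z (by simp)) h2
      refine ⟨x, y, z, w, List.Sublist.trans ?_ hfl, hxy, hyz, hzw⟩
      refine (List.Sublist.trans (List.Sublist.cons_cons y ?_) hs1).cons_cons x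
      refine (List.Sublist.trans (List.Sublist.cons_cons z ?_) hs2)
      exact List.Sublist.trans (List.Sublist.cons_cons w (List.nil_sublist _)) hs3
  · rintro ⟨x, y, z, w, hs, hxy, hyz, hzw⟩
    have hx : x ≠ 0 := left_ne_zero_of_mul hxy.ne
    have hy : y ≠ 0 := left_ne_zero_of_mul hyz.ne
    have hz : z ≠ 0 := left_ne_zero_of_mul hzw.ne
    have hw : w ≠ 0 := right_ne_zero_of_mul hzw.ne
    have hs' : [x, y, z, w].Sublist f := by
      have := hs.filter (fun x => decide (x ≠ 0))
      rw [hf]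
      convert this using 1
      simp [hx, hy, hz, hw]
    rw [variation, ← hf]
    cases hc : f with
    | nil => simp [hc] at hs'
    | cons b f' =>
      rw [if_neg (by simp), List.tail_cons, countP_zip_tail_eq_signChanges]
      rw [hc] at hs' hf0
      have hb : b ≠ 0 := hf0 b (by simp)
      have h3 : signChanges b [x, y, z, w] ≤ signChanges b (b :: f') :=
        signChanges_mono hs' hf0 b hb
      simp only [signChanges, hxy, hyz, hzw, if_true, not_lt.2 (mul_self_nonneg b), if_false] at h3
      have : 2 < signChanges b f' := by omega
      exact_mod_cast this

/-- A sequence with period `n` has four sign changes around one period. -/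
def Alternates (n : ℕ) (u : ℤ → ℝ) : Prop :=
  ∃ a b c d : ℤ, a < b ∧ b < c ∧ c < d ∧ d < a + n ∧ 0 < u a ∧ u b < 0 ∧ 0 < u c ∧ u d < 0

/-- A sequence with period `n` has four sign changes around one period, where zeros may be given
either sign. -/
def WeaklyAlternates (n : ℕ) (u : ℤ → ℝ) : Prop :=
  ∃ a b c d : ℤ, a < b ∧ b < c ∧ c < d ∧ d < a + n ∧ 0 ≤ u a ∧ u b ≤ 0 ∧ 0 ≤ u c ∧ u d ≤ 0

/-- Four alternating signs within one period, in either phase, give an alternation: if the first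
sign is negative, the sequence is entered one step later. -/
lemma alternates_of_mul_neg {n : ℕ} {u : ℤ → ℝ} (hu : ∀ t, u (t + n) = u t) {a b c d : ℤ}
    (hab : a < b) (hbc : b < c) (hcd : c < d) (hda : d < a + n)
    (h1 : u a * u b < 0) (h2 : u b * u c < 0) (h3 : u c * u d < 0) : Alternates n u := by
  rcases mul_neg_iff.1 h1 with ⟨ha, hb⟩ | ⟨ha, hb⟩
  · have hc : 0 < u c := by
      rcases mul_neg_iff.1 h2 with h | h
      · linarith [h.1]
      · exact h.2
    have hd : u d < 0 := by
      rcases mul_neg_iff.1 h3 with h | h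
      · exact h.2
      · linarith [h.1]
    exact ⟨a, b, c, d, hab, hbc, hcd, hda, ha, hb, hc, hd⟩
  · have hc : u c < 0 := by
      rcases mul_neg_iff.1 h2 with h | h
      · exact h.2
      · linarith [h.1]
    have hd : 0 < u d := by
      rcases mul_neg_iff.1 h3 with h | h
      · linarith [h.1]
      · exact h.2
    exact ⟨b, c, d, a + n, hbc, hcd, hda, by omega, hb, hc, hd, by rwa [hu]⟩

lemma periodic_add_mul {E : Type*} {n : ℕ} {u : ℤ → E} (hu : ∀ t, u (t + n) = u t) (q t : ℤ) :
    u (t + n * q) = u t := by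
  have h : Function.Periodic u (n : ℤ) := hu
  have := h.zsmul q t
  rwa [zsmul_eq_mul, mul_comm] at this

lemma periodic_emod {E : Type*} {n : ℕ} {u : ℤ → E} (hu : ∀ t, u (t + n) = u t) (t : ℤ) :
    u (t % n) = u t := by
  conv_rhs => rw [← Int.emod_add_mul_ediv t n]
  rw [periodic_add_mul hu]

lemma rotate_ofFn_onePeriod {n : ℕ} {u : ℤ → ℝ} (hu : ∀ t, u (t + n) = u t) (i : Fin n) :
    (List.ofFn (onePeriod n u)).rotate (i : ℕ) ++ [onePeriod n u i] =
      (List.range (n + 1)).map (fun j : ℕ => u (i + j)) := by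
  apply List.ext_getElem
  · simp
  · intro k h1 h2
    have hk : k < n + 1 := by simpa using h2
    rw [List.getElem_map, List.getElem_range]
    rcases Nat.lt_succ_iff_lt_or_eq.1 hk with hk | hk
    · rw [List.getElem_append_left (by simpa using hk), List.getElem_rotate, List.getElem_ofFn]
      simp only [onePeriod, List.length_ofFn]
      rw [← periodic_emod hu (i + k)]
      push_cast
      rw [add_comm (k : ℤ)]
    · subst hk
      rw [List.getElem_append_right (by simp)]
      simp only [onePeriod, List.getElem_singleton]
      rw [hu]

lemma cyclicVariation_le_iff {n : ℕ} (hn : 0 < n) (u : Fin n → ℝ) (k : ℤ) :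
    cyclicVariation u ≤ k ↔ ∀ i : Fin n, variation ((List.ofFn u).rotate (i : ℕ) ++ [u i]) ≤ k := by
  have : Nonempty (Fin n) := ⟨⟨0, hn⟩⟩
  exact ciSup_le_iff (Set.finite_range _).bddAbove

lemma strictCyclicVariation_le_iff {n : ℕ} (u : Fin n → ℝ) (k : ℤ) :
    strictCyclicVariation u ≤ k ↔ ∀ ε : Fin n → ℤˣ,
      cyclicVariation (fun i => if u i = 0 then (((ε i : ℤˣ) : ℤ) : ℝ) else u i) ≤ k :=
  ciSup_le_iff (Set.finite_range _).bddAbove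

/-- Three sign changes along a closed sequence `u_i, …, u_i` entail a fourth one: if the alternating
subsequence ends with the repeated entry, it cannot also start there. -/
lemma cyclicVariation_onePeriod_le_two_iff {n : ℕ} (hn : 0 < n) {u : ℤ → ℝ}
    (hu : ∀ t, u (t + n) = u t) :
    cyclicVariation (onePeriod n u) ≤ 2 ↔ ¬ Alternates n u := by
  rw [cyclicVariation_le_iff hn]
  constructor
  · rintro h ⟨a, b, c, d, hab, hbc, hcd, hda, ha, hb, hc, hd⟩
    have hn' : (0 : ℤ) < n := by exact_mod_cast hn
    have hr0 : 0 ≤ a % n := Int.emod_nonneg _ hn'.ne'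
    have hr1 : a % n < n := Int.emod_lt_of_pos _ hn'
    obtain ⟨i, hi⟩ := Int.eq_ofNat_of_zero_le hr0
    have hin : i < n := by omega
    refine absurd (h ⟨i, hin⟩) (not_le.2 ?_)
    rw [two_lt_variation_iff, rotate_ofFn_onePeriod hu]
    have key : ∀ t : ℤ, a ≤ t → u ((i : ℤ) + ((t - a).toNat : ℤ)) = u t := by
      intro t ht
      rw [Int.toNat_of_nonneg (by omega), ← periodic_add_mul hu (a / n), ← hi]
      congr 1
      linarith [Int.emod_add_mul_ediv a n]
    refine ⟨u a, u b, u c, u d, ?_, by nlinarith, by nlinarith, by nlinarith⟩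
    have : [u a, u b, u c, u d] = ([(a - a).toNat, (b - a).toNat, (c - a).toNat,
        (d - a).toNat]).map (fun j : ℕ => u (i + j)) := by
      simp only [List.map_cons, List.map_nil]
      rw [key a le_rfl, key b (by omega), key c (by omega), key d (by omega)]
    rw [this]
    apply List.Sublist.map
    apply List.sublist_of_subperm_of_pairwise (r := (· < ·))
    · apply List.subperm_of_subset
      · simp; omega
      · intro x hx
        simp only [List.mem_cons, List.not_mem_nil, or_false] at hx
        rw [List.mem_range]
        omega
    · simp; omega
    · exact List.pairwise_lt_range
  · intro h i
    by_contra hlt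
    rw [not_le, two_lt_variation_iff, rotate_ofFn_onePeriod hu] at hlt
    obtain ⟨x, y, z, w, hs, hxy, hyz, hzw⟩ := hlt
    obtain ⟨l', hs', hl'⟩ := List.sublist_map_iff.1 hs
    match l', hl' with
    | [a, b, c, d], hl' =>
      simp only [List.map_cons, List.map_nil, List.cons.injEq, and_true] at hl'
      obtain ⟨rfl, rfl, rfl, rfl⟩ := hl'
      have hp := List.Pairwise.sublist hs' List.pairwise_lt_range
      simp only [List.pairwise_cons, List.mem_cons, List.not_mem_nil, or_false] at hp
      have hab : a < b := hp.1 b (by simp)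
      have hbc : b < c := hp.2.1 c (by simp)
      have hcd : c < d := hp.2.2.1 d (by simp)
      have hd : d < n + 1 := List.mem_range.1 (hs'.subset (by simp))
      rcases Nat.lt_or_ge d (a + n) with hda | hda
      · exact h (alternates_of_mul_neg hu (by omega) (by omega) (by omega) (by omega) hxy hyz hzw)
      · -- now `a = 0` and `d = n` are the same point, at which the signs would differ
        have : (i : ℤ) + d = (i + a) + n := by omega
        rw [this, hu] at hzw
        nlinarith [mul_pos (mul_pos_of_neg_of_neg hxy hyz) (neg_pos.2 hzw),
          sq_nonneg (u (i + a) * u (i + b) * u (i + c))]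

lemma strictCyclicVariation_onePeriod_le_two_iff {n : ℕ} (hn : 0 < n) {u : ℤ → ℝ}
    (hu : ∀ t, u (t + n) = u t) :
    strictCyclicVariation (onePeriod n u) ≤ 2 ↔ ¬ WeaklyAlternates n u := by
  rw [strictCyclicVariation_le_iff]
  have hn' : (0 : ℤ) < n := by exact_mod_cast hn
  let idx : ℤ → Fin n := fun t => ⟨(t % n).toNat, by
    have := Int.emod_nonneg t hn'.ne'
    have := Int.emod_lt_of_pos t hn'
    omega⟩
  -- the periodic extension of the vector in which the zeros have been replaced
  let w : (Fin n → ℤˣ) → ℤ → ℝ := fun ε t =>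
    if u t = 0 then (((ε (idx t) : ℤˣ) : ℤ) : ℝ) else u t
  have hidx : ∀ t, idx (t + n) = idx t := fun t => by simp [idx]
  have hw : ∀ ε t, w ε (t + n) = w ε t := fun ε t => by simp only [w, hu, hidx]
  have hone : ∀ ε, (fun i => if onePeriod n u i = 0 then (((ε i : ℤˣ) : ℤ) : ℝ)
      else onePeriod n u i) = onePeriod n (w ε) := by
    intro ε
    funext i
    have : idx ((i : ℕ) : ℤ) = i := by
      ext
      simp only [idx]
      rw [Int.emod_eq_of_lt (by omega) (by omega)]
      simp
    simp only [onePeriod, w, this]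
    by_cases h : u ((i : ℕ) : ℤ) = 0 <;> simp [h]
  have hiff : ∀ ε, cyclicVariation (fun i => if onePeriod n u i = 0 then (((ε i : ℤˣ) : ℤ) : ℝ)
      else onePeriod n u i) ≤ 2 ↔ ¬ Alternates n (w ε) := fun ε => by
    rw [hone, cyclicVariation_onePeriod_le_two_iff hn (hw ε)]
  simp only [hiff]
  constructor
  · rintro h ⟨a, b, c, d, hab, hbc, hcd, hda, ha, hb, hc, hd⟩
    have hne : ∀ s t : ℤ, s < t → t < s + n → idx s ≠ idx t := by
      intro s t hst hts heq
      have h1 : (s % n).toNat = (t % n).toNat := congrArg Fin.val heq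
      have := Int.emod_nonneg t hn'.ne'
      have := Int.emod_nonneg s hn'.ne'
      have h2 : s % n = t % n := by omega
      have h3 : (n : ℤ) ∣ t - s := Int.ModEq.dvd h2
      exact absurd (Int.le_of_dvd (by omega) h3) (by omega)
    refine h (fun i => if i = idx a ∨ i = idx c then 1 else -1)
      ⟨a, b, c, d, hab, hbc, hcd, hda, ?_, ?_, ?_, ?_⟩
    · simp only [w]
      split_ifs with h1 h2
      · simp
      · simp at h2
      · exact lt_of_le_of_ne ha (Ne.symm h1)
    · simp only [w]
      have h1 := hne a b hab (by omega)
      have h2 := hne b c hbc (by omega)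
      split_ifs with h3 h4
      · exact absurd h4 (by rintro (h | h); exacts [h1 h.symm, h2 h])
      · simp
      · exact lt_of_le_of_ne hb h3
    · simp only [w]
      split_ifs with h1 h2
      · simp
      · simp at h2
      · exact lt_of_le_of_ne hc (Ne.symm h1)
    · simp only [w]
      have h1 := hne a d (by omega) (by omega)
      have h2 := hne c d hcd (by omega)
      split_ifs with h3 h4
      · exact absurd h4 (by rintro (h | h); exacts [h1 h.symm, h2 h.symm])
      · simp
      · exact lt_of_le_of_ne hd h3
  · rintro h ε ⟨a, b, c, d, hab, hbc, hcd, hda, ha, hb, hc, hd⟩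
    refine h ⟨a, b, c, d, hab, hbc, hcd, hda, ?_, ?_, ?_, ?_⟩
    all_goals
      by_contra hcon
      first
        | simp only [w, if_neg (lt_of_not_ge hcon).ne] at ha; linarith
        | simp only [w, if_neg (lt_of_not_ge hcon).ne'] at hb; linarith
        | simp only [w, if_neg (lt_of_not_ge hcon).ne] at hc; linarith
        | simp only [w, if_neg (lt_of_not_ge hcon).ne'] at hd; linarith

/-! ### Orientation of triples of points -/

/-- Twice the signed area of the triangle `p q r`. -/
noncomputable def orient (p q r : Plane) : ℝ :=
  (q 0 - p 0) * (r 1 - p 1) - (q 1 - p 1) * (r 0 - p 0)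

/-- The affine form `α₀ x + α₁ y + α₂` on the plane. -/
noncomputable def affineForm (α : Fin 3 → ℝ) (p : Plane) : ℝ := α 0 * p 0 + α 1 * p 1 + α 2

lemma orient_rotate (p q r : Plane) : orient p q r = orient q r p := by
  unfold orient; ring

lemma orient_swap (p q r : Plane) : orient q p r = -orient p q r := by
  unfold orient; ring

lemma orient_self_left (p q : Plane) : orient p p q = 0 := by
  unfold orient; ring

lemma orient_self_right (p q : Plane) : orient p q q = 0 := by
  unfold orient; ring

lemma orient_self_outer (p q : Plane) : orient p q p = 0 := by
  unfold orient; ring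

lemma tripleDet_eq_orient (γ : ℤ → Plane) (i j k : ℤ) :
    tripleDet γ i j k = orient (γ i) (γ j) (γ k) := by
  rw [tripleDet, Matrix.det_fin_three, orient]
  simp
  ring

lemma consecutiveDet_eq_orient (γ : ℤ → Plane) (t : ℤ) :
    consecutiveDet γ t = orient (γ t) (γ (t + 1)) (γ (t + 1 + 1)) := by
  rw [consecutiveDet, Matrix.det_fin_two, orient]
  simp [forwardDiff]
  ring

/-- The linear dependence between four points of the plane, tested on an affine form. -/
lemma affineForm_dependence (α : Fin 3 → ℝ) (p q r s : Plane) :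
    orient q r s * affineForm α p - orient p r s * affineForm α q +
      orient p q s * affineForm α r - orient p q r * affineForm α s = 0 := by
  unfold orient affineForm; ring

lemma plane_ext {p q : Plane} (h0 : p 0 = q 0) (h1 : p 1 = q 1) : p = q := by
  ext i; fin_cases i
  exacts [h0, h1]

lemma eq_zero_of_affineForm_eq_zero {α : Fin 3 → ℝ} {p q r : Plane} (h : orient p q r ≠ 0)
    (hp : affineForm α p = 0) (hq : affineForm α q = 0) (hr : affineForm α r = 0) : α = 0 := by
  unfold affineForm at hp hq hr
  have h0 : α 0 * orient p q r = 0 := by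
    unfold orient
    linear_combination (r 1 - p 1) * (hq - hp) - (q 1 - p 1) * (hr - hp)
  have h1 : α 1 * orient p q r = 0 := by
    unfold orient
    linear_combination (r 0 - p 0) * (hp - hq) + (q 0 - p 0) * (hr - hp)
  have h0 := (mul_eq_zero.1 h0).resolve_right h
  have h1 := (mul_eq_zero.1 h1).resolve_right h
  funext i
  fin_cases i
  · exact h0
  · exact h1
  · simpa [h0, h1] using hp

/-- The affine form that vanishes on the line through `p` and `q`. -/
lemma exists_affineForm_eq_orient {p q : Plane} (h : p ≠ q) :
    ∃ α : Fin 3 → ℝ, α ≠ 0 ∧ ∀ r, affineForm α r = orient p q r := by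
  refine ⟨![-(q 1 - p 1), q 0 - p 0, (q 1 - p 1) * p 0 - (q 0 - p 0) * p 1], ?_, ?_⟩
  · intro h0
    have h1 := congrFun h0 0
    have h2 := congrFun h0 1
    simp at h1 h2
    exact h (plane_ext (by linarith) (by linarith))
  · intro r
    simp [affineForm, orient]
    ring

lemma exists_param_of_orient_eq_zero {p q r : Plane} (hpq : p ≠ q) (h : orient p q r = 0) :
    ∃ s : ℝ, r 0 = p 0 + s * (q 0 - p 0) ∧ r 1 = p 1 + s * (q 1 - p 1) := by
  unfold orient at h
  by_cases h0 : q 0 - p 0 = 0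
  · have h1 : q 1 - p 1 ≠ 0 := fun h1 => hpq (plane_ext (by linarith) (by linarith))
    refine ⟨(r 1 - p 1) / (q 1 - p 1), ?_, ?_⟩
    · rw [h0] at h ⊢
      have : (q 1 - p 1) * (r 0 - p 0) = 0 := by linarith
      have := (mul_eq_zero.1 this).resolve_left h1
      linarith
    · field_simp
      ring
  · refine ⟨(r 0 - p 0) / (q 0 - p 0), ?_, ?_⟩
    · field_simp
      ring
    · field_simp
      linarith

/-- The points `γ t` do not lie on a line: no nonzero affine form vanishes at all of them. -/
def SpansPlane (γ : ℤ → Plane) : Prop := ∀ α : Fin 3 → ℝ, α ≠ 0 → ∃ t, affineForm α (γ t) ≠ 0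

lemma SpansPlane.exists_orient_ne_zero {γ : ℤ → Plane} (h : SpansPlane γ) {p q : Plane}
    (hpq : p ≠ q) : ∃ t, orient p q (γ t) ≠ 0 := by
  obtain ⟨α, hα, hαr⟩ := exists_affineForm_eq_orient hpq
  obtain ⟨t, ht⟩ := h α hα
  exact ⟨t, by rwa [← hαr]⟩

lemma contourMatrix_mulVec (T : ℕ) (γ : ℤ → Plane) (α : Fin 3 → ℝ) (i : Fin T) :
    (contourMatrix T γ).mulVec α i = affineForm α (γ ((i : ℕ) : ℤ)) := by
  simp [contourMatrix, Matrix.mulVec, dotProduct, Fin.sum_univ_three, affineForm]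
  ring

lemma spansPlane_iff_rank {T : ℕ} (hT : 0 < T) {γ : ℤ → Plane} (hγ : ∀ t, γ (t + T) = γ t) :
    SpansPlane γ ↔ (contourMatrix T γ).rank = 3 := by
  have hdim := LinearMap.finrank_range_add_finrank_ker (contourMatrix T γ).mulVecLin
  rw [Module.finrank_fin_fun] at hdim
  have h1 : (contourMatrix T γ).rank = 3 ↔
      LinearMap.ker (contourMatrix T γ).mulVecLin = ⊥ := by
    rw [← Submodule.finrank_eq_zero, Matrix.rank]
    omega
  rw [h1, LinearMap.ker_eq_bot']
  constructor
  · intro h α hα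
    by_contra hne
    obtain ⟨t, ht⟩ := h α hne
    apply ht
    have hT' : (0 : ℤ) < T := by exact_mod_cast hT
    have h0 := Int.emod_nonneg t hT'.ne'
    have h1 := Int.emod_lt_of_pos t hT'
    obtain ⟨i, hi⟩ := Int.eq_ofNat_of_zero_le h0
    have := congrFun hα ⟨i, by omega⟩
    rw [Matrix.mulVecLin_apply, contourMatrix_mulVec] at this
    rw [← periodic_emod hγ t, hi]
    exact this
  · intro h α hα
    by_contra hne
    push Not at hne
    refine hα (h α ?_)
    funext i
    rw [Matrix.mulVecLin_apply, contourMatrix_mulVec, hne]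
    rfl

/-! ### Sign consistency of the contour matrix -/

/-- There is only one choice of columns, so the minors are the orientations of the triples with
increasing indices. -/
lemma forall_minor_iff {T : ℕ} {γ : ℤ → Plane} (P : ℝ → Prop) :
    (∀ (I : Fin 3 ↪o Fin T) (J : Fin 3 ↪o Fin 3), P ((contourMatrix T γ).submatrix I J).det) ↔
      ∀ i j k : ℤ, 0 ≤ i → i < j → j < k → k < T → P (orient (γ i) (γ j) (γ k)) := by
  have hJ : ∀ (J : Fin 3 ↪o Fin 3) i, J i = i := by
    intro J i
    have : StrictMono J := J.strictMono
    have h01 := this (show (0 : Fin 3) < 1 by decide)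
    have h12 := this (show (1 : Fin 3) < 2 by decide)
    fin_cases i <;> simp only [Fin.ext_iff, Fin.lt_def] at * <;> simp <;> omega
  have hdet : ∀ (I : Fin 3 ↪o Fin T) (J : Fin 3 ↪o Fin 3),
      ((contourMatrix T γ).submatrix I J).det =
        orient (γ ((I 0 : ℕ) : ℤ)) (γ ((I 1 : ℕ) : ℤ)) (γ ((I 2 : ℕ) : ℤ)) := by
    intro I J
    rw [Matrix.det_fin_three, orient]
    simp [hJ, contourMatrix]
    ring
  simp only [hdet]
  constructor
  · intro h i j k hi hij hjk hk
    lift i to ℕ using hi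
    lift j to ℕ using by omega
    lift k to ℕ using by omega
    let I : Fin 3 ↪o Fin T := OrderEmbedding.ofStrictMono
      ![⟨i, by omega⟩, ⟨j, by omega⟩, ⟨k, by omega⟩] (by
        rw [Fin.strictMono_iff_lt_succ]
        intro m
        fin_cases m <;> simp <;> omega)
    exact h I (RelEmbedding.refl _)
  · intro h I _
    have h01 : I 0 < I 1 := I.strictMono (by decide)
    have h12 : I 1 < I 2 := I.strictMono (by decide)
    exact h _ _ _ (by omega) (by exact_mod_cast h01) (by exact_mod_cast h12) (by omega)

/-- As a cyclic permutation of three rows is even, triples within any window of one period behave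
as those within the window `0, …, T - 1`. -/
lemma forall_sorted_iff_forall_cyclic {T : ℕ} {γ : ℤ → Plane} (hγ : ∀ t, γ (t + T) = γ t)
    (P : ℝ → Prop) :
    (∀ i j k : ℤ, 0 ≤ i → i < j → j < k → k < T → P (orient (γ i) (γ j) (γ k))) ↔
      ∀ i j k : ℤ, i < j → j < k → k < i + T → P (orient (γ i) (γ j) (γ k)) := by
  constructor
  · intro h i j k hij hjk hki
    have hT : (0 : ℤ) < T := by omega
    set q := i / T with hq
    have h0 := Int.emod_nonneg i hT.ne'
    have h1 := Int.emod_lt_of_pos i hT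
    have h2 := Int.emod_add_mul_ediv i T
    rw [← hq] at h2
    have hs : ∀ t, γ t = γ (t + T * -q) := fun t => (periodic_add_mul hγ _ _).symm
    have hs' : ∀ t, γ (t + T * -q) = γ (t + T * -q - T) := fun t => by
      rw [← hγ (t + T * -q - T)]; congr 1; ring
    have e : (T : ℤ) * -q = -(T * q) := by ring
    rw [hs i, hs j, hs k]
    rcases lt_or_ge (k + T * -q) T with hk | hk
    · exact h _ _ _ (by omega) (by omega) (by omega) hk
    · rw [hs' k]
      rcases lt_or_ge (j + T * -q) T with hj | hj
      · rw [orient_rotate, orient_rotate]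
        exact h _ _ _ (by omega) (by omega) (by omega) (by omega)
      · rw [hs' j, orient_rotate]
        exact h _ _ _ (by omega) (by omega) (by omega) (by omega)
  · intro h i j k hi hij hjk hk
    exact h i j k hij hjk (by omega)

/-- All triples of points in cyclic order within one period have orientation of the sign of `σ`,
or zero. -/
def WeaklyOriented (σ : ℝ) (T : ℕ) (γ : ℤ → Plane) : Prop :=
  ∀ i j k : ℤ, i ≤ j → j ≤ k → k ≤ i + T → 0 ≤ σ * orient (γ i) (γ j) (γ k)

lemma weaklyOriented_of_lt {σ : ℝ} {T : ℕ} {γ : ℤ → Plane} (hγ : ∀ t, γ (t + T) = γ t)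
    (h : ∀ i j k : ℤ, i < j → j < k → k < i + T → 0 ≤ σ * orient (γ i) (γ j) (γ k)) :
    WeaklyOriented σ T γ := by
  intro i j k hij hjk hki
  rcases hij.eq_or_lt with rfl | hij
  · simp [orient_self_left]
  rcases hjk.eq_or_lt with rfl | hjk
  · simp [orient_self_right]
  rcases hki.eq_or_lt with rfl | hki
  · simp [hγ, orient_self_outer]
  exact h i j k hij hjk hki

lemma forall_tripleDet_iff_weaklyOriented {T : ℕ} {γ : ℤ → Plane} (hγ : ∀ t, γ (t + T) = γ t) :
    ((∀ t₁ t₂ t₃ : ℤ, t₁ < t₂ → t₂ < t₃ → t₃ < t₁ + T → 0 ≤ tripleDet γ t₁ t₂ t₃) ∨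
      (∀ t₁ t₂ t₃ : ℤ, t₁ < t₂ → t₂ < t₃ → t₃ < t₁ + T → tripleDet γ t₁ t₂ t₃ ≤ 0)) ↔
    ∃ σ : ℝ, σ ≠ 0 ∧ WeaklyOriented σ T γ := by
  simp only [tripleDet_eq_orient]
  constructor
  · rintro (h | h)
    · exact ⟨1, one_ne_zero, weaklyOriented_of_lt hγ fun i j k h1 h2 h3 => by
        linarith [h i j k h1 h2 h3]⟩
    · exact ⟨-1, by norm_num, weaklyOriented_of_lt hγ fun i j k h1 h2 h3 => by
        linarith [h i j k h1 h2 h3]⟩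
  · rintro ⟨σ, hσ, h⟩
    rcases lt_or_gt_of_ne hσ with hs | hs
    · right
      intro i j k h1 h2 h3
      exact nonpos_of_mul_nonneg_right (h i j k h1.le h2.le h3.le) hs
    · left
      intro i j k h1 h2 h3
      exact nonneg_of_mul_nonneg_right (h i j k h1.le h2.le h3.le) hs

/-! ### Convex contours -/

lemma affineForm_periodic {T : ℕ} {γ : ℤ → Plane} (hγ : ∀ t, γ (t + T) = γ t) (α : Fin 3 → ℝ)
    (t : ℤ) : affineForm α (γ (t + T)) = affineForm α (γ t) := by rw [hγ]

lemma isConvexContour_iff {T : ℕ} (hT : 0 < T) {γ : ℤ → Plane} (hγ : ∀ t, γ (t + T) = γ t) :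
    IsConvexContour T γ ↔ ∀ α : Fin 3 → ℝ, α ≠ 0 → ¬ Alternates T (fun t => affineForm α (γ t)) :=
  forall₂_congr fun α _ => cyclicVariation_onePeriod_le_two_iff hT (affineForm_periodic hγ α)

lemma isStrictConvexContour_iff {T : ℕ} (hT : 0 < T) {γ : ℤ → Plane}
    (hγ : ∀ t, γ (t + T) = γ t) :
    IsStrictConvexContour T γ ↔
      ∀ α : Fin 3 → ℝ, α ≠ 0 → ¬ WeaklyAlternates T (fun t => affineForm α (γ t)) :=
  forall₂_congr fun α _ =>
    strictCyclicVariation_onePeriod_le_two_iff hT (affineForm_periodic hγ α)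

lemma periodicallyMonotone_iff {T : ℕ} (hT : 0 < T) {u : ℤ → ℝ} (hu : ∀ t, u (t + T) = u t) :
    PeriodicallyMonotone T u ↔ ∀ c : ℝ, ¬ Alternates T (fun t => u t - c) :=
  forall_congr' fun c => cyclicVariation_onePeriod_le_two_iff hT (fun t => by rw [hu])

lemma strictlyPeriodicallyMonotone_iff {T : ℕ} (hT : 0 < T) {u : ℤ → ℝ}
    (hu : ∀ t, u (t + T) = u t) :
    StrictlyPeriodicallyMonotone T u ↔ ∀ c : ℝ, ¬ WeaklyAlternates T (fun t => u t - c) :=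
  forall_congr' fun c => strictCyclicVariation_onePeriod_le_two_iff hT (fun t => by rw [hu])

lemma Alternates.weaklyAlternates {n : ℕ} {u : ℤ → ℝ} (h : Alternates n u) :
    WeaklyAlternates n u := by
  obtain ⟨a, b, c, d, h1, h2, h3, h4, h5, h6, h7, h8⟩ := h
  exact ⟨a, b, c, d, h1, h2, h3, h4, h5.le, h6.le, h7.le, h8.le⟩

/-- The signs of `t ↦ ∏ (t - s)`, with `s` ranging over the other members of a set of four integers,
alternate along that set. This gives a description of alternations that is symmetric in the four
indices. -/
lemma not_forall_mul_prod_sub_pos {T : ℕ} {u : ℤ → ℝ} (hu : ∀ t, u (t + T) = u t)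
    (halt : ¬ Alternates T u) {x y z w : ℤ} (hx : 0 ≤ x ∧ x < T) (hy : 0 ≤ y ∧ y < T)
    (hz : 0 ≤ z ∧ z < T) (hw : 0 ≤ w ∧ w < T)
    (h1 : 0 < u x * ((x - y) * (x - z) * (x - w))) (h2 : 0 < u y * ((y - x) * (y - z) * (y - w)))
    (h3 : 0 < u z * ((z - x) * (z - y) * (z - w))) (h4 : 0 < u w * ((w - x) * (w - y) * (w - z))) :
    False := by
  have key : ∀ a b c d : ℤ, a < b → b < c → c < d → d < a + T →
      0 < u a * ((a - b) * (a - c) * (a - d)) → 0 < u b * ((b - a) * (b - c) * (b - d)) →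
      0 < u c * ((c - a) * (c - b) * (c - d)) → 0 < u d * ((d - a) * (d - b) * (d - c)) →
      False := by
    intro a b c d hab hbc hcd hda h1 h2 h3 h4
    have ab : (0 : ℝ) < b - a := by exact_mod_cast sub_pos.2 hab
    have bc : (0 : ℝ) < c - b := by exact_mod_cast sub_pos.2 hbc
    have cd : (0 : ℝ) < d - c := by exact_mod_cast sub_pos.2 hcd
    have ac : (0 : ℝ) < c - a := by linarith
    have bd : (0 : ℝ) < d - b := by linarith
    have ad : (0 : ℝ) < d - a := by linarith
    have ha : u a < 0 := by
      have : (0 : ℝ) < (b - a) * (c - a) * (d - a) := by positivity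
      nlinarith
    have hb : 0 < u b := by
      have : (0 : ℝ) < (b - a) * (c - b) * (d - b) := by positivity
      nlinarith
    have hc : u c < 0 := by
      have : (0 : ℝ) < (c - a) * (c - b) * (d - c) := by positivity
      nlinarith
    have hd : 0 < u d := by
      have : (0 : ℝ) < (d - a) * (d - b) * (d - c) := by positivity
      nlinarith
    exact halt (alternates_of_mul_neg hu hab hbc hcd hda (by nlinarith) (by nlinarith)
      (by nlinarith))
  have hne : ∀ {s t : ℤ} {v : ℝ}, 0 < v * ((s : ℝ) - t) → s ≠ t := by
    rintro s t v h rfl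
    simp at h
  have hxy : x ≠ y := hne (v := u x * ((x - z) * (x - w))) (by linarith)
  have hxz : x ≠ z := hne (v := u x * ((x - y) * (x - w))) (by linarith)
  have hxw : x ≠ w := hne (v := u x * ((x - y) * (x - z))) (by linarith)
  have hyz : y ≠ z := hne (v := u y * ((y - x) * (y - w))) (by linarith)
  have hyw : y ≠ w := hne (v := u y * ((y - x) * (y - z))) (by linarith)
  have hzw : z ≠ w := hne (v := u z * ((z - x) * (z - y))) (by linarith)
  clear hne
  wlog h12 : x < y generalizing x y
  · exact this hy hx h2 h1 (h3.trans_eq (by ring)) (h4.trans_eq (by ring)) hxy.symm hyz hyw hxz hxw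
      (lt_of_le_of_ne (not_lt.1 h12) hxy.symm)
  wlog h34 : z < w generalizing z w
  · exact this hw hz hzw.symm (h1.trans_eq (by ring)) (h2.trans_eq (by ring)) h4 h3 hxw hxz hyw hyz
      (lt_of_le_of_ne (not_lt.1 h34) hzw.symm)
  wlog h13 : x < z generalizing x y z w
  · exact this hz hw hzw h34 hx hy hxy (h3.trans_eq (by ring)) (h4.trans_eq (by ring))
      (h1.trans_eq (by ring)) (h2.trans_eq (by ring)) hxz.symm hyz.symm hxw.symm hyw.symm h12
      (lt_of_le_of_ne (not_lt.1 h13) hxz.symm)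
  rcases lt_or_gt_of_ne hyz with h | h
  · exact key x y z w h12 h h34 (by omega) h1 h2 h3 h4
  rcases lt_or_gt_of_ne hyw with h' | h'
  · exact key x z y w h13 h h' (by omega) (h1.trans_eq (by ring)) h3 h2 (h4.trans_eq (by ring))
  · exact key x z w y h13 h34 h' (by omega) (h1.trans_eq (by ring)) (h3.trans_eq (by ring))
      (h4.trans_eq (by ring)) (h2.trans_eq (by ring))

/-- The orientation of three points of `γ`, multiplied by the Vandermonde product of their indices.
It is symmetric in the indices, and for increasing indices it has the sign of the orientation. -/
noncomputable def vandermondeOrient (γ : ℤ → Plane) (x y z : ℤ) : ℝ :=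
  ((y : ℝ) - x) * (z - y) * (z - x) * orient (γ x) (γ y) (γ z)

lemma vandermondeOrient_rotate (γ : ℤ → Plane) (x y z : ℤ) :
    vandermondeOrient γ y z x = vandermondeOrient γ x y z := by
  unfold vandermondeOrient orient; ring

lemma exists_pos_mul_add_pos (S : ℝ) {A : ℝ} (hA : 0 < A) : ∃ ε > 0, 0 < ε * S + A := by
  refine ⟨A / (2 * (|S| + 1)), by positivity, ?_⟩
  have h1 : A / (2 * (|S| + 1)) * S ≥ -(A / 2) := by
    have h2 : A / (2 * (|S| + 1)) * (|S| + 1) = A / 2 := by field_simp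
    have h3 : 0 < A / (2 * (|S| + 1)) := by positivity
    nlinarith [neg_abs_le S]
  linarith

/-- If exchanging one point of a triple reversed the orientation, an affine form that is small at
the two common points would alternate along the four points. -/
lemma vandermondeOrient_exchange {T : ℕ} {γ : ℤ → Plane} (hγ : ∀ t, γ (t + T) = γ t)
    (hc : ∀ α : Fin 3 → ℝ, α ≠ 0 → ¬ Alternates T (fun t => affineForm α (γ t)))
    {x y z w : ℤ} (hx : 0 ≤ x ∧ x < T) (hy : 0 ≤ y ∧ y < T)
    (hz : 0 ≤ z ∧ z < T) (hw : 0 ≤ w ∧ w < T) (h : 0 < vandermondeOrient γ x y z) :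
    0 ≤ vandermondeOrient γ x y w := by
  by_contra hneg
  rw [not_le] at hneg
  unfold vandermondeOrient at h hneg
  set A := orient (γ x) (γ y) (γ z) with hA
  set B := orient (γ x) (γ y) (γ w) with hB
  have hA0 : A ≠ 0 := right_ne_zero_of_mul h.ne'
  have hyx : (y : ℝ) - x ≠ 0 := fun h0 => by simp [h0] at h
  have hzy : (z : ℝ) - y ≠ 0 := fun h0 => by simp [h0] at h
  have hzx : (z : ℝ) - x ≠ 0 := fun h0 => by simp [h0] at h
  have hwy : (w : ℝ) - y ≠ 0 := fun h0 => by simp [h0] at hneg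
  have hwx : (w : ℝ) - x ≠ 0 := fun h0 => by simp [h0] at hneg
  have hwz : (w : ℝ) - z ≠ 0 := fun h0 => by
    have : w = z := by exact_mod_cast sub_eq_zero.1 h0
    subst this
    linarith
  have hQ : ((z : ℝ) - x) * (z - y) * (w - x) * (w - y) * (A * B) < 0 := by
    have h1 := mul_neg_of_pos_of_neg h hneg
    have h2 : 0 < ((y : ℝ) - x) ^ 2 := by positivity
    nlinarith
  have hpos : 0 < A * B * ((z - x) * (z - y) * (z - w)) * ((w - x) * (w - y) * (w - z)) := by
    have h2 : 0 < ((w : ℝ) - z) ^ 2 := by positivity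
    nlinarith [mul_neg_of_neg_of_pos hQ h2]
  set τx : ℝ := (x - y) * (x - z) * (x - w) with hτx
  set τy : ℝ := (y - x) * (y - z) * (y - w) with hτy
  set τz : ℝ := (z - x) * (z - y) * (z - w) with hτz
  set τw : ℝ := (w - x) * (w - y) * (w - z) with hτw
  have hx0 : τx ≠ 0 := by
    rw [hτx, ← neg_sub (y : ℝ), ← neg_sub (z : ℝ), ← neg_sub (w : ℝ)]
    exact mul_ne_zero (mul_ne_zero (neg_ne_zero.2 hyx) (neg_ne_zero.2 hzx)) (neg_ne_zero.2 hwx)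
  have hy0 : τy ≠ 0 := by
    rw [hτy, ← neg_sub (z : ℝ), ← neg_sub (w : ℝ)]
    exact mul_ne_zero (mul_ne_zero hyx (neg_ne_zero.2 hzy)) (neg_ne_zero.2 hwy)
  have hz0 : τz ≠ 0 := by
    rw [hτz, ← neg_sub (w : ℝ)]
    exact mul_ne_zero (mul_ne_zero hzx hzy) (neg_ne_zero.2 hwz)
  obtain ⟨ε, hε, hεS⟩ := exists_pos_mul_add_pos
    (A * τw * (τx * orient (γ w) (γ y) (γ z) + τy * orient (γ x) (γ w) (γ z))) hpos
  -- the affine form with values proportional to `ε τx`, `ε τy`, `τz` at the points `x`, `y`, `z`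
  obtain ⟨α, hα⟩ : ∃ α : Fin 3 → ℝ, ∀ p, affineForm α p =
      A * (ε * τx * orient p (γ y) (γ z) + ε * τy * orient (γ x) p (γ z) +
        τz * orient (γ x) (γ y) p) := by
    refine ⟨![A * (ε * τx * (γ y 1 - γ z 1) + ε * τy * (γ z 1 - γ x 1) + τz * (γ x 1 - γ y 1)),
      A * (ε * τx * (γ z 0 - γ y 0) + ε * τy * (γ x 0 - γ z 0) + τz * (γ y 0 - γ x 0)),
      A * (ε * τx * (γ y 0 * γ z 1 - γ y 1 * γ z 0) + ε * τy * (γ z 0 * γ x 1 - γ z 1 * γ x 0) +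
        τz * (γ x 0 * γ y 1 - γ x 1 * γ y 0))], fun p => ?_⟩
    simp only [affineForm, orient, Matrix.cons_val_zero, Matrix.cons_val_one, Matrix.cons_val]
    ring
  have vx : affineForm α (γ x) = A ^ 2 * (ε * τx) := by
    rw [hα, orient_self_left, orient_self_outer, ← hA]; ring
  have vy : affineForm α (γ y) = A ^ 2 * (ε * τy) := by
    rw [hα, orient_self_left, orient_self_right, ← hA]; ring
  have vz : affineForm α (γ z) = A ^ 2 * τz := by
    rw [hα, orient_self_outer, orient_self_right, ← hA]; ring
  have vw : affineForm α (γ w) = A * (ε * τx * orient (γ w) (γ y) (γ z) +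
      ε * τy * orient (γ x) (γ w) (γ z) + τz * B) := hα _
  have hα0 : α ≠ 0 := by
    rintro rfl
    have : A ^ 2 * τz = 0 := by rw [← vz]; simp [affineForm]
    exact (mul_ne_zero (pow_ne_zero 2 hA0) hz0) this
  have hA2 : 0 < A ^ 2 := by positivity
  refine not_forall_mul_prod_sub_pos (affineForm_periodic hγ α) (hc α hα0) hx hy hz hw ?_ ?_ ?_ ?_
  · rw [← hτx, vx]
    have : 0 < A ^ 2 * ε * τx ^ 2 := by positivity
    linarith
  · rw [← hτy, vy]
    have : 0 < A ^ 2 * ε * τy ^ 2 := by positivity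
    linarith
  · rw [← hτz, vz]
    have : 0 < A ^ 2 * τz ^ 2 := by positivity
    linarith
  · rw [← hτw, vw]
    linarith

/-- A triple of negative orientation could be exchanged, point by point, for a given triple of
positive orientation. -/
lemma vandermondeOrient_nonneg {T : ℕ} {γ : ℤ → Plane} (hγ : ∀ t, γ (t + T) = γ t)
    (hc : ∀ α : Fin 3 → ℝ, α ≠ 0 → ¬ Alternates T (fun t => affineForm α (γ t)))
    {a b c x y z : ℤ} (ha : 0 ≤ a ∧ a < T) (hb : 0 ≤ b ∧ b < T) (hc' : 0 ≤ c ∧ c < T)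
    (hx : 0 ≤ x ∧ x < T) (hy : 0 ≤ y ∧ y < T) (hz : 0 ≤ z ∧ z < T)
    (h : 0 < vandermondeOrient γ a b c) : 0 ≤ vandermondeOrient γ x y z := by
  have habc : orient (γ a) (γ b) (γ c) ≠ 0 := right_ne_zero_of_mul h.ne'
  have step : ∀ x y z : ℤ, 0 ≤ x ∧ x < T → 0 ≤ y ∧ y < T → 0 ≤ z ∧ z < T →
      vandermondeOrient γ x y z < 0 →
      ∃ w, (w = a ∨ w = b ∨ w = c) ∧ vandermondeOrient γ x y w < 0 := by
    intro x y z hx hy hz hneg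
    have hxy : γ x ≠ γ y := fun h0 => by
      simp [vandermondeOrient, h0, orient_self_left] at hneg
    have hxy' : x ≠ y := fun h0 => hxy (by rw [h0])
    obtain ⟨w, hw, hw0⟩ : ∃ w, (w = a ∨ w = b ∨ w = c) ∧ orient (γ x) (γ y) (γ w) ≠ 0 := by
      obtain ⟨α, hα, hαr⟩ := exists_affineForm_eq_orient hxy
      by_contra hcon
      push Not at hcon
      refine hα (eq_zero_of_affineForm_eq_zero habc ?_ ?_ ?_)
      · rw [hαr]; exact hcon a (by simp)
      · rw [hαr]; exact hcon b (by simp)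
      · rw [hαr]; exact hcon c (by simp)
    refine ⟨w, hw, ?_⟩
    have hwT : 0 ≤ w ∧ w < T := by rcases hw with rfl | rfl | rfl <;> assumption
    have hne : vandermondeOrient γ x y w ≠ 0 := by
      have h1 : y ≠ w := by rintro rfl; exact hw0 (orient_self_right _ _)
      have h2 : x ≠ w := by rintro rfl; exact hw0 (orient_self_outer _ _)
      refine mul_ne_zero (mul_ne_zero (mul_ne_zero ?_ ?_) ?_) hw0 <;>
        · rw [sub_ne_zero]; exact_mod_cast Ne.symm (by assumption)
    by_contra hcon
    have := vandermondeOrient_exchange hγ hc hx hy hwT hz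
      (lt_of_le_of_ne (not_lt.1 hcon) hne.symm)
    linarith
  by_contra hneg
  rw [not_le] at hneg
  have hmem : ∀ w, (w = a ∨ w = b ∨ w = c) → 0 ≤ w ∧ w < T := by
    rintro w (rfl | rfl | rfl) <;> assumption
  obtain ⟨w₁, hw₁, h₁⟩ := step x y z hx hy hz hneg
  rw [← vandermondeOrient_rotate] at h₁
  obtain ⟨w₂, hw₂, h₂⟩ := step y w₁ x hy (hmem _ hw₁) hx h₁
  rw [← vandermondeOrient_rotate] at h₂
  obtain ⟨w₃, hw₃, h₃⟩ := step w₁ w₂ y (hmem _ hw₁) (hmem _ hw₂) hy h₂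
  unfold vandermondeOrient orient at h h₃
  rcases hw₁ with rfl | rfl | rfl <;> rcases hw₂ with rfl | rfl | rfl <;>
    rcases hw₃ with rfl | rfl | rfl <;> linarith

lemma exists_weaklyOriented_of_not_alternates {T : ℕ} {γ : ℤ → Plane}
    (hγ : ∀ t, γ (t + T) = γ t)
    (hc : ∀ α : Fin 3 → ℝ, α ≠ 0 → ¬ Alternates T (fun t => affineForm α (γ t))) :
    ∃ σ : ℝ, σ ≠ 0 ∧ WeaklyOriented σ T γ := by
  have hV : ∀ i j k : ℤ, i < j → j < k → (0 : ℝ) < ((j : ℝ) - i) * (k - j) * (k - i) := by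
    intro i j k hij hjk
    have h1 : (0 : ℝ) < j - i := by exact_mod_cast sub_pos.2 hij
    have h2 : (0 : ℝ) < k - j := by exact_mod_cast sub_pos.2 hjk
    have h3 : (0 : ℝ) < k - i := by linarith
    positivity
  by_cases hp : ∃ i j k : ℤ, 0 ≤ i ∧ i < j ∧ j < k ∧ k < T ∧ 0 < orient (γ i) (γ j) (γ k)
  · obtain ⟨a, b, c, ha, hab, hbc, hcT, habc⟩ := hp
    refine ⟨1, one_ne_zero, weaklyOriented_of_lt hγ ?_⟩
    refine (forall_sorted_iff_forall_cyclic hγ (fun r => 0 ≤ 1 * r)).1 ?_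
    intro i j k hi hij hjk hk
    have := vandermondeOrient_nonneg hγ hc (a := a) (b := b) (c := c) (x := i) (y := j) (z := k)
      (by omega) (by omega) (by omega) (by omega) (by omega) (by omega)
      (mul_pos (hV a b c hab hbc) habc)
    rw [one_mul]
    exact nonneg_of_mul_nonneg_right this (hV i j k hij hjk)
  · push Not at hp
    refine ⟨-1, by norm_num, weaklyOriented_of_lt hγ ?_⟩
    refine (forall_sorted_iff_forall_cyclic hγ (fun r => 0 ≤ -1 * r)).1 ?_
    intro i j k hi hij hjk hk
    linarith [hp i j k hi hij hjk hk]

/-- If an affine form alternates, all terms of the dependence between the four points have the same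
sign, so the points are collinear; then a point off their line contradicts weak orientation. -/
lemma WeaklyOriented.not_alternates {σ : ℝ} (hσ : σ ≠ 0) {T : ℕ} {γ : ℤ → Plane}
    (hγ : ∀ t, γ (t + T) = γ t) (hspan : SpansPlane γ) (h : WeaklyOriented σ T γ)
    (α : Fin 3 → ℝ) : ¬ Alternates T (fun t => affineForm α (γ t)) := by
  set f : ℤ → ℝ := fun t => affineForm α (γ t) with hf
  -- four collinear points along which `f` alternates cannot be complemented by a fifth point
  have key : ∀ a b c e : ℤ, a < b → b < c → c < e → e < a + T → f a * f b < 0 → f b * f c < 0 →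
      orient (γ a) (γ b) (γ c) = 0 → orient (γ a) (γ b) (γ e) = 0 := by
    intro a b c e hab hbc hce hea h1 h2 habc
    have hne : γ a ≠ γ b := fun h0 => by
      simp only [hf, h0] at h1; nlinarith [mul_self_nonneg (affineForm α (γ b))]
    obtain ⟨s, hs0, hs1⟩ := exists_param_of_orient_eq_zero hne habc
    have hprop : orient (γ b) (γ c) (γ e) * (f b - f a) =
        (f c - f b) * orient (γ a) (γ b) (γ e) := by
      simp only [hf, orient, affineForm, hs0, hs1]
      ring
    have o1 := h a b e hab.le (by omega) (by omega)
    have o2 := h b c e hbc.le (by omega) (by omega)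
    have hopp : (f c - f b) * (f b - f a) < 0 := by
      nlinarith [mul_pos_of_neg_of_neg h1 h2, sq_nonneg (f b), mul_self_nonneg (f a)]
    have h3 : 0 ≤ (f c - f b) * (f b - f a) * (σ * orient (γ a) (γ b) (γ e)) := by
      have : (f c - f b) * (f b - f a) * (σ * orient (γ a) (γ b) (γ e)) =
        (f b - f a) ^ 2 * (σ * orient (γ b) (γ c) (γ e)) := by
          linear_combination (-(f b - f a) * σ) * hprop
      rw [this]; positivity
    have h4 : σ * orient (γ a) (γ b) (γ e) = 0 := by nlinarith
    exact (mul_eq_zero.1 h4).resolve_left hσ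
  rintro ⟨a, b, c, d, hab, hbc, hcd, hda, ha, hb, hc, hd⟩
  have dep := affineForm_dependence α (γ a) (γ b) (γ c) (γ d)
  have o1 := mul_nonneg (h b c d hbc.le hcd.le (by omega)) ha.le
  have o2 := mul_nonneg (h a c d (by omega) hcd.le (by omega)) (neg_nonneg.2 hb.le)
  have o3 := mul_nonneg (h a b d hab.le (by omega) (by omega)) hc.le
  have o4 := mul_nonneg (h a b c hab.le (by omega) (by omega)) (neg_nonneg.2 hd.le)
  simp only [hf] at o1 o2 o3 o4 ha hb hc hd
  have hsum : σ * orient (γ b) (γ c) (γ d) * affineForm α (γ a) +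
      σ * orient (γ a) (γ c) (γ d) * -affineForm α (γ b) +
      σ * orient (γ a) (γ b) (γ d) * affineForm α (γ c) +
      σ * orient (γ a) (γ b) (γ c) * -affineForm α (γ d) = 0 := by
    linear_combination σ * dep
  have z1 : orient (γ b) (γ c) (γ d) = 0 := by
    have : σ * orient (γ b) (γ c) (γ d) * affineForm α (γ a) = 0 := by linarith
    simpa [hσ, ha.ne'] using this
  have z2 : orient (γ a) (γ c) (γ d) = 0 := by
    have : σ * orient (γ a) (γ c) (γ d) * -affineForm α (γ b) = 0 := by linarith
    simpa [hσ, hb.ne] using this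
  have z3 : orient (γ a) (γ b) (γ d) = 0 := by
    have : σ * orient (γ a) (γ b) (γ d) * affineForm α (γ c) = 0 := by linarith
    simpa [hσ, hc.ne'] using this
  have z4 : orient (γ a) (γ b) (γ c) = 0 := by
    have : σ * orient (γ a) (γ b) (γ c) * -affineForm α (γ d) = 0 := by linarith
    simpa [hσ, hd.ne] using this
  have hne : γ a ≠ γ b := fun h0 => by rw [h0] at ha; linarith
  obtain ⟨e₀, he₀⟩ := hspan.exists_orient_ne_zero hne
  -- move the fifth index into the period that starts at `a`
  have hT : (0 : ℤ) < T := by omega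
  set e := a + (e₀ - a) % T with he
  have hγe : γ e = γ e₀ := by
    have := Int.emod_add_mul_ediv (e₀ - a) T
    rw [← periodic_add_mul hγ ((e₀ - a) / T) e]
    congr 1
    omega
  have hea : a ≤ e := by have := Int.emod_nonneg (e₀ - a) hT.ne'; omega
  have heT : e < a + T := by have := Int.emod_lt_of_pos (e₀ - a) hT; omega
  rw [← hγe] at he₀
  have per : ∀ t, f (t + T) = f t := fun t => by simp only [hf, hγ]
  -- on the line, vanishing of the orientation with `e` does not depend on the two points
  have transfer : ∀ p q : Plane, p ≠ q → orient (γ a) (γ b) p = 0 → orient (γ a) (γ b) q = 0 →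
      orient p q (γ e) = 0 → orient (γ a) (γ b) (γ e) = 0 := by
    intro p q hpq hp hq hz
    obtain ⟨s, hs0, hs1⟩ := exists_param_of_orient_eq_zero hne hp
    obtain ⟨r, hr0, hr1⟩ := exists_param_of_orient_eq_zero hne hq
    have hsr : r - s ≠ 0 := fun h0 => by
      have : r = s := by linarith
      subst this
      exact hpq (plane_ext (by rw [hs0, hr0]) (by rw [hs1, hr1]))
    have : (r - s) * orient (γ a) (γ b) (γ e) = 0 := by
      rw [← hz]
      simp only [orient, hs0, hs1, hr0, hr1]
      ring
    exact (mul_eq_zero.1 this).resolve_left hsr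
  have hbcne : γ b ≠ γ c := fun h0 => by rw [h0] at hb; linarith
  have hcdne : γ c ≠ γ d := fun h0 => by rw [h0] at hc; linarith
  have hdane : γ d ≠ γ a := fun h0 => by rw [h0] at hd; linarith
  apply he₀
  rcases lt_or_ge e b with h1 | h1
  · rcases hea.eq_or_lt with h2 | h2
    · rw [← h2]; exact orient_self_outer _ _
    · refine transfer _ _ hbcne (orient_self_right _ _) z4 ?_
      rw [← hγ e]
      exact key b c d (e + T) hbc hcd (by omega) (by omega) (mul_neg_of_neg_of_pos hb hc)
        (mul_neg_of_pos_of_neg hc hd) z1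
  rcases lt_or_ge e c with h2 | h2
  · rcases h1.eq_or_lt with h3 | h3
    · rw [← h3]; exact orient_self_right _ _
    · refine transfer _ _ hcdne z4 z3 ?_
      rw [← hγ e]
      refine key c d (a + T) (e + T) hcd hda (by omega) (by omega) (mul_neg_of_pos_of_neg hc hd)
        ?_ ?_
      · rw [per]; exact mul_neg_of_neg_of_pos hd ha
      · rw [hγ, ← orient_rotate]; exact z2
  rcases lt_or_ge e d with h3 | h3
  · rcases h2.eq_or_lt with h4 | h4
    · rw [← h4]; exact z4
    · refine transfer _ _ hdane z3 (orient_self_outer _ _) ?_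
      rw [← hγ e, ← hγ a]
      refine key d (a + T) (b + T) (e + T) hda (by omega) (by omega) (by omega) ?_ ?_ ?_
      · rw [per]; exact mul_neg_of_neg_of_pos hd ha
      · rw [per, per]; exact mul_neg_of_pos_of_neg ha hb
      · rw [hγ, hγ, orient_rotate]; exact z3
  · rcases h3.eq_or_lt with h4 | h4
    · rw [← h4]; exact z3
    · exact key a b c e hab hbc (by omega) (by omega) (mul_neg_of_pos_of_neg ha hb)
        (mul_neg_of_neg_of_pos hb hc) z4

/-- All terms of the dependence have the same sign, so the affine form vanishes at points that are
not collinear. -/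
lemma not_weaklyAlternates_of_orient_pos {σ : ℝ} {T : ℕ} {γ : ℤ → Plane}
    (h : ∀ i j k : ℤ, i < j → j < k → k < i + T → 0 < σ * orient (γ i) (γ j) (γ k))
    {α : Fin 3 → ℝ} (hα : α ≠ 0) : ¬ WeaklyAlternates T (fun t => affineForm α (γ t)) := by
  rintro ⟨a, b, c, d, hab, hbc, hcd, hda, ha, hb, hc, hd⟩
  have dep := affineForm_dependence α (γ a) (γ b) (γ c) (γ d)
  have p1 := h b c d hbc hcd (by omega)
  have p2 := h a c d (by omega) hcd (by omega)
  have p3 := h a b d hab (by omega) (by omega)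
  have p4 := h a b c hab hbc (by omega)
  have o1 := mul_nonneg p1.le ha
  have o2 := mul_nonneg p2.le (neg_nonneg.2 hb)
  have o3 := mul_nonneg p3.le hc
  have o4 := mul_nonneg p4.le (neg_nonneg.2 hd)
  have hsum : σ * orient (γ b) (γ c) (γ d) * affineForm α (γ a) +
      σ * orient (γ a) (γ c) (γ d) * -affineForm α (γ b) +
      σ * orient (γ a) (γ b) (γ d) * affineForm α (γ c) +
      σ * orient (γ a) (γ b) (γ c) * -affineForm α (γ d) = 0 := by
    linear_combination σ * dep
  refine hα (eq_zero_of_affineForm_eq_zero (right_ne_zero_of_mul p4.ne') ?_ ?_ ?_)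
  · have : σ * orient (γ b) (γ c) (γ d) * affineForm α (γ a) = 0 := by linarith
    exact (mul_eq_zero.1 this).resolve_left p1.ne'
  · have : σ * orient (γ a) (γ c) (γ d) * -affineForm α (γ b) = 0 := by linarith
    exact neg_eq_zero.1 ((mul_eq_zero.1 this).resolve_left p2.ne')
  · have : σ * orient (γ a) (γ b) (γ d) * affineForm α (γ c) = 0 := by linarith
    exact (mul_eq_zero.1 this).resolve_left p3.ne'

/-! ### The polygonal curve -/

lemma polygonCurve_eq {γ : ℤ → Plane} {i : ℤ} {s : ℝ} (h1 : i ≤ s) (h2 : s ≤ i + 1) :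
    polygonCurve γ s = (1 - (s - i)) • γ i + (s - i) • γ (i + 1) := by
  rcases h2.eq_or_lt with rfl | h2
  · have : (i : ℝ) + 1 = ((i + 1 : ℤ) : ℝ) := by push_cast; ring
    rw [polygonCurve, this]
    simp
  · have hf : ⌊s⌋ = i := Int.floor_eq_iff.2 ⟨h1, h2⟩
    have hfr : Int.fract s = s - i := by rw [← hf]; rfl
    rcases h1.eq_or_lt with rfl | h1
    · simp [polygonCurve]
    · have hc : ⌈s⌉ = i + 1 := Int.ceil_eq_iff.2 ⟨by push_cast; linarith, by push_cast; linarith⟩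
      rw [polygonCurve, hf, hc, hfr]

lemma polygonCurve_intCast (γ : ℤ → Plane) (i : ℤ) : polygonCurve γ i = γ i := by
  simp [polygonCurve]

lemma polygonCurve_eq_floor (γ : ℤ → Plane) (s : ℝ) :
    polygonCurve γ s = (1 - Int.fract s) • γ ⌊s⌋ + Int.fract s • γ (⌊s⌋ + 1) :=
  polygonCurve_eq (Int.floor_le s) (Int.lt_floor_add_one s).le

lemma polygonCurve_add_period {T : ℕ} {γ : ℤ → Plane} (hγ : ∀ t, γ (t + T) = γ t) (s : ℝ) :
    polygonCurve γ (s + T) = polygonCurve γ s := by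
  simp [polygonCurve, hγ]

lemma polygonCurve_sub_period {T : ℕ} {γ : ℤ → Plane} (hγ : ∀ t, γ (t + T) = γ t) (s : ℝ) :
    polygonCurve γ (s - T) = polygonCurve γ s := by
  rw [← polygonCurve_add_period hγ, sub_add_cancel]

lemma polygonCurve_mem {γ : ℤ → Plane} {S : Set Plane} (hS : Convex ℝ S) {s : ℝ}
    (h1 : γ ⌊s⌋ ∈ S) (h2 : γ (⌊s⌋ + 1) ∈ S) : polygonCurve γ s ∈ S := by
  rw [polygonCurve_eq_floor]
  exact hS h1 h2 (sub_nonneg.2 (Int.fract_lt_one s).le) (Int.fract_nonneg s) (by ring)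

lemma continuous_polygonCurve (γ : ℤ → Plane) : Continuous (polygonCurve γ) := by
  have hseg : ∀ i : ℤ, ContinuousOn (polygonCurve γ) (Set.Icc (i : ℝ) (i + 1)) := by
    intro i
    have : Continuous fun s : ℝ => (1 - (s - i)) • γ i + (s - i) • γ (i + 1) := by fun_prop
    exact this.continuousOn.congr fun s hs => polygonCurve_eq hs.1 hs.2
  rw [continuous_iff_continuousAt]
  intro s
  have hU : ContinuousOn (polygonCurve γ)
      (Set.Icc ((⌊s⌋ - 1 : ℤ) : ℝ) ((⌊s⌋ - 1 : ℤ) + 1) ∪ Set.Icc (⌊s⌋ : ℝ) (⌊s⌋ + 1)) :=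
    (hseg _).union_of_isClosed (hseg _) isClosed_Icc isClosed_Icc
  refine hU.continuousAt (Filter.mem_of_superset
    (Ioo_mem_nhds (a := (⌊s⌋ : ℝ) - 1) (b := ⌊s⌋ + 1) ?_ (Int.lt_floor_add_one s)) ?_)
  · linarith [Int.floor_le s]
  · intro r hr
    rcases le_total r ⌊s⌋ with h | h
    · left; constructor <;> push_cast <;> linarith [hr.1]
    · right; exact ⟨h, hr.2.le⟩

lemma orient_combo_right (p q a b : Plane) (t : ℝ) :
    orient p q ((1 - t) • a + t • b) = (1 - t) * orient p q a + t * orient p q b := by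
  simp [orient]; ring

lemma affineForm_combo (α : Fin 3 → ℝ) (a b : Plane) (t : ℝ) :
    affineForm α ((1 - t) • a + t • b) = (1 - t) * affineForm α a + t * affineForm α b := by
  simp [affineForm]; ring

/-- Within one edge, the orientation with a third point is proportional to the length. -/
lemma orient_polygonCurve_same_edge (γ : ℤ → Plane) {i : ℤ} {s t : ℝ} (hs : i ≤ s) (hs' : s ≤ i + 1)
    (ht : i ≤ t) (ht' : t ≤ i + 1) (p : Plane) :
    orient (polygonCurve γ s) (polygonCurve γ t) p = (t - s) * orient (γ i) (γ (i + 1)) p := by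
  rw [polygonCurve_eq hs hs', polygonCurve_eq ht ht']
  simp [orient]; ring

namespace WeaklyOriented

variable {σ : ℝ} {T : ℕ} {γ : ℤ → Plane}

lemma orient_edge_nonneg (h : WeaklyOriented σ T γ) (hγ : ∀ t, γ (t + T) = γ t) (hT : 0 < T)
    (i k : ℤ) : 0 ≤ σ * orient (γ i) (γ (i + 1)) (γ k) := by
  have hT' : (0 : ℤ) < T := by exact_mod_cast hT
  have h0 := Int.emod_nonneg (k - i) hT'.ne'
  have h1 := Int.emod_lt_of_pos (k - i) hT'
  have hk : γ k = γ (i + (k - i) % T) := by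
    rw [← periodic_add_mul hγ ((k - i) / T) (i + (k - i) % T)]
    congr 1
    linarith [Int.emod_add_mul_ediv (k - i) T]
  rw [hk]
  rcases h0.eq_or_lt with h0 | h0
  · rw [← h0, add_zero, orient_self_outer, mul_zero]
  · exact h _ _ _ (by omega) (by omega) (by omega)

lemma orient_edge_curve_nonneg (h : WeaklyOriented σ T γ) (hγ : ∀ t, γ (t + T) = γ t) (hT : 0 < T)
    (i : ℤ) (s : ℝ) : 0 ≤ σ * orient (γ i) (γ (i + 1)) (polygonCurve γ s) := by
  rw [polygonCurve_eq_floor, orient_combo_right]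
  have h1 := mul_nonneg (sub_nonneg.2 (Int.fract_lt_one s).le)
    (h.orient_edge_nonneg hγ hT i ⌊s⌋)
  have h2 := mul_nonneg (Int.fract_nonneg s) (h.orient_edge_nonneg hγ hT i (⌊s⌋ + 1))
  linarith

/-- Weak orientation extends to real parameters, since the orientation is affine in each point. -/
lemma orient_polygonCurve_nonneg (h : WeaklyOriented σ T γ) (hγ : ∀ t, γ (t + T) = γ t)
    (hT : 0 < T) {r s t : ℝ} (hrs : r ≤ s) (hst : s ≤ t) (htr : t ≤ r + T) :
    0 ≤ σ * orient (polygonCurve γ r) (polygonCurve γ s) (polygonCurve γ t) := by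
  -- the orientation of two vertices and one point of the curve
  have one : ∀ (i j : ℤ) (t : ℝ), i ≤ j → j ≤ t → t ≤ i + T →
      0 ≤ σ * orient (γ i) (γ j) (polygonCurve γ t) := by
    intro i j t hij hjt hti
    have hjf : j ≤ ⌊t⌋ := Int.le_floor.2 hjt
    rcases hti.eq_or_lt with rfl | hti
    · rw [polygonCurve_add_period hγ, polygonCurve_intCast, orient_self_outer, mul_zero]
    · have hf : ⌊t⌋ < i + T := Int.floor_lt.2 (by push_cast; exact hti)
      rw [polygonCurve_eq_floor, orient_combo_right]
      have h1 := mul_nonneg (sub_nonneg.2 (Int.fract_lt_one t).le)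
        (h i j ⌊t⌋ hij hjf hf.le)
      have h2 := mul_nonneg (Int.fract_nonneg t) (h i j (⌊t⌋ + 1) hij (by omega) (by omega))
      linarith
  -- the orientation of one vertex and two points of the curve
  have two : ∀ (i : ℤ) (s t : ℝ), i ≤ s → s ≤ t → t ≤ i + T →
      0 ≤ σ * orient (γ i) (polygonCurve γ s) (polygonCurve γ t) := by
    intro i s t his hst hti
    have hf0 := Int.floor_le s
    have hf1 := (Int.lt_floor_add_one s).le
    have hif : i ≤ ⌊s⌋ := Int.le_floor.2 his
    rcases le_or_gt t (⌊s⌋ + 1) with ht | ht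
    · rw [orient_rotate, orient_polygonCurve_same_edge γ hf0 hf1 (hf0.trans hst) ht]
      have := mul_nonneg (sub_nonneg.2 hst) (h.orient_edge_nonneg hγ hT ⌊s⌋ i)
      linarith
    · rw [orient_rotate, orient_rotate, polygonCurve_eq_floor γ s, orient_combo_right]
      have h1 := one i ⌊s⌋ t hif (by linarith) hti
      have h2 := one i (⌊s⌋ + 1) t (by omega) (by push_cast; linarith) hti
      rw [orient_rotate, orient_rotate] at h1 h2
      have h3 := mul_nonneg (sub_nonneg.2 (Int.fract_lt_one s).le) h1
      have h4 := mul_nonneg (Int.fract_nonneg s) h2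
      linarith
  set i := ⌊r⌋ with hi
  have hi0 : (i : ℝ) ≤ r := Int.floor_le r
  have hi1 : r ≤ i + 1 := (Int.lt_floor_add_one r).le
  rcases le_or_gt s (i + 1) with hs | hs
  · rw [orient_polygonCurve_same_edge γ hi0 hi1 (hi0.trans hrs) hs]
    have := mul_nonneg (sub_nonneg.2 hrs) (h.orient_edge_curve_nonneg hγ hT i t)
    linarith
  rcases le_or_gt t (i + T) with ht | ht
  · rw [orient_rotate, polygonCurve_eq_floor γ r, orient_combo_right, ← hi]
    have h1 := two i s t (by linarith) hst ht
    have h2 := two (i + 1) s t (by push_cast; linarith) hst (by push_cast; linarith)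
    rw [orient_rotate] at h1 h2
    have h3 := mul_nonneg (sub_nonneg.2 (Int.fract_lt_one r).le) h1
    have h4 := mul_nonneg (Int.fract_nonneg r) h2
    linarith
  · rw [← polygonCurve_sub_period hγ t, ← orient_rotate,
      orient_polygonCurve_same_edge γ (by linarith) (by linarith) hi0 hi1]
    have := mul_nonneg (show 0 ≤ r - (t - T) by linarith)
      (h.orient_edge_curve_nonneg hγ hT i s)
    linarith

/-- If `P r = P s = x`, then `x` is collinear with any two points of the two arcs between them; so
if neither arc is constant, then the whole curve lies on a line. -/
lemma isSimpleClosedCurve (h : WeaklyOriented σ T γ) (hσ : σ ≠ 0) (hγ : ∀ t, γ (t + T) = γ t)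
    (hT : 0 < T) (hspan : SpansPlane γ) : IsSimpleClosedCurve T (polygonCurve γ) := by
  intro s t _ hst _ heq
  by_contra hcon
  push Not at hcon
  obtain ⟨⟨a, ha, hPa⟩, ⟨b, hb, hPb⟩⟩ := hcon
  have hT' : (0 : ℝ) < T := by exact_mod_cast hT
  set x := polygonCurve γ s with hx
  have col : ∀ a ∈ Set.Icc s t, ∀ b ∈ Set.Icc t (s + T),
      orient x (polygonCurve γ a) (polygonCurve γ b) = 0 := by
    intro a ha b hb
    have h1 := h.orient_polygonCurve_nonneg hγ hT ha.1 (ha.2.trans hb.1) hb.2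
    have h2 := h.orient_polygonCurve_nonneg hγ hT ha.2 hb.1 (by linarith [hb.2, ha.1])
    rw [← heq, orient_swap] at h2
    rw [← hx] at h1
    have : σ * orient x (polygonCurve γ a) (polygonCurve γ b) = 0 := by linarith
    exact (mul_eq_zero.1 this).resolve_left hσ
  obtain ⟨α, hα, hαr⟩ := exists_affineForm_eq_orient (Ne.symm hPa)
  -- the line through `x` and `P a` contains both arcs
  have arc2 : ∀ c ∈ Set.Icc t (s + T), affineForm α (polygonCurve γ c) = 0 := fun c hc => by
    rw [hαr]; exact col a ha c hc
  have arc1 : ∀ c ∈ Set.Icc s t, affineForm α (polygonCurve γ c) = 0 := fun c hc => by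
    have h1 := col c hc b hb
    have h2 := col a ha b hb
    rw [hαr]
    rw [orient_rotate, orient_rotate] at h1 h2
    obtain ⟨u, hu0, hu1⟩ := exists_param_of_orient_eq_zero hPb
      (r := polygonCurve γ a) (by rw [← h2, orient_rotate])
    obtain ⟨v, hv0, hv1⟩ := exists_param_of_orient_eq_zero hPb
      (r := polygonCurve γ c) (by rw [← h1, orient_rotate])
    simp only [orient, hu0, hu1, hv0, hv1]
    ring
  obtain ⟨k, hk⟩ := hspan α hα
  apply hk
  have hmem := toIcoMod_mem_Ico hT' s (k : ℝ)
  have hPk : polygonCurve γ (toIcoMod hT' s (k : ℝ)) = γ k := by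
    have hper : Function.Periodic (polygonCurve γ) (T : ℝ) := polygonCurve_add_period hγ
    rw [toIcoMod, hper.sub_zsmul_eq, polygonCurve_intCast]
  rw [← hPk]
  rcases le_total (toIcoMod hT' s (k : ℝ)) t with hle | hle
  · exact arc1 _ ⟨hmem.1, hle⟩
  · exact arc2 _ ⟨hle, hmem.2.le⟩

end WeaklyOriented

/-! ### The convex hull of the contour -/

/-- The convex hull of the points of `γ`. -/
def contourHull (γ : ℤ → Plane) : Set Plane := convexHull ℝ (Set.range γ)

lemma convex_contourHull (γ : ℤ → Plane) : Convex ℝ (contourHull γ) := convex_convexHull ℝ _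

lemma mem_contourHull (γ : ℤ → Plane) (t : ℤ) : γ t ∈ contourHull γ :=
  subset_convexHull ℝ _ (Set.mem_range_self t)

lemma finite_range_of_periodic {T : ℕ} (hT : 0 < T) {γ : ℤ → Plane}
    (hγ : ∀ t, γ (t + T) = γ t) : (Set.range γ).Finite := by
  refine ((Set.finite_Ico (0 : ℤ) T).image γ).subset ?_
  rintro _ ⟨t, rfl⟩
  have hT' : (0 : ℤ) < T := by exact_mod_cast hT
  exact ⟨t % T, ⟨Int.emod_nonneg t hT'.ne', Int.emod_lt_of_pos t hT'⟩, periodic_emod hγ t⟩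

lemma isCompact_contourHull {T : ℕ} (hT : 0 < T) {γ : ℤ → Plane} (hγ : ∀ t, γ (t + T) = γ t) :
    IsCompact (contourHull γ) :=
  (finite_range_of_periodic hT hγ).isCompact_convexHull ℝ

lemma polygonCurve_mem_contourHull (γ : ℤ → Plane) (s : ℝ) : polygonCurve γ s ∈ contourHull γ :=
  polygonCurve_mem (convex_contourHull γ) (mem_contourHull γ _) (mem_contourHull γ _)

lemma range_polygonCurve {T : ℕ} (hT : 0 < T) {γ : ℤ → Plane} (hγ : ∀ t, γ (t + T) = γ t) :
    polygonCurve γ '' Set.Ico (0 : ℝ) T = Set.range (polygonCurve γ) := by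
  refine Set.Subset.antisymm (Set.image_subset_range _ _) ?_
  rintro _ ⟨s, rfl⟩
  have hT' : (0 : ℝ) < T := by exact_mod_cast hT
  refine ⟨toIcoMod hT' 0 s, by simpa using toIcoMod_mem_Ico hT' 0 s, ?_⟩
  have hper : Function.Periodic (polygonCurve γ) (T : ℝ) := polygonCurve_add_period hγ
  rw [toIcoMod, hper.sub_zsmul_eq]

lemma isCompact_range_polygonCurve {T : ℕ} (hT : 0 < T) {γ : ℤ → Plane}
    (hγ : ∀ t, γ (t + T) = γ t) : IsCompact (Set.range (polygonCurve γ)) := by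
  have : Set.range (polygonCurve γ) = polygonCurve γ '' Set.Icc (0 : ℝ) T := by
    refine Set.Subset.antisymm ?_ (Set.image_subset_range _ _)
    rw [← range_polygonCurve hT hγ]
    exact Set.image_mono Set.Ico_subset_Icc_self
  rw [this]
  exact isCompact_Icc.image (continuous_polygonCurve γ)

/-- Continuous linear functionals on the plane, shifted by a constant, are affine forms. -/
lemma exists_affineForm_eq_dual (f : StrongDual ℝ Plane) (c : ℝ) :
    ∃ α : Fin 3 → ℝ, (f ≠ 0 → α ≠ 0) ∧ ∀ p, affineForm α p = f p - c := by
  have hf : ∀ p : Plane, f p =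
      f (EuclideanSpace.single 0 1) * p 0 + f (EuclideanSpace.single 1 1) * p 1 := by
    intro p
    have hp : p = p 0 • EuclideanSpace.single 0 (1 : ℝ) + p 1 • EuclideanSpace.single 1 (1 : ℝ) :=
      plane_ext (by simp) (by simp)
    conv_lhs => rw [hp, map_add, map_smul, map_smul, smul_eq_mul, smul_eq_mul]
    ring
  refine ⟨![f (EuclideanSpace.single 0 1), f (EuclideanSpace.single 1 1), -c], ?_, ?_⟩
  · intro hne h0
    apply hne
    have h1 := congrFun h0 0
    have h2 := congrFun h0 1
    simp only [Matrix.cons_val_zero, Matrix.cons_val_one, Pi.zero_apply] at h1 h2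
    ext p
    rw [hf p, h1, h2]
    simp
  · intro p
    rw [hf p]
    simp [affineForm]
    ring

lemma SpansPlane.interior_contourHull_nonempty {γ : ℤ → Plane} (h : SpansPlane γ) :
    (interior (contourHull γ)).Nonempty := by
  rw [contourHull, interior_convexHull_nonempty_iff_affineSpan_eq_top,
    AffineSubspace.affineSpan_eq_top_iff_vectorSpan_eq_top_of_nonempty ℝ _ _
      (Set.range_nonempty γ)]
  by_contra hne
  obtain ⟨f, hf, hle⟩ := Submodule.exists_le_ker_of_lt_top _ (lt_top_iff_ne_top.2 hne)
  obtain ⟨α, hα, hαf⟩ := exists_affineForm_eq_dual (LinearMap.toContinuousLinearMap f) (f (γ 0))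
  obtain ⟨t, ht⟩ := h α (hα (by simpa using hf))
  apply ht
  have h1 : γ t -ᵥ γ 0 ∈ vectorSpan ℝ (Set.range γ) :=
    vsub_mem_vectorSpan ℝ (Set.mem_range_self t) (Set.mem_range_self 0)
  have h2 := hle h1
  rw [LinearMap.mem_ker, vsub_eq_sub, map_sub] at h2
  rw [hαf]
  exact h2

/-- A supporting line at a boundary point of the hull. -/
lemma exists_support {γ : ℤ → Plane} (hspan : SpansPlane γ) {y : Plane}
    (hy : y ∈ frontier (contourHull γ)) :
    ∃ α : Fin 3 → ℝ, α 0 ^ 2 + α 1 ^ 2 ≠ 0 ∧ affineForm α y = 0 ∧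
      ∀ p ∈ contourHull γ, affineForm α p ≤ 0 := by
  obtain ⟨f, hf, hle⟩ := geometric_hahn_banach_of_nonempty_interior_point (convex_contourHull γ)
    hy.2 hspan.interior_contourHull_nonempty
  obtain ⟨α, hα, hαf⟩ := exists_affineForm_eq_dual f (f y)
  have hαy : affineForm α y = 0 := by rw [hαf, sub_self]
  refine ⟨α, ?_, hαy, fun p hp => ?_⟩
  · intro h0
    have h1 : α 0 = 0 := by nlinarith [sq_nonneg (α 0), sq_nonneg (α 1)]
    have h2 : α 1 = 0 := by nlinarith [sq_nonneg (α 0), sq_nonneg (α 1)]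
    apply hα hf
    funext i
    fin_cases i
    · exact h1
    · exact h2
    · simpa [affineForm, h1, h2] using hαy
  · rw [hαf]
    linarith [hle p hp]

/-- A linear form that, together with `affineForm α`, gives coordinates of the plane: it measures
the position along the lines on which `affineForm α` is constant. -/
noncomputable def alongForm (α : Fin 3 → ℝ) (p : Plane) : ℝ := α 1 * p 0 - α 0 * p 1

lemma continuous_alongForm (α : Fin 3 → ℝ) : Continuous (alongForm α) := by
  unfold alongForm; fun_prop

lemma continuous_affineForm (α : Fin 3 → ℝ) : Continuous (affineForm α) := by
  unfold affineForm; fun_prop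

lemma eq_of_affineForm_eq_of_alongForm_eq {α : Fin 3 → ℝ} (hα : α 0 ^ 2 + α 1 ^ 2 ≠ 0) {p q : Plane}
    (h1 : affineForm α p = affineForm α q) (h2 : alongForm α p = alongForm α q) : p = q := by
  unfold affineForm at h1
  unfold alongForm at h2
  have e0 : (α 0 ^ 2 + α 1 ^ 2) * (p 0 - q 0) = 0 := by
    linear_combination α 0 * h1 + α 1 * h2
  have e1 : (α 0 ^ 2 + α 1 ^ 2) * (p 1 - q 1) = 0 := by
    linear_combination α 1 * h1 - α 0 * h2
  exact plane_ext (sub_eq_zero.1 ((mul_eq_zero.1 e0).resolve_left hα))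
    (sub_eq_zero.1 ((mul_eq_zero.1 e1).resolve_left hα))

lemma orient_eq_of_affineForm_eq_zero {α : Fin 3 → ℝ} {p q : Plane} (hp : affineForm α p = 0)
    (hq : affineForm α q = 0) (r : Plane) :
    (α 0 ^ 2 + α 1 ^ 2) * orient p q r = (alongForm α q - alongForm α p) * affineForm α r := by
  unfold affineForm at *
  unfold orient alongForm
  linear_combination -(α 1 * (q 0 - p 0) - α 0 * (q 1 - p 1)) * hp +
    (α 0 * (r 1 - p 1) - α 1 * (r 0 - p 0)) * (hq - hp)

/-- A face of the hull is spanned by points of `γ`: if a point `x` of the hull lies on a supporting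
line, then some point of `γ` on that line is not beyond `x` in the direction of a given form. -/
lemma exists_affineForm_le_of_mem_face {γ : ℤ → Plane} {α : Fin 3 → ℝ} {x : Plane}
    (hx : x ∈ contourHull γ) (hαx : affineForm α x = 0)
    (hle : ∀ p ∈ contourHull γ, affineForm α p ≤ 0) (β : Fin 3 → ℝ) :
    ∃ i, affineForm α (γ i) = 0 ∧ affineForm β (γ i) ≤ affineForm β x := by
  by_contra hcon
  push Not at hcon
  -- otherwise `x` is outside of the following convex set, which contains all points of `γ`
  set L : Set Plane := {p | affineForm α p < 0 ∨
    affineForm α p = 0 ∧ affineForm β x < affineForm β p} with hL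
  have hconv : Convex ℝ L := by
    intro p hp q hq a b ha hb hab
    have e : ∀ ω, affineForm ω (a • p + b • q) = a * affineForm ω p + b * affineForm ω q := by
      intro ω
      simp [affineForm]
      linear_combination -ω 2 * hab
    rcases ha.eq_or_lt with rfl | ha
    · have : b = 1 := by linarith
      subst this
      simpa using hq
    rcases hb.eq_or_lt with rfl | hb
    · have : a = 1 := by linarith
      subst this
      simpa using hp
    simp only [hL, Set.mem_ofPred_eq, e] at hp hq ⊢
    rcases hp with hp | ⟨hp, hp'⟩ <;> rcases hq with hq | ⟨hq, hq'⟩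
    · left; nlinarith
    · left; rw [hq]; nlinarith
    · left; rw [hp]; nlinarith
    · right
      refine ⟨by rw [hp, hq]; ring, ?_⟩
      have : affineForm β x = a * affineForm β x + b * affineForm β x := by
        rw [← add_mul, hab, one_mul]
      nlinarith
  have hsub : contourHull γ ⊆ L := by
    refine convexHull_min ?_ hconv
    rintro _ ⟨i, rfl⟩
    rcases (hle _ (mem_contourHull γ i)).lt_or_eq with h | h
    · exact Or.inl h
    · exact Or.inr ⟨h, hcon i h⟩
  rcases hsub hx with h | h
  · linarith
  · linarith [h.2]

lemma affineForm_polygonCurve_eq_zero {γ : ℤ → Plane} {α : Fin 3 → ℝ} {i j : ℤ}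
    (h : ∀ k, i ≤ k → k ≤ j → affineForm α (γ k) = 0) {s : ℝ} (h1 : i ≤ s) (h2 : s ≤ j) :
    affineForm α (polygonCurve γ s) = 0 := by
  have hif : i ≤ ⌊s⌋ := Int.le_floor.2 h1
  rcases h2.eq_or_lt with rfl | h2
  · rw [polygonCurve_intCast]
    exact h j (by exact_mod_cast h1) le_rfl
  · have hjf : ⌊s⌋ < j := Int.floor_lt.2 h2
    rw [polygonCurve_eq_floor, affineForm_combo, h _ hif hjf.le, h _ (by omega) (by omega)]
    ring

/-- On a supporting line, the contour runs through the face without interruption: of the two arcs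
between two different points of the face, one stays on the line. -/
lemma WeaklyOriented.frontier_subset {σ : ℝ} {T : ℕ} {γ : ℤ → Plane} (h : WeaklyOriented σ T γ)
    (hσ : σ ≠ 0) (hγ : ∀ t, γ (t + T) = γ t) (hT : 0 < T) (hspan : SpansPlane γ) :
    frontier (contourHull γ) ⊆ Set.range (polygonCurve γ) := by
  intro x hx
  have hxK : x ∈ contourHull γ := (isCompact_contourHull hT hγ).isClosed.frontier_subset hx
  obtain ⟨α, hα, hαx, hle⟩ := exists_support hspan hx
  obtain ⟨i, hi, hix⟩ := exists_affineForm_le_of_mem_face hxK hαx hle ![α 1, -α 0, 0]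
  obtain ⟨j₀, hj₀, hjx₀⟩ := exists_affineForm_le_of_mem_face hxK hαx hle ![-α 1, α 0, 0]
  replace hix : alongForm α (γ i) ≤ alongForm α x := by
    simp [affineForm] at hix
    unfold alongForm
    linarith
  replace hjx₀ : alongForm α x ≤ alongForm α (γ j₀) := by
    simp [affineForm] at hjx₀
    unfold alongForm
    linarith
  have hT' : (0 : ℤ) < T := by exact_mod_cast hT
  obtain ⟨j, hij, hji, hj⟩ : ∃ j, i ≤ j ∧ j < i + T ∧ γ j = γ j₀ := by
    refine ⟨i + (j₀ - i) % T, ?_, ?_, ?_⟩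
    · have := Int.emod_nonneg (j₀ - i) hT'.ne'; omega
    · have := Int.emod_lt_of_pos (j₀ - i) hT'; omega
    · rw [← periodic_add_mul hγ ((j₀ - i) / T) (i + (j₀ - i) % T)]
      congr 1
      linarith [Int.emod_add_mul_ediv (j₀ - i) T]
  rw [← hj] at hj₀ hjx₀
  by_cases heq : alongForm α (γ i) = alongForm α (γ j)
  · refine ⟨i, ?_⟩
    rw [polygonCurve_intCast]
    exact eq_of_affineForm_eq_of_alongForm_eq hα (by rw [hi, hαx]) (by linarith)
  have hlt : 0 < alongForm α (γ j) - alongForm α (γ i) := by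
    have := lt_of_le_of_ne (hix.trans hjx₀) heq
    linarith
  have hα' : 0 < α 0 ^ 2 + α 1 ^ 2 := lt_of_le_of_ne (by positivity) hα.symm
  have horient := orient_eq_of_affineForm_eq_zero hi hj₀
  have hcont : Continuous fun s => alongForm α (polygonCurve γ s) :=
    (continuous_alongForm α).comp (continuous_polygonCurve γ)
  have harc : (∀ k, i ≤ k → k ≤ j → affineForm α (γ k) = 0) ∨
      (∀ k, j ≤ k → k ≤ i + T → affineForm α (γ k) = 0) := by
    by_contra hcon
    push Not at hcon
    obtain ⟨⟨e, he1, he2, he⟩, ⟨e', he1', he2', he'⟩⟩ := hcon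
    have heneg := lt_of_le_of_ne (hle _ (mem_contourHull γ e)) he
    have heneg' := lt_of_le_of_ne (hle _ (mem_contourHull γ e')) he'
    have o1 := h i e j he1 he2 hji.le
    have o2 := h i j e' hij he1' he2'
    rw [← orient_rotate, orient_swap] at o1
    have h1 := horient (γ e)
    have h2 := horient (γ e')
    have p1 := mul_neg_of_pos_of_neg hlt heneg
    have p2 := mul_neg_of_pos_of_neg hlt heneg'
    have n1 : orient (γ i) (γ j) (γ e) < 0 := by
      rw [← h1] at p1; exact neg_of_mul_neg_right p1 hα'.le
    have n2 : orient (γ i) (γ j) (γ e') < 0 := by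
      rw [← h2] at p2; exact neg_of_mul_neg_right p2 hα'.le
    rcases lt_or_gt_of_ne hσ with hs | hs <;> nlinarith
  rcases harc with harc | harc
  · obtain ⟨s, hs, hsx⟩ := intermediate_value_Icc (a := (i : ℝ)) (b := j) (by exact_mod_cast hij)
      hcont.continuousOn (show alongForm α x ∈ _ by
        rw [polygonCurve_intCast, polygonCurve_intCast]; exact ⟨hix, hjx₀⟩)
    refine ⟨s, eq_of_affineForm_eq_of_alongForm_eq hα ?_ hsx⟩
    rw [hαx]
    exact affineForm_polygonCurve_eq_zero harc hs.1 hs.2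
  · obtain ⟨s, hs, hsx⟩ := intermediate_value_Icc' (a := (j : ℝ)) (b := ((i + T : ℤ) : ℝ))
      (by exact_mod_cast hji.le) hcont.continuousOn (show alongForm α x ∈ _ by
        rw [polygonCurve_intCast, polygonCurve_intCast, hγ]; exact ⟨hix, hjx₀⟩)
    refine ⟨s, eq_of_affineForm_eq_of_alongForm_eq hα ?_ hsx⟩
    rw [hαx]
    exact affineForm_polygonCurve_eq_zero harc hs.1 hs.2

/-! ### The enclosed set -/

/-- From a point outside of a closed convex set one can escape to infinity. -/
lemma not_isBounded_connectedComponentIn {K C : Set Plane} (hK : Convex ℝ K) (hKc : IsClosed K)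
    (hCK : C ⊆ K) {x : Plane} (hx : x ∉ K) :
    ¬ Bornology.IsBounded (connectedComponentIn Cᶜ x) := by
  obtain ⟨f, u, hfK, hfx⟩ := geometric_hahn_banach_closed_point hK hKc hx
  by_cases hK0 : f = 0
  · -- the functional vanishes only if the convex set is empty; then the component is the plane
    have hCe : C = ∅ := by
      refine Set.eq_empty_of_forall_notMem fun c hc => ?_
      have := hfK c (hCK hc)
      simp [hK0] at this hfx
      linarith
    rw [hCe, Set.compl_empty, connectedComponentIn_univ,
      PreconnectedSpace.connectedComponent_eq_univ]
    exact NormedSpace.unbounded_univ ℝ Plane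
  · obtain ⟨v, hv⟩ : ∃ v, 0 < f v := by
      obtain ⟨v, hv⟩ : ∃ v, f v ≠ 0 := by
        by_contra hcon
        push Not at hcon
        exact hK0 (ContinuousLinearMap.ext hcon)
      rcases lt_or_gt_of_ne hv with h | h
      · exact ⟨-v, by simpa using h⟩
      · exact ⟨v, h⟩
    have hray : (fun r : ℝ => x + r • v) '' Set.Ici 0 ⊆ connectedComponentIn Cᶜ x := by
      refine IsPreconnected.subset_connectedComponentIn ?_ ⟨0, by simp, by simp⟩ ?_
      · exact isPreconnected_Ici.image _ (by fun_prop)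
      · rintro _ ⟨r, hr, rfl⟩ hc
        have h1 := hfK _ (hCK hc)
        have h2 : 0 ≤ r * f v := mul_nonneg hr hv.le
        rw [map_add, map_smul, smul_eq_mul] at h1
        linarith
    intro hb
    have hb' := (f.lipschitz.isBounded_image (hb.subset hray)).bddAbove
    obtain ⟨M, hM⟩ := hb'
    have hr : (0 : ℝ) ≤ (|M - f x| + 1) / f v := by positivity
    have := hM ⟨_, ⟨_, hr, rfl⟩, rfl⟩
    rw [map_add, map_smul, smul_eq_mul, div_mul_cancel₀ _ hv.ne'] at this
    linarith [le_abs_self (M - f x)]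

lemma enclosedSet_subset {K C : Set Plane} (hK : Convex ℝ K) (hKc : IsClosed K) (hCK : C ⊆ K) :
    enclosedSet C ⊆ K := by
  rintro x (hx | ⟨_, hx⟩)
  · exact hCK hx
  · by_contra hxK
    exact not_isBounded_connectedComponentIn hK hKc hCK hxK hx

lemma subset_enclosedSet {K C : Set Plane} (hKc : IsCompact K) (hCK : frontier K ⊆ C) :
    K ⊆ enclosedSet C := by
  intro x hx
  by_cases hxC : x ∈ C
  · exact Or.inl hxC
  refine Or.inr ⟨hxC, hKc.isBounded.subset ?_⟩
  have hxint : x ∈ interior K := by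
    by_contra hcon
    exact hxC (hCK ⟨subset_closure hx, hcon⟩)
  refine Set.Subset.trans ?_ interior_subset
  refine IsPreconnected.subset_left_of_subset_union isOpen_interior hKc.isClosed.isOpen_compl
    (disjoint_compl_right.mono_left interior_subset) ?_ ?_ isPreconnected_connectedComponentIn
  · intro y hy
    by_cases hyK : y ∈ K
    · left
      by_contra hcon
      exact connectedComponentIn_subset _ _ hy (hCK ⟨subset_closure hyK, hcon⟩)
    · exact Or.inr hyK
  · exact ⟨x, mem_connectedComponentIn hxC, hxint⟩

lemma WeaklyOriented.hasConvexPolygon {σ : ℝ} {T : ℕ} {γ : ℤ → Plane} (h : WeaklyOriented σ T γ)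
    (hσ : σ ≠ 0) (hγ : ∀ t, γ (t + T) = γ t) (hT : 0 < T) (hspan : SpansPlane γ) :
    HasConvexPolygon T γ := by
  refine ⟨h.isSimpleClosedCurve hσ hγ hT hspan, ?_⟩
  have hK := isCompact_contourHull hT hγ
  have heq : enclosedSet (polygonCurve γ '' Set.Ico (0 : ℝ) T) = contourHull γ := by
    rw [range_polygonCurve hT hγ]
    refine Set.Subset.antisymm (enclosedSet_subset (convex_contourHull γ) hK.isClosed ?_)
      (subset_enclosedSet hK (h.frontier_subset hσ hγ hT hspan))
    rintro _ ⟨s, rfl⟩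
    exact polygonCurve_mem_contourHull γ s
  rw [heq]
  exact convex_contourHull γ

/-! ### Polygons enclosing a convex set -/

/-- A sphere in the plane remains connected without one point, by stereographic projection. -/
lemma isPreconnected_sphere_diff_singleton {v : Plane} (hv : ‖v‖ = 1) :
    IsPreconnected (Metric.sphere (0 : Plane) 1 \ {v}) := by
  have hv' : v ∈ Metric.sphere (0 : Plane) 1 := by simpa using hv
  have h1 : IsPreconnected (Set.range (stereographic hv).symm) :=
    isPreconnected_range (continuous_stereoInvFun hv)
  rw [range_stereographic_symm hv hv'] at h1
  have h2 := h1.image _ continuous_subtype_val.continuousOn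
  convert h2 using 1
  ext x
  constructor
  · rintro ⟨hx, hxv⟩
    exact ⟨⟨x, hx⟩, fun h => hxv (congrArg Subtype.val h), rfl⟩
  · rintro ⟨⟨y, hy⟩, hyv, rfl⟩
    exact ⟨hy, fun h => hyv (Subtype.ext h)⟩

/-- The boundary of a planar convex body is a topological circle: it remains connected without any
one of its points. -/
lemma isPreconnected_frontier_diff_singleton {K : Set Plane} (hK : Convex ℝ K)
    (hne : (interior K).Nonempty) (hb : Bornology.IsBounded K) {y : Plane} (hy : y ∈ frontier K) :
    IsPreconnected (frontier K \ {y}) := by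
  obtain ⟨e, _, _, he⟩ := exists_homeomorph_image_interior_closure_frontier_eq_unitBall hK hne hb
  have hy' : ‖e y‖ = 1 := by
    have : e y ∈ Metric.sphere (0 : Plane) 1 := he ▸ Set.mem_image_of_mem e hy
    simpa using this
  have h := (isPreconnected_sphere_diff_singleton hy').image e.symm e.symm.continuous.continuousOn
  convert h using 1
  rw [← he, ← Set.image_singleton, ← Set.image_sdiff e.injective]
  simp [Set.image_image]

lemma exists_three_mem_frontier {K : Set Plane} (hK : Convex ℝ K)
    (hne : (interior K).Nonempty) (hb : Bornology.IsBounded K) :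
    ∃ x ∈ frontier K, ∃ y ∈ frontier K, ∃ z ∈ frontier K, x ≠ y ∧ y ≠ z ∧ x ≠ z := by
  obtain ⟨e, _, _, he⟩ := exists_homeomorph_image_interior_closure_frontier_eq_unitBall hK hne hb
  have hmem : ∀ v : Plane, ‖v‖ = 1 → e.symm v ∈ frontier K := by
    intro v hv
    have : v ∈ e '' frontier K := by rw [he]; simpa using hv
    obtain ⟨x, hx, rfl⟩ := this
    simpa using hx
  refine ⟨_, hmem (EuclideanSpace.single 0 1) (by simp), _, hmem (EuclideanSpace.single 1 1)
    (by simp), _, hmem (-EuclideanSpace.single 0 1) (by simp), ?_, ?_, ?_⟩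
  all_goals
    rw [e.symm.injective.ne_iff]
    intro h
    have := congrArg (fun p : Plane => p 0) h
    simp at this
    try linarith

/-- For a periodic curve, simplicity passes from the fundamental interval to all pairs of parameters
within one period. -/
lemma IsSimpleClosedCurve.of_periodic {T : ℕ} {P : ℝ → Plane} (h : IsSimpleClosedCurve T P)
    (hP : Function.Periodic P (T : ℝ)) (hT : 0 < T) {s t : ℝ} (hst : s ≤ t) (hts : t ≤ s + T)
    (heq : P s = P t) :
    (∀ r ∈ Set.Icc s t, P r = P s) ∨ (∀ r ∈ Set.Icc t (s + T), P r = P s) := by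
  have hT' : (0 : ℝ) < T := by exact_mod_cast hT
  set z := toIcoDiv hT' 0 s with hz
  have hmem := toIcoMod_mem_Ico hT' 0 s
  rw [toIcoMod, ← hz, zsmul_eq_mul, zero_add] at hmem
  have hshift : ∀ r, P (r - z * T) = P r := fun r => by
    rw [← zsmul_eq_mul]; exact hP.sub_zsmul_eq z
  rcases lt_or_ge (t - z * T) T with ht | ht
  · rcases h (s - z * T) (t - z * T) hmem.1 (by linarith) ht (by rw [hshift, hshift, heq])
      with h | h
    · left
      intro r hr
      rw [← hshift r, ← hshift s]
      exact h _ ⟨by linarith [hr.1], by linarith [hr.2]⟩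
    · right
      intro r hr
      rw [← hshift r, ← hshift s]
      exact h _ ⟨by linarith [hr.1], by linarith [hr.2]⟩
  · rcases h (t - z * T - T) (s - z * T) (by linarith) (by linarith) hmem.2
      (by rw [hP.sub_eq, hshift, hshift, heq]) with h | h
    · right
      intro r hr
      rw [heq, ← hshift r, ← hP.sub_eq, ← hshift t, ← hP.sub_eq (t - z * T)]
      exact h _ ⟨by linarith [hr.1], by linarith [hr.2]⟩
    · left
      intro r hr
      rw [heq, ← hshift r, ← hshift t, ← hP.sub_eq (t - z * T)]
      exact h _ ⟨by linarith [hr.1], by linarith [hr.2]⟩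

/-- A simple closed curve that covers a topological circle `S` stays on it. If it left `S` at the
parameter `s`, then for any three points of `S` the second one visited after `s` would separate the
first one from the third one in `S`. -/
lemma IsSimpleClosedCurve.mem_of_subset_range {T : ℕ} {P : ℝ → Plane}
    (h : IsSimpleClosedCurve T P) (hP : Function.Periodic P (T : ℝ)) (hcont : Continuous P)
    (hT : 0 < T) {S : Set Plane} (hS : S ⊆ Set.range P)
    (hconn : ∀ y ∈ S, IsPreconnected (S \ {y}))
    (hthree : ∃ x ∈ S, ∃ y ∈ S, ∃ z ∈ S, x ≠ y ∧ y ≠ z ∧ x ≠ z) (s : ℝ) : P s ∈ S := by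
  by_contra hs
  have hT' : (0 : ℝ) < T := by exact_mod_cast hT
  have key : ∀ a b c : ℝ, s ≤ a → a < b → b < c → c ≤ s + T → P a ∈ S → P b ∈ S → P c ∈ S →
      P a ≠ P b → P b ≠ P c → False := by
    intro a b c hsa hab hbc hcs ha hb hc hne1 hne2
    have hA : IsClosed (P '' Set.Icc s b) := (isCompact_Icc.image hcont).isClosed
    have hB : IsClosed (P '' Set.Icc b (s + T)) := (isCompact_Icc.image hcont).isClosed
    obtain ⟨y, ⟨_, hyb⟩, ⟨r, hr, rfl⟩, ⟨r', hr', heq⟩⟩ :=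
      isPreconnected_closed_iff.1 (hconn _ hb) _ _ hA hB (by
        rintro y ⟨hy, -⟩
        obtain ⟨r, rfl⟩ := hS hy
        have hmem := toIcoMod_mem_Ico hT' s r
        have hPr : P (toIcoMod hT' s r) = P r := by rw [toIcoMod, hP.sub_zsmul_eq]
        rcases le_total (toIcoMod hT' s r) b with hle | hle
        · exact Or.inl ⟨_, ⟨hmem.1, hle⟩, hPr⟩
        · exact Or.inr ⟨_, ⟨hle, hmem.2.le⟩, hPr⟩)
        ⟨P a, ⟨ha, hne1⟩, a, ⟨hsa, hab.le⟩, rfl⟩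
        ⟨P c, ⟨hc, hne2.symm⟩, c, ⟨hbc.le, hcs⟩, rfl⟩
    rcases h.of_periodic hP hT (hr.2.trans hr'.1) (by linarith [hr'.2, hr.1]) heq.symm with h1 | h1
    · exact hyb (h1 b ⟨hr.2, hr'.1⟩).symm
    · have := h1 (s + T) ⟨hr'.2, by linarith [hr.1]⟩
      rw [hP] at this
      rw [this] at hs
      exact hs ‹_›
  obtain ⟨x, hx, y, hy, z, hz, hxy, hyz, hxz⟩ := hthree
  have hpar : ∀ x ∈ S, ∃ r, s ≤ r ∧ r ≤ s + T ∧ P r = x := by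
    intro x hx
    obtain ⟨r, rfl⟩ := hS hx
    have hmem := toIcoMod_mem_Ico hT' s r
    exact ⟨toIcoMod hT' s r, hmem.1, hmem.2.le, by rw [toIcoMod, hP.sub_zsmul_eq]⟩
  obtain ⟨a, ha1, ha2, rfl⟩ := hpar x hx
  obtain ⟨b, hb1, hb2, rfl⟩ := hpar y hy
  obtain ⟨c, hc1, hc2, rfl⟩ := hpar z hz
  have hab : a ≠ b := fun h => hxy (by rw [h])
  have hbc : b ≠ c := fun h => hyz (by rw [h])
  have hac : a ≠ c := fun h => hxz (by rw [h])
  rcases lt_or_gt_of_ne hab with h1 | h1 <;> rcases lt_or_gt_of_ne hbc with h2 | h2 <;>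
    rcases lt_or_gt_of_ne hac with h3 | h3
  · exact key a b c ha1 h1 h2 hc2 hx hy hz hxy hyz
  · linarith
  · exact key a c b ha1 h3 h2 hb2 hx hz hy hxz hyz.symm
  · exact key c a b hc1 h3 h1 hb2 hz hx hy hxz.symm hxy
  · exact key b a c hb1 h1 h3 hc2 hy hx hz hxy.symm hxz
  · exact key b c a hb1 h2 h3 ha2 hy hz hx hyz hxz.symm
  · linarith
  · exact key c b a hc1 h2 h1 ha2 hz hy hx hyz.symm hxy.symm

/-- If the enclosed set is convex, the curve covers the boundary of its convex hull: a boundary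
point off the curve could be joined to the exterior. -/
lemma frontier_subset_of_convex_enclosedSet {K C : Set Plane} (hK : Convex ℝ K)
    (hKc : IsClosed K) (hC : IsClosed C) (hCK : C ⊆ K) (hKE : K ⊆ enclosedSet C) :
    frontier K ⊆ C := by
  intro x hx
  by_contra hxC
  have hxK : x ∈ K := hKc.frontier_subset hx
  have hb := ((hKE hxK).resolve_left hxC).2
  have hopen : IsOpen (connectedComponentIn Cᶜ x) := hC.isOpen_compl.connectedComponentIn
  have hxcl : x ∈ closure Kᶜ := by
    rw [frontier_eq_closure_inter_closure] at hx
    exact hx.2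
  obtain ⟨y, hy, hyK⟩ := mem_closure_iff.1 hxcl _ hopen (mem_connectedComponentIn hxC)
  rw [connectedComponentIn_eq hy] at hb
  exact not_isBounded_connectedComponentIn hK hKc hCK hyK hb

/-- A line that meets the interior of the hull meets its boundary in at most two points: the middle
one of three points would have the line itself as its supporting line. -/
lemma not_three_mem_frontier {γ : ℤ → Plane} (hspan : SpansPlane γ) (hKc : IsClosed (contourHull γ))
    {α : Fin 3 → ℝ} (hα : α 0 ^ 2 + α 1 ^ 2 ≠ 0) {i j : ℤ} (hi : 0 < affineForm α (γ i))
    (hj : affineForm α (γ j) < 0) {x y z : Plane} (hx : x ∈ frontier (contourHull γ))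
    (hy : y ∈ frontier (contourHull γ)) (hz : z ∈ frontier (contourHull γ))
    (hαx : affineForm α x = 0) (hαy : affineForm α y = 0) (hαz : affineForm α z = 0)
    (hxy : x ≠ y) (hyz : y ≠ z) (hxz : x ≠ z) : False := by
  have key : ∀ x y z : Plane, x ∈ frontier (contourHull γ) → y ∈ frontier (contourHull γ) →
      z ∈ frontier (contourHull γ) → affineForm α x = 0 → affineForm α y = 0 →
      affineForm α z = 0 → alongForm α x < alongForm α y → alongForm α y < alongForm α z →
      False := by
    intro x y z hx hy hz hαx hαy hαz hxy hyz
    obtain ⟨β, hβ, hβy, hle⟩ := exists_support hspan hy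
    have hβx := hle x (hKc.frontier_subset hx)
    have hβz := hle z (hKc.frontier_subset hz)
    set g := alongForm α with hg
    have hmid : (g z - g y) * affineForm β x + (g y - g x) * affineForm β z = 0 := by
      have e0 : (α 0 ^ 2 + α 1 ^ 2) * ((g z - g y) * affineForm β x + (g y - g x) * affineForm β z -
          (g z - g x) * affineForm β y) = 0 := by
        unfold affineForm at hαx hαy hαz ⊢
        simp only [hg, alongForm]
        linear_combination
          (α 0 * β 0 + α 1 * β 1) * (α 1 * (z 0 - y 0) - α 0 * (z 1 - y 1)) * hαx +
          (α 0 * β 0 + α 1 * β 1) * (α 1 * (x 0 - z 0) - α 0 * (x 1 - z 1)) * hαy +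
          (α 0 * β 0 + α 1 * β 1) * (α 1 * (y 0 - x 0) - α 0 * (y 1 - x 1)) * hαz
      have := (mul_eq_zero.1 e0).resolve_left hα
      rw [hβy] at this
      linarith
    have hβx0 : affineForm β x = 0 := by nlinarith
    have hβz0 : affineForm β z = 0 := by nlinarith
    have hα' : 0 < α 0 ^ 2 + α 1 ^ 2 := lt_of_le_of_ne (by positivity) hα.symm
    have hβ' : 0 < β 0 ^ 2 + β 1 ^ 2 := lt_of_le_of_ne (by positivity) hβ.symm
    have hprop : ∀ r, (α 0 ^ 2 + α 1 ^ 2) * (alongForm β z - alongForm β x) * affineForm β r =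
        (β 0 ^ 2 + β 1 ^ 2) * (g z - g x) * affineForm α r := by
      intro r
      have h1 := orient_eq_of_affineForm_eq_zero hαx hαz r
      have h2 := orient_eq_of_affineForm_eq_zero hβx0 hβz0 r
      linear_combination (β 0 ^ 2 + β 1 ^ 2) * h1 - (α 0 ^ 2 + α 1 ^ 2) * h2
    have hc : 0 < (β 0 ^ 2 + β 1 ^ 2) * (g z - g x) := mul_pos hβ' (by linarith)
    have hpi := mul_pos hc hi
    have hpj := mul_neg_of_pos_of_neg hc hj
    rw [← hprop] at hpi hpj
    have hni := hle _ (mem_contourHull γ i)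
    have hnj := hle _ (mem_contourHull γ j)
    rcases le_total 0 ((α 0 ^ 2 + α 1 ^ 2) * (alongForm β z - alongForm β x)) with h0 | h0
    · nlinarith
    · nlinarith
  have hne : ∀ p q : Plane, affineForm α p = 0 → affineForm α q = 0 → p ≠ q →
      alongForm α p ≠ alongForm α q := fun p q hp hq hpq h0 =>
    hpq (eq_of_affineForm_eq_of_alongForm_eq hα (by rw [hp, hq]) h0)
  rcases lt_or_gt_of_ne (hne x y hαx hαy hxy) with h1 | h1 <;>
    rcases lt_or_gt_of_ne (hne y z hαy hαz hyz) with h2 | h2 <;>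
    rcases lt_or_gt_of_ne (hne x z hαx hαz hxz) with h3 | h3
  · exact key x y z hx hy hz hαx hαy hαz h1 h2
  · linarith
  · exact key x z y hx hz hy hαx hαz hαy h3 h2
  · exact key z x y hz hx hy hαz hαx hαy h3 h1
  · exact key y x z hy hx hz hαy hαx hαz h1 h3
  · exact key y z x hy hz hx hαy hαz hαx h2 h3
  · linarith
  · exact key z y x hz hy hx hαz hαy hαx h2 h1

lemma HasConvexPolygon.polygonCurve_mem_frontier {T : ℕ} (hT : 0 < T) {γ : ℤ → Plane}
    (hγ : ∀ t, γ (t + T) = γ t) (hspan : SpansPlane γ) (h : HasConvexPolygon T γ) (s : ℝ) :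
    polygonCurve γ s ∈ frontier (contourHull γ) := by
  obtain ⟨hsimple, hconv⟩ := h
  rw [range_polygonCurve hT hγ] at hconv
  have hK := isCompact_contourHull hT hγ
  have hKint := hspan.interior_contourHull_nonempty
  have hKE : contourHull γ ⊆ enclosedSet (Set.range (polygonCurve γ)) := by
    refine convexHull_min ?_ hconv
    rintro _ ⟨t, rfl⟩
    exact Or.inl ⟨t, polygonCurve_intCast γ t⟩
  have hfr := frontier_subset_of_convex_enclosedSet (convex_contourHull γ) hK.isClosed
    (isCompact_range_polygonCurve hT hγ).isClosed
    (Set.range_subset_iff.2 (polygonCurve_mem_contourHull γ)) hKE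
  exact hsimple.mem_of_subset_range (polygonCurve_add_period hγ) (continuous_polygonCurve γ) hT hfr
    (fun y hy => isPreconnected_frontier_diff_singleton (convex_contourHull γ) hKint
      hK.isBounded hy)
    (exists_three_mem_frontier (convex_contourHull γ) hKint hK.isBounded) s

/-- An alternation would give three zeros of the affine form on the curve, separated by points where
the form does not vanish. By simplicity they are three different points of the hull boundary on one
line through the interior. -/
lemma HasConvexPolygon.not_alternates {T : ℕ} (hT : 0 < T) {γ : ℤ → Plane}
    (hγ : ∀ t, γ (t + T) = γ t) (hspan : SpansPlane γ) (h : HasConvexPolygon T γ)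
    (α : Fin 3 → ℝ) : ¬ Alternates T (fun t => affineForm α (γ t)) := by
  rintro ⟨a, b, c, d, hab, hbc, hcd, hda, ha, hb, hc, hd⟩
  have hcont : Continuous fun s => affineForm α (polygonCurve γ s) :=
    (continuous_affineForm α).comp (continuous_polygonCurve γ)
  have hα : α 0 ^ 2 + α 1 ^ 2 ≠ 0 := by
    intro h0
    have h1 : α 0 = 0 := by nlinarith [sq_nonneg (α 0), sq_nonneg (α 1)]
    have h2 : α 1 = 0 := by nlinarith [sq_nonneg (α 0), sq_nonneg (α 1)]
    simp [affineForm, h1, h2] at ha hb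
    linarith
  have hab' : (a : ℝ) ≤ b := by exact_mod_cast hab.le
  have hbc' : (b : ℝ) ≤ c := by exact_mod_cast hbc.le
  have hcd' : (c : ℝ) ≤ d := by exact_mod_cast hcd.le
  have hda' : (d : ℝ) ≤ a + T := by exact_mod_cast hda.le
  obtain ⟨s₁, hs₁, hz₁⟩ := intermediate_value_Icc' hab' hcont.continuousOn
    (show (0 : ℝ) ∈ _ by simp only [polygonCurve_intCast]; exact ⟨hb.le, ha.le⟩)
  obtain ⟨s₂, hs₂, hz₂⟩ := intermediate_value_Icc hbc' hcont.continuousOn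
    (show (0 : ℝ) ∈ _ by simp only [polygonCurve_intCast]; exact ⟨hb.le, hc.le⟩)
  obtain ⟨s₃, hs₃, hz₃⟩ := intermediate_value_Icc' hcd' hcont.continuousOn
    (show (0 : ℝ) ∈ _ by simp only [polygonCurve_intCast]; exact ⟨hd.le, hc.le⟩)
  simp only at hz₁ hz₂ hz₃ ha hb hc hd
  have hdiff : ∀ (s t : ℝ) (m : ℤ), s ≤ m → m ≤ t → t ≤ d → a ≤ s →
      affineForm α (polygonCurve γ s) = 0 → affineForm α (γ m) ≠ 0 →
      polygonCurve γ s ≠ polygonCurve γ t := by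
    intro s t m hsm hmt htd has hs hm heq
    rcases h.1.of_periodic (polygonCurve_add_period hγ) hT (hsm.trans hmt) (by linarith) heq
      with h1 | h1
    · have := h1 m ⟨hsm, hmt⟩
      rw [polygonCurve_intCast] at this
      exact hm (by rw [this, hs])
    · have := h1 d ⟨htd, by linarith⟩
      rw [polygonCurve_intCast] at this
      exact hd.ne (by rw [this, hs])
  have hfr := h.polygonCurve_mem_frontier hT hγ hspan
  exact not_three_mem_frontier hspan (isCompact_contourHull hT hγ).isClosed hα ha hb
    (hfr s₁) (hfr s₂) (hfr s₃) hz₁ hz₂ hz₃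
    (hdiff s₁ s₂ b hs₁.2 hs₂.1 (by linarith [hs₂.2]) hs₁.1 hz₁ hb.ne)
    (hdiff s₂ s₃ c hs₂.2 hs₃.1 hs₃.2 (by linarith [hs₂.1]) hz₂ hc.ne')
    (hdiff s₁ s₃ b hs₁.2 (by linarith [hs₃.1]) hs₃.2 hs₁.1 hz₁ hb.ne)

/-! ### From local to global convexity -/

/-- A polygon that turns left, or goes straight on, at every vertex: there are no repeated
consecutive points, and no reversals of direction. -/
def TurnsLeft (γ : ℤ → Plane) : Prop :=
  ∀ t : ℤ, γ t ≠ γ (t + 1) ∧ 0 ≤ orient (γ t) (γ (t + 1)) (γ (t + 1 + 1)) ∧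
    ∀ c : ℝ, 0 < c → forwardDiff γ (t + 1) ≠ -(c • forwardDiff γ t)

/-- For nonzero vectors in the right half-plane, the slope of `(a₀, a₁)`, from `-∞` to `∞`, is at
most that of `(b₀, b₁)`. -/
def SlopeLE (a₀ a₁ b₀ b₁ : ℝ) : Prop :=
  (a₀ = 0 ∧ a₁ < 0) ∨ (b₀ = 0 ∧ 0 < b₁) ∨ (0 < a₀ ∧ 0 < b₀ ∧ 0 ≤ a₀ * b₁ - a₁ * b₀)

lemma slopeLE_refl {a₀ a₁ : ℝ} (h0 : 0 ≤ a₀) (hne : a₀ = 0 → a₁ ≠ 0) : SlopeLE a₀ a₁ a₀ a₁ := by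
  rcases h0.eq_or_lt with h0 | h0
  · rcases lt_or_gt_of_ne (hne h0.symm) with h | h
    · exact Or.inl ⟨h0.symm, h⟩
    · exact Or.inr (Or.inl ⟨h0.symm, h⟩)
  · exact Or.inr (Or.inr ⟨h0, h0, by linarith⟩)

lemma SlopeLE.cross_nonneg {a₀ a₁ b₀ b₁ : ℝ} (h : SlopeLE a₀ a₁ b₀ b₁) (ha : 0 ≤ a₀)
    (hb : 0 ≤ b₀) : 0 ≤ a₀ * b₁ - a₁ * b₀ := by
  rcases h with ⟨h1, h2⟩ | ⟨h1, h2⟩ | h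
  · rw [h1]; nlinarith
  · rw [h1]; nlinarith
  · exact h.2.2

/-- Within the right half-plane, a left turn by less than a straight angle increases the slope. -/
lemma SlopeLE.step {a₀ a₁ b₀ b₁ c₀ c₁ : ℝ} (h : SlopeLE a₀ a₁ b₀ b₁) (hc : 0 ≤ c₀)
    (hcne : c₀ = 0 → c₁ ≠ 0) (hbc : 0 ≤ b₀ * c₁ - b₁ * c₀)
    (hopp : ∀ k : ℝ, 0 < k → ¬ (c₀ = -(k * b₀) ∧ c₁ = -(k * b₁))) : SlopeLE a₀ a₁ c₀ c₁ := by
  rcases h with h | ⟨h1, h2⟩ | ⟨h1, h2, h3⟩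
  · exact Or.inl h
  · rw [h1] at hbc
    have hc0 : c₀ = 0 := by nlinarith
    refine Or.inr (Or.inl ⟨hc0, ?_⟩)
    by_contra hcon
    have hc1 : c₁ < 0 := lt_of_le_of_ne (not_lt.1 hcon) (hcne hc0)
    refine hopp (-c₁ / b₁) (div_pos (by linarith) h2) ⟨by rw [hc0, h1]; ring, ?_⟩
    field_simp
  · rcases hc.eq_or_lt with hc0 | hc0
    · refine Or.inr (Or.inl ⟨hc0.symm, ?_⟩)
      rw [← hc0] at hbc
      have : 0 ≤ c₁ := by nlinarith
      exact lt_of_le_of_ne this (hcne hc0.symm).symm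
    · refine Or.inr (Or.inr ⟨h1, hc0, ?_⟩)
      have : b₀ * (a₀ * c₁ - a₁ * c₀) = a₀ * (b₀ * c₁ - b₁ * c₀) + c₀ * (a₀ * b₁ - a₁ * b₀) := by
        ring
      have h4 : 0 ≤ b₀ * (a₀ * c₁ - a₁ * c₀) := by rw [this]; positivity
      exact nonneg_of_mul_nonneg_right h4 h2

lemma TurnsLeft.neg {γ : ℤ → Plane} (h : TurnsLeft γ) : TurnsLeft (fun t => -γ t) := by
  intro t
  obtain ⟨h1, h2, h3⟩ := h t
  refine ⟨fun h0 => h1 (neg_injective h0), ?_, fun c hc h0 => h3 c hc ?_⟩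
  · convert h2 using 1
    simp [orient]; ring
  · have hd : ∀ t, forwardDiff (fun t => -γ t) t = -forwardDiff γ t := fun t => by
      simp only [forwardDiff]; abel
    rw [hd, hd, smul_neg, neg_inj] at h0
    exact h0

/-- Along a part of the polygon on which the first coordinate increases, the slope of the edges
increases. -/
lemma TurnsLeft.slopeLE {γ : ℤ → Plane} (h : TurnsLeft γ) {p q : ℤ}
    (hmono : ∀ t, p ≤ t → t < q → γ t 0 ≤ γ (t + 1) 0) {i : ℤ} (hpi : p ≤ i) :
    ∀ j, i ≤ j → j < q → SlopeLE (γ (i + 1) 0 - γ i 0) (γ (i + 1) 1 - γ i 1)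
      (γ (j + 1) 0 - γ j 0) (γ (j + 1) 1 - γ j 1) := by
  have hne : ∀ t, γ (t + 1) 0 - γ t 0 = 0 → γ (t + 1) 1 - γ t 1 ≠ 0 := fun t h0 h1 =>
    (h t).1 (plane_ext (by linarith) (by linarith))
  refine Int.leInduction ?_ ?_
  · intro hiq
    exact slopeLE_refl (by linarith [hmono i hpi hiq]) (hne i)
  · intro j hij ih hjq
    refine (ih (by omega)).step (by linarith [hmono (j + 1) (by omega) hjq]) (hne _) ?_ ?_
    · have := (h j).2.1
      unfold orient at this
      linarith
    · rintro k hk ⟨h0, h1⟩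
      refine (h j).2.2 k hk (plane_ext ?_ ?_)
      · simpa [forwardDiff] using h0
      · simpa [forwardDiff] using h1

lemma TurnsLeft.orient_nonneg_of_mono {γ : ℤ → Plane} (h : TurnsLeft γ) {p q : ℤ}
    (hmono : ∀ t, p ≤ t → t < q → γ t 0 ≤ γ (t + 1) 0) {i j k : ℤ} (hpi : p ≤ i) (hij : i ≤ j)
    (hjk : j ≤ k) (hkq : k ≤ q) : 0 ≤ orient (γ i) (γ j) (γ k) := by
  -- the product of the two sides is a sum of products of edges
  have h1 : ∀ a, p ≤ a → a ≤ j → ∀ k, j ≤ k → k ≤ q →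
      0 ≤ (γ (a + 1) 0 - γ a 0) * (γ k 1 - γ j 1) - (γ (a + 1) 1 - γ a 1) * (γ k 0 - γ j 0) := by
    intro a hpa haj
    refine Int.leInduction ?_ ?_
    · intro; simp
    · intro k hjk ih hkq
      have h2 := (h.slopeLE hmono hpa k (by omega) (by omega)).cross_nonneg
        (by linarith [hmono a hpa (by omega)]) (by linarith [hmono k (by omega) (by omega)])
      have := ih (by omega)
      linarith
  have h2 : ∀ i, i ≤ j → p ≤ i →
      0 ≤ (γ j 0 - γ i 0) * (γ k 1 - γ j 1) - (γ j 1 - γ i 1) * (γ k 0 - γ j 0) := by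
    refine Int.leInductionDown ?_ ?_
    · intro; simp
    · intro i hij ih hpi
      have h3 := h1 (i - 1) hpi (by omega) k hjk hkq
      rw [sub_add_cancel] at h3
      have := ih (by omega)
      linarith
  have := h2 i hij hpi
  unfold orient
  linarith

lemma mono_of_step {u : ℤ → ℝ} {p q : ℤ} (h : ∀ t, p ≤ t → t < q → u t ≤ u (t + 1)) {i : ℤ}
    (hpi : p ≤ i) : ∀ j, i ≤ j → j ≤ q → u i ≤ u j := by
  refine Int.leInduction (fun _ => le_rfl) ?_
  intro j hij ih hjq
  exact (ih (by omega)).trans (h j (by omega) (by omega))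

/-- Two vertices on the lower chain and one vertex on the upper chain: the latter is above the chord
between the end points of the chains, and these lie above the line through the former. -/
lemma TurnsLeft.orient_nonneg_of_mono_of_antitone {n : ℕ} {γ : ℤ → Plane}
    (hγ : ∀ t, γ (t + n) = γ t) (h : TurnsLeft γ) {p q : ℤ} (hlt : γ p 0 < γ q 0)
    (hmono : ∀ t, p ≤ t → t < q → γ t 0 ≤ γ (t + 1) 0)
    (hanti : ∀ t, q ≤ t → t < p + n → γ (t + 1) 0 ≤ γ t 0) {a b c : ℤ} (hpa : p ≤ a) (hab : a ≤ b)
    (hbq : b ≤ q) (hqc : q ≤ c) (hcp : c ≤ p + n) : 0 ≤ orient (γ a) (γ b) (γ c) := by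
  have o1 := h.orient_nonneg_of_mono hmono le_rfl hpa hab hbq
  have o2 := h.orient_nonneg_of_mono hmono hpa hab hbq le_rfl
  have hmono' : ∀ t, q ≤ t → t < p + n → (-γ t) 0 ≤ (-γ (t + 1)) 0 := by
    intro t h1 h2
    simpa using hanti t h1 h2
  have o3 := h.neg.orient_nonneg_of_mono hmono' le_rfl hqc hcp le_rfl
  have x1 := mono_of_step (u := fun t => γ t 0) hmono hpa b hab hbq
  have x2 := mono_of_step (u := fun t => (-γ t) 0) hmono' le_rfl c hqc hcp
  have x3 := mono_of_step (u := fun t => (-γ t) 0) hmono' hqc (p + n) hcp le_rfl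
  simp only [PiLp.neg_apply, hγ] at x1 x2 x3
  have key : (γ q 0 - γ p 0) * orient (γ a) (γ b) (γ c) =
      (γ q 0 - γ c 0) * orient (γ p) (γ a) (γ b) + (γ c 0 - γ p 0) * orient (γ a) (γ b) (γ q) +
        (γ b 0 - γ a 0) * orient (-γ q) (-γ c) (-γ (p + n)) := by
    rw [hγ]
    simp [orient]; ring
  have h1 : 0 ≤ (γ q 0 - γ p 0) * orient (γ a) (γ b) (γ c) := by
    rw [key]
    have y1 : 0 ≤ γ q 0 - γ c 0 := by linarith
    have y2 : 0 ≤ γ c 0 - γ p 0 := by linarith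
    have y3 : 0 ≤ γ b 0 - γ a 0 := by linarith
    positivity
  exact nonneg_of_mul_nonneg_right h1 (by linarith)

/-- A left-turning polygon with a periodically monotone coordinate consists of a lower and an
upper chain, and it is convex. -/
lemma TurnsLeft.weaklyOriented {n : ℕ} (hn : 0 < n) {γ : ℤ → Plane} (hγ : ∀ t, γ (t + n) = γ t)
    (hspan : SpansPlane γ) (h : TurnsLeft γ)
    (hpm : ∀ c : ℝ, ¬ Alternates n (fun t => γ t 0 - c)) : WeaklyOriented 1 n γ := by
  have hn' : (0 : ℤ) < n := by exact_mod_cast hn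
  have hne : (Set.Ico (0 : ℤ) n).Nonempty := ⟨0, le_rfl, hn'⟩
  obtain ⟨p, -, hp⟩ := Set.exists_min_image _ (fun t => γ t 0) (Set.finite_Ico (0 : ℤ) n) hne
  obtain ⟨q₀, -, hq₀⟩ := Set.exists_max_image _ (fun t => γ t 0) (Set.finite_Ico (0 : ℤ) n) hne
  have hmem : ∀ t : ℤ, t % n ∈ Set.Ico (0 : ℤ) n := fun t =>
    ⟨Int.emod_nonneg t hn'.ne', Int.emod_lt_of_pos t hn'⟩
  replace hp : ∀ t, γ p 0 ≤ γ t 0 := fun t => by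
    have := hp _ (hmem t); rwa [periodic_emod hγ] at this
  replace hq₀ : ∀ t, γ t 0 ≤ γ q₀ 0 := fun t => by
    have := hq₀ _ (hmem t); rwa [periodic_emod hγ] at this
  obtain ⟨q, hpq, hqp, hq⟩ : ∃ q, p ≤ q ∧ q < p + n ∧ γ q = γ q₀ := by
    refine ⟨p + (q₀ - p) % n, ?_, ?_, ?_⟩
    · have := (hmem (q₀ - p)).1; omega
    · have := (hmem (q₀ - p)).2; omega
    · rw [← periodic_add_mul hγ ((q₀ - p) / n) (p + (q₀ - p) % n)]
      congr 1
      linarith [Int.emod_add_mul_ediv (q₀ - p) n]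
  rw [← hq] at hq₀
  have hlt : γ p 0 < γ q 0 := by
    by_contra hcon
    obtain ⟨t, ht⟩ := hspan ![1, 0, -γ p 0] (fun h0 => by simpa using congrFun h0 0)
    apply ht
    simp [affineForm]
    linarith [hp t, hq₀ t]
  have hmono : ∀ t, p ≤ t → t < q → γ t 0 ≤ γ (t + 1) 0 := by
    intro t h1 h2
    by_contra hcon
    have hpt : p ≠ t := by rintro rfl; exact hcon (hp _)
    have htq : t + 1 ≠ q := by rintro rfl; exact hcon (hq₀ _)
    refine hpm ((γ t 0 + γ (t + 1) 0) / 2) ⟨t, t + 1, q, p + n, by omega, by omega, by omega,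
      by omega, ?_, ?_, ?_, ?_⟩
    · linarith
    · linarith
    · linarith [hq₀ t]
    · simp only [hγ]; linarith [hp (t + 1)]
  have hanti : ∀ t, q ≤ t → t < p + n → γ (t + 1) 0 ≤ γ t 0 := by
    intro t h1 h2
    by_contra hcon
    have hpq' : p ≠ q := by rintro rfl; exact hlt.false
    have hpt : q ≠ t := by rintro rfl; exact hcon (hq₀ _)
    have htq : t + 1 ≠ p + n := by
      intro h0
      rw [h0, hγ] at hcon
      exact hcon (hp _)
    refine hpm ((γ t 0 + γ (t + 1) 0) / 2) ⟨q, t, t + 1, p + n, by omega, by omega, by omega,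
      by omega, ?_, ?_, ?_, ?_⟩
    · linarith [hq₀ (t + 1)]
    · linarith
    · linarith
    · simp only [hγ]; linarith [hp t]
  have hmono' : ∀ t, q ≤ t → t < p + n → (-γ t) 0 ≤ (-γ (t + 1)) 0 := fun t h1 h2 => by
    simpa using hanti t h1 h2
  have hanti' : ∀ t, p + n ≤ t → t < q + n → (-γ (t + 1)) 0 ≤ (-γ t) 0 := fun t h1 h2 => by
    have := hmono (t - n) (by omega) (by omega)
    rw [← hγ (t - n), ← hγ (t - n + 1), sub_add_cancel, sub_add_eq_add_sub, sub_add_cancel] at this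
    simpa using this
  have hneg : ∀ i j k, orient (γ i) (γ j) (γ k) = orient (-γ i) (-γ j) (-γ k) := fun i j k => by
    simp [orient]; ring
  have hsorted : ∀ i j k : ℤ, p ≤ i → i < j → j < k → k < p + n →
      0 ≤ orient (γ i) (γ j) (γ k) := by
    intro i j k hi hij hjk hk
    rcases le_or_gt k q with h1 | h1
    · exact h.orient_nonneg_of_mono hmono hi hij.le hjk.le h1
    rcases le_or_gt j q with h2 | h2
    · exact h.orient_nonneg_of_mono_of_antitone hγ hlt hmono hanti hi hij.le h2 h1.le hk.le
    rcases le_or_gt i q with h3 | h3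
    · rw [orient_rotate, ← hγ i, hneg]
      exact h.neg.orient_nonneg_of_mono_of_antitone (fun t => by rw [hγ]) (p := q) (q := p + n)
        (by simpa [hγ] using hlt) hmono' hanti' h2.le hjk.le hk.le (by omega) (by omega)
    · rw [hneg]
      exact h.neg.orient_nonneg_of_mono hmono' h3.le hij.le hjk.le hk.le
  have hcyc := (forall_sorted_iff_forall_cyclic (γ := fun t => γ (t + p))
    (fun t => by rw [add_right_comm, hγ]) (fun r => 0 ≤ r)).1 (fun i j k h1 h2 h3 h4 =>
      hsorted (i + p) (j + p) (k + p) (by omega) (by omega) (by omega) (by omega))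
  refine weaklyOriented_of_lt hγ fun i j k hij hjk hki => ?_
  rw [one_mul]
  simpa using hcyc (i - p) (j - p) (k - p) (by omega) (by omega) (by omega)

/-! ### Strict convexity -/

namespace WeaklyOriented

variable {σ : ℝ} {n : ℕ} {γ : ℤ → Plane}

/-- If all consecutive triples are strictly oriented, then no point is on the line through an edge
to which it does not belong. If the first such point after the edge is met at the index `m`, all
points from there to the end of the period are on that line. -/
lemma orient_edge_pos (h : WeaklyOriented σ n γ) (hγ : ∀ t, γ (t + n) = γ t)
    (hpos : ∀ t, 0 < σ * orient (γ t) (γ (t + 1)) (γ (t + 1 + 1))) (t : ℤ) :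
    ∀ m, t + 1 + 1 ≤ m → m < t + n → 0 < σ * orient (γ t) (γ (t + 1)) (γ m) := by
  refine Int.leInduction (fun _ => hpos t) ?_
  intro k htk ih hkn
  have hk := ih (by omega)
  have hσ : σ ≠ 0 := left_ne_zero_of_mul hk.ne'
  have hne : γ (t + 1) ≠ γ t := fun h0 => by
    rw [h0, orient_self_left, mul_zero] at hk; exact hk.false
  by_contra hcon
  have h0 : σ * orient (γ t) (γ (t + 1)) (γ (k + 1)) = 0 :=
    le_antisymm (not_lt.1 hcon) (h _ _ _ (by omega) (by omega) (by omega))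
  replace h0 := (mul_eq_zero.1 h0).resolve_left hσ
  obtain ⟨c, hc0, hc1⟩ := exists_param_of_orient_eq_zero hne (r := γ (k + 1))
    (by rw [orient_swap, h0, neg_zero])
  have hcnn : 0 ≤ c := by
    have h1 := h (t + 1) k (k + 1) (by omega) (by omega) (by omega)
    have h2 : σ * orient (γ (t + 1)) (γ k) (γ (k + 1)) =
        c * (σ * orient (γ t) (γ (t + 1)) (γ k)) := by
      simp only [orient, hc0, hc1]; ring
    rw [h2] at h1
    exact nonneg_of_mul_nonneg_left h1 hk
  rcases hcnn.eq_or_lt with rfl | hcpos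
  · have h1 := h k (k + 1) (t + n) (by omega) (by omega) (by omega)
    have h2 : σ * orient (γ k) (γ (k + 1)) (γ (t + n)) =
        -(σ * orient (γ t) (γ (t + 1)) (γ k)) := by
      rw [hγ]
      simp only [orient, hc0, hc1]; ring
    linarith
  · have hline : ∀ z, k + 1 ≤ z → z ≤ t + n → orient (γ t) (γ (t + 1)) (γ z) = 0 := by
      intro z hz1 hz2
      have h1 := h (t + 1) (k + 1) z (by omega) hz1 (by omega)
      have h2 : σ * orient (γ (t + 1)) (γ (k + 1)) (γ z) =
          -(c * (σ * orient (γ t) (γ (t + 1)) (γ z))) := by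
        simp only [orient, hc0, hc1]; ring
      have h3 := h t (t + 1) z (by omega) (by omega) (by omega)
      have h4 : c * (σ * orient (γ t) (γ (t + 1)) (γ z)) = 0 :=
        le_antisymm (by linarith) (mul_nonneg hcpos.le h3)
      exact (mul_eq_zero.1 ((mul_eq_zero.1 h4).resolve_left hcpos.ne')).resolve_left hσ
    obtain ⟨α, hα, hαr⟩ := exists_affineForm_eq_orient hne.symm
    refine hα (eq_zero_of_affineForm_eq_zero (right_ne_zero_of_mul (hpos (k + 1)).ne') ?_ ?_ ?_)
    · rw [hαr]; exact hline _ le_rfl (by omega)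
    · rw [hαr]; exact hline _ (by omega) (by omega)
    · rw [hαr]
      rcases le_or_gt (k + 1 + 1 + 1) (t + n) with hle | hgt
      · exact hline _ (by omega) hle
      · have : k + 1 + 1 + 1 = t + 1 + n := by omega
        rw [this, hγ, orient_self_right]

/-- Of three collinear points, one lies between the other two, and these are then on different sides
of the edge that starts at the middle point. -/
lemma orient_pos (h : WeaklyOriented σ n γ) (hγ : ∀ t, γ (t + n) = γ t)
    (hpos : ∀ t, 0 < σ * orient (γ t) (γ (t + 1)) (γ (t + 1 + 1))) {i j k : ℤ} (hij : i < j)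
    (hjk : j < k) (hki : k < i + n) : 0 < σ * orient (γ i) (γ j) (γ k) := by
  have hσ : σ ≠ 0 := left_ne_zero_of_mul (hpos 0).ne'
  have hne : ∀ i j : ℤ, i < j → j < i + n → γ i ≠ γ j := by
    intro i j hij hji h0
    rcases (show i + 1 ≤ j by omega).eq_or_lt with h1 | h1
    · have := hpos i
      rw [h1, ← h0, orient_self_left, mul_zero] at this
      exact this.false
    · have := h.orient_edge_pos hγ hpos i j (by omega) hji
      rw [← h0, orient_self_outer, mul_zero] at this
      exact this.false
  have outer : ∀ i j k : ℤ, i < j → j < k → k < i + n → orient (γ i) (γ j) (γ k) = 0 →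
      ∃ c : ℝ, 0 < c ∧ γ k 0 = γ j 0 + c * (γ i 0 - γ j 0) ∧
        γ k 1 = γ j 1 + c * (γ i 1 - γ j 1) := by
    intro i j k hij hjk hki h0
    obtain ⟨c, hc0, hc1⟩ := exists_param_of_orient_eq_zero (hne i j hij (by omega)).symm
      (r := γ k) (by rw [orient_swap, h0, neg_zero])
    refine ⟨c, lt_of_le_of_ne ?_ ?_, hc0, hc1⟩
    · have h1 := h.orient_edge_pos hγ hpos j (i + n) (by omega) (by omega)
      rw [hγ] at h1
      have h2 := h j (j + 1) k (by omega) (by omega) (by omega)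
      have h3 : σ * orient (γ j) (γ (j + 1)) (γ k) =
          c * (σ * orient (γ j) (γ (j + 1)) (γ i)) := by
        simp only [orient, hc0, hc1]; ring
      rw [h3] at h2
      exact nonneg_of_mul_nonneg_left h2 h1
    · rintro rfl
      exact hne j k hjk (by omega) (plane_ext (by linarith) (by linarith))
  have hnn := h i j k hij.le hjk.le hki.le
  refine lt_of_le_of_ne hnn fun h0 => ?_
  replace h0 := (mul_eq_zero.1 h0.symm).resolve_left hσ
  obtain ⟨c, hc, hc0, hc1⟩ := outer i j k hij hjk hki h0
  obtain ⟨d, hd, hd0, hd1⟩ := outer j k (i + n) hjk hki (by omega)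
    (by rw [hγ, ← orient_rotate]; exact h0)
  obtain ⟨e, he, he0, he1⟩ := outer k (i + n) (j + n) hki (by omega) (by omega)
    (by rw [hγ, hγ, orient_rotate]; exact h0)
  simp only [hγ] at hd0 hd1 he0 he1
  -- in each coordinate, being outside of each other in all three ways forces the points together
  have key : ∀ w x y : ℝ, y = x + c * (w - x) → w = y + d * (x - y) → x = w + e * (y - w) →
      w = x := by
    intro w x y h1 h2 h3
    by_contra hwx
    have hw : w - x ≠ 0 := sub_ne_zero.2 hwx
    have e1 : (w - x) * (1 - c + d * c) = 0 := by rw [h1] at h2; linear_combination h2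
    have e2 : (w - x) * (1 + e * (c - 1)) = 0 := by rw [h1] at h3; linear_combination -h3
    have e1' := (mul_eq_zero.1 e1).resolve_left hw
    have e2' := (mul_eq_zero.1 e2).resolve_left hw
    have : 0 < d * c := mul_pos hd hc
    have : 0 < e * (c - 1) := mul_pos he (by linarith)
    linarith
  exact hne i j hij (by omega) (plane_ext (key _ _ _ hc0 hd0 he0) (key _ _ _ hc1 hd1 he1))

end WeaklyOriented

/-! ### Deleting repeated points -/

lemma forwardDiff_periodic {T : ℕ} {γ : ℤ → Plane} (hγ : ∀ t, γ (t + T) = γ t) (t : ℤ) :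
    forwardDiff γ (t + T) = forwardDiff γ t := by
  simp only [forwardDiff]
  rw [add_right_comm, hγ, hγ]

/-- The index in `γ` of the `j`-th point of the reduced sequence, for all integers `j`. -/
noncomputable def reducedIndex (T : ℕ) (γ : ℤ → Plane) (j : ℤ) : ℤ :=
  (Nat.nth (fun n : ℕ => forwardDiff γ (n : ℤ) ≠ 0) (j % (reducedPeriod T γ : ℤ)).toNat : ℤ) +
    T * (j / (reducedPeriod T γ : ℤ))

lemma reducedSeq_eq {T : ℕ} {γ : ℤ → Plane} (hγ : ∀ t, γ (t + T) = γ t) (j : ℤ) :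
    reducedSeq T γ j = γ (reducedIndex T γ j) := by
  rw [reducedIndex, periodic_add_mul hγ, reducedSeq]

lemma reducedSeq_add_period {T : ℕ} {γ : ℤ → Plane} (j : ℤ) :
    reducedSeq T γ (j + reducedPeriod T γ) = reducedSeq T γ j := by
  simp [reducedSeq]

lemma SpansPlane.exists_forwardDiff_ne_zero {γ : ℤ → Plane} (hspan : SpansPlane γ) :
    ∃ t, forwardDiff γ t ≠ 0 := by
  by_contra hcon
  push Not at hcon
  have hconst : ∀ t, γ t = γ 0 := by
    intro t
    induction t with
    | zero => rfl
    | succ k ih => rw [← ih]; exact sub_eq_zero.1 (hcon k)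
    | pred k ih =>
      rw [← ih]
      have := sub_eq_zero.1 (hcon (-(k : ℤ) - 1))
      rw [sub_add_cancel] at this
      exact this.symm
  obtain ⟨t, ht⟩ := hspan ![1, 0, -γ 0 0] (fun h0 => by simpa using congrFun h0 0)
  apply ht
  rw [hconst t]
  simp [affineForm]

lemma exists_nat_forwardDiff_ne_zero {T : ℕ} (hT : 0 < T) {γ : ℤ → Plane}
    (hγ : ∀ t, γ (t + T) = γ t) (hne : ∃ t, forwardDiff γ t ≠ 0) :
    ∃ n : ℕ, n < T ∧ forwardDiff γ (n : ℤ) ≠ 0 := by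
  obtain ⟨t, ht⟩ := hne
  have hT' : (0 : ℤ) < T := by exact_mod_cast hT
  have h0 := Int.emod_nonneg t hT'.ne'
  have h1 := Int.emod_lt_of_pos t hT'
  refine ⟨(t % T).toNat, by omega, ?_⟩
  rw [Int.toNat_of_nonneg h0, periodic_emod (forwardDiff_periodic hγ)]
  exact ht

lemma reducedPeriod_pos {T : ℕ} (hT : 0 < T) {γ : ℤ → Plane}
    (hγ : ∀ t, γ (t + T) = γ t) (hne : ∃ t, forwardDiff γ t ≠ 0) : 0 < reducedPeriod T γ := by
  classical
  obtain ⟨n, hn, hn0⟩ := exists_nat_forwardDiff_ne_zero hT hγ hne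
  have : Nat.count (fun n : ℕ => forwardDiff γ (n : ℤ) ≠ 0) T ≠ 0 :=
    Nat.count_ne_iff_exists.2 ⟨n, hn, hn0⟩
  rw [reducedPeriod]
  convert Nat.pos_of_ne_zero this

lemma reducedIndex_add_period {T : ℕ} {γ : ℤ → Plane} (hpos : 0 < reducedPeriod T γ) (j : ℤ) :
    reducedIndex T γ (j + reducedPeriod T γ) = reducedIndex T γ j + T := by
  have : (reducedPeriod T γ : ℤ) ≠ 0 := by exact_mod_cast hpos.ne'
  rw [reducedIndex, Int.add_emod_right, Int.add_ediv_of_dvd_right dvd_rfl, Int.ediv_self this,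
    reducedIndex]
  ring

/-- The reduced indices are the indices `t` with `Δγ(t) ≠ 0`, in increasing order. -/
lemma reducedIndex_spec {T : ℕ} (hT : 0 < T) {γ : ℤ → Plane}
    (hγ : ∀ t, γ (t + T) = γ t) (hne : ∃ t, forwardDiff γ t ≠ 0) :
    StrictMono (reducedIndex T γ) ∧
      ∀ t, forwardDiff γ t ≠ 0 → ∃ j, reducedIndex T γ j = t := by
  classical
  set p : ℕ → Prop := fun n : ℕ => forwardDiff γ (n : ℤ) ≠ 0 with hp
  have hcount : reducedPeriod T γ = Nat.count p T := by
    rw [reducedPeriod]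
  have hpos := reducedPeriod_pos hT hγ hne
  have hpos' : (0 : ℤ) < reducedPeriod T γ := by exact_mod_cast hpos
  have hT' : (0 : ℤ) < T := by exact_mod_cast hT
  have hinf : (Set.ofPred p).Infinite := by
    obtain ⟨n, -, hn⟩ := exists_nat_forwardDiff_ne_zero hT hγ hne
    refine Set.infinite_of_forall_exists_gt fun N => ⟨n + T * (N + 1), ?_, ?_⟩
    · show forwardDiff γ ((n + T * (N + 1) : ℕ) : ℤ) ≠ 0
      push_cast
      rwa [periodic_add_mul (forwardDiff_periodic hγ)]
    · nlinarith
  have hmod : ∀ j : ℤ, (j % (reducedPeriod T γ : ℤ)).toNat < Nat.count p T := by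
    intro j
    have h0 := Int.emod_nonneg j hpos'.ne'
    have h1 := Int.emod_lt_of_pos j hpos'
    omega
  refine ⟨strictMono_int_of_lt_succ fun j => ?_, fun t ht => ?_⟩
  · have h0 := Int.emod_nonneg j hpos'.ne'
    have h1 := Int.emod_lt_of_pos j hpos'
    have h2 := Int.emod_add_mul_ediv j (reducedPeriod T γ : ℤ)
    rcases (show j % (reducedPeriod T γ : ℤ) + 1 ≤ reducedPeriod T γ by omega).lt_or_eq
      with h3 | h3
    · have hm : (j + 1) % (reducedPeriod T γ : ℤ) = j % (reducedPeriod T γ : ℤ) + 1 := by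
        rw [← Int.emod_add_emod, Int.emod_eq_of_lt (by omega) h3]
      have hd : (j + 1) / (reducedPeriod T γ : ℤ) = j / (reducedPeriod T γ : ℤ) := by
        have h4 := Int.emod_add_mul_ediv (j + 1) (reducedPeriod T γ : ℤ)
        rw [hm] at h4
        exact mul_left_cancel₀ hpos'.ne' (by linarith)
      rw [reducedIndex, reducedIndex, hm, hd, ← hp]
      have : Nat.nth p (j % (reducedPeriod T γ : ℤ)).toNat <
          Nat.nth p (j % (reducedPeriod T γ : ℤ) + 1).toNat :=
        Nat.nth_strictMono hinf (by omega)
      omega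
    · -- the last index of one period is followed by the first one of the next
      have hd : (j + 1) / (reducedPeriod T γ : ℤ) = j / (reducedPeriod T γ : ℤ) + 1 := by
        rw [← h2, add_right_comm, h3, Int.add_mul_ediv_left _ _ hpos'.ne',
          Int.ediv_self hpos'.ne', Int.add_mul_ediv_left _ _ hpos'.ne',
          Int.ediv_eq_zero_of_lt h0 h1]
        ring
      rw [reducedIndex, reducedIndex, hd, ← hp]
      have := Nat.nth_lt_of_lt_count (hmod j)
      rw [mul_add, mul_one]
      omega
  · have h0 := Int.emod_nonneg t hT'.ne'
    have h1 := Int.emod_lt_of_pos t hT'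
    obtain ⟨r, hr⟩ := Int.eq_ofNat_of_zero_le h0
    have hpr : p r := by
      show forwardDiff γ (r : ℤ) ≠ 0
      rw [← hr, periodic_emod (forwardDiff_periodic hγ)]
      exact ht
    have hc : Nat.count p r < reducedPeriod T γ := by
      rw [hcount]; exact Nat.count_strict_mono hpr (by omega)
    refine ⟨Nat.count p r + reducedPeriod T γ * (t / T), ?_⟩
    rw [reducedIndex, Int.add_mul_emod_self_left, Int.add_mul_ediv_left _ _ hpos'.ne',
      Int.emod_eq_of_lt (by omega) (by omega), Int.ediv_eq_zero_of_lt (by omega) (by omega),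
      Int.toNat_natCast, Nat.nth_count hpr, ← hr, zero_add]
    exact Int.emod_add_mul_ediv t T

/-- Every point of `γ` equals the next point that is kept in the reduced sequence. -/
lemma exists_reducedIndex_between {T : ℕ} (hT : 0 < T) {γ : ℤ → Plane}
    (hγ : ∀ t, γ (t + T) = γ t) (hne : ∃ t, forwardDiff γ t ≠ 0) (t : ℤ) :
    ∃ j, reducedIndex T γ (j - 1) < t ∧ t ≤ reducedIndex T γ j ∧ γ t = reducedSeq T γ j := by
  obtain ⟨hmono, hsurj⟩ := reducedIndex_spec hT hγ hne
  have hgrow : ∀ m : ℕ, reducedIndex T γ 0 + m ≤ reducedIndex T γ m := by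
    intro m
    induction m with
    | zero => simp
    | succ m ih =>
      have := hmono (show (m : ℤ) < m + 1 by omega)
      push_cast
      omega
  have hdecay : ∀ m : ℕ, reducedIndex T γ (-m) ≤ reducedIndex T γ 0 - m := by
    intro m
    induction m with
    | zero => simp
    | succ m ih =>
      have := hmono (show -((m : ℤ) + 1) < -m by omega)
      push_cast
      omega
  obtain ⟨j, hj, hleast⟩ := Int.exists_least_of_bdd (P := fun j => t ≤ reducedIndex T γ j)
    ⟨-((reducedIndex T γ 0 - t).toNat + 1 : ℕ), fun z hz => by
      by_contra hcon
      have h1 := hmono.monotone (not_le.1 hcon).le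
      have h2 := hdecay ((reducedIndex T γ 0 - t).toNat + 1)
      omega⟩
    ⟨((t - reducedIndex T γ 0).toNat : ℕ), by
      have := hgrow (t - reducedIndex T γ 0).toNat
      omega⟩
  have hj' : reducedIndex T γ (j - 1) < t := by
    by_contra hcon
    have := hleast (j - 1) (not_lt.1 hcon)
    omega
  refine ⟨j, hj', hj, ?_⟩
  have hconst : ∀ s, t ≤ s → s ≤ reducedIndex T γ j → γ t = γ s := by
    refine Int.leInduction (fun _ => rfl) ?_
    intro s hts ih hs
    rw [ih (by omega)]
    by_contra hcon
    obtain ⟨i, rfl⟩ := hsurj s fun h0 => hcon (sub_eq_zero.1 h0).symm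
    have h1 : i < j := hmono.lt_iff_lt.1 (by omega)
    have h2 := hmono.monotone (show i ≤ j - 1 by omega)
    omega
  rw [reducedSeq_eq hγ]
  exact hconst _ hj le_rfl

lemma reducedSeq_ne_succ {T : ℕ} (hT : 0 < T) {γ : ℤ → Plane}
    (hγ : ∀ t, γ (t + T) = γ t) (hne : ∃ t, forwardDiff γ t ≠ 0) (j : ℤ) :
    reducedSeq T γ j ≠ reducedSeq T γ (j + 1) := by
  classical
  obtain ⟨hmono, -⟩ := reducedIndex_spec hT hγ hne
  obtain ⟨i, hi1, hi2, hi⟩ := exists_reducedIndex_between hT hγ hne (reducedIndex T γ j + 1)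
  have h1 : i - 1 < j + 1 := hmono.lt_iff_lt.1 (by have := hmono (lt_add_one j); omega)
  have h2 : j < i := hmono.lt_iff_lt.1 (by omega)
  obtain rfl : i = j + 1 := by omega
  rw [← hi, reducedSeq_eq hγ]
  have hmem : forwardDiff γ (reducedIndex T γ j) ≠ 0 := by
    have hp := periodic_add_mul (forwardDiff_periodic hγ) (j / (reducedPeriod T γ : ℤ))
    rw [reducedIndex, hp]
    have hpos := reducedPeriod_pos hT hγ hne
    have hpos' : (0 : ℤ) < reducedPeriod T γ := by exact_mod_cast hpos
    obtain ⟨n, hn, hn0⟩ := exists_nat_forwardDiff_ne_zero hT hγ hne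
    refine Nat.nth_mem (p := fun n : ℕ => forwardDiff γ (n : ℤ) ≠ 0) _ fun hf => ?_
    refine lt_of_lt_of_le ?_ (Nat.count_le_card hf T)
    have h0 := Int.emod_nonneg j hpos'.ne'
    have h1 := Int.emod_lt_of_pos j hpos'
    have hcount : reducedPeriod T γ = Nat.count (fun n : ℕ => forwardDiff γ (n : ℤ) ≠ 0) T := by
      rw [reducedPeriod]
    omega
  exact fun h0 => hmem (sub_eq_zero.2 h0.symm)

lemma SpansPlane.reducedSeq {T : ℕ} (hT : 0 < T) {γ : ℤ → Plane} (hγ : ∀ t, γ (t + T) = γ t)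
    (hspan : SpansPlane γ) : SpansPlane (reducedSeq T γ) := by
  intro α hα
  obtain ⟨t, ht⟩ := hspan α hα
  obtain ⟨j, -, -, hj⟩ :=
    exists_reducedIndex_between hT hγ hspan.exists_forwardDiff_ne_zero t
  exact ⟨j, by rwa [← hj]⟩

lemma WeaklyOriented.reducedSeq {σ : ℝ} {T : ℕ} (hT : 0 < T) {γ : ℤ → Plane}
    (hγ : ∀ t, γ (t + T) = γ t) (hne : ∃ t, forwardDiff γ t ≠ 0) (h : WeaklyOriented σ T γ) :
    WeaklyOriented σ (reducedPeriod T γ) (reducedSeq T γ) := by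
  intro i j k hij hjk hki
  obtain ⟨hmono, -⟩ := reducedIndex_spec hT hγ hne
  rw [reducedSeq_eq hγ, reducedSeq_eq hγ, reducedSeq_eq hγ]
  refine h _ _ _ (hmono.monotone hij) (hmono.monotone hjk) ?_
  rw [← reducedIndex_add_period (reducedPeriod_pos hT hγ hne)]
  exact hmono.monotone hki

lemma weaklyOriented_of_reducedSeq {σ : ℝ} {T : ℕ} (hT : 0 < T) {γ : ℤ → Plane}
    (hγ : ∀ t, γ (t + T) = γ t) (hne : ∃ t, forwardDiff γ t ≠ 0)
    (h : WeaklyOriented σ (reducedPeriod T γ) (reducedSeq T γ)) : WeaklyOriented σ T γ := by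
  intro i j k hij hjk hki
  obtain ⟨hmono, -⟩ := reducedIndex_spec hT hγ hne
  obtain ⟨a, ha1, ha2, ha⟩ := exists_reducedIndex_between hT hγ hne i
  obtain ⟨b, hb1, hb2, hb⟩ := exists_reducedIndex_between hT hγ hne j
  obtain ⟨c, hc1, hc2, hc⟩ := exists_reducedIndex_between hT hγ hne k
  rw [ha, hb, hc]
  have h1 : a - 1 < b := hmono.lt_iff_lt.1 (by omega)
  have h2 : b - 1 < c := hmono.lt_iff_lt.1 (by omega)
  have h3 : c - 1 < a + reducedPeriod T γ := hmono.lt_iff_lt.1 (by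
    rw [reducedIndex_add_period (reducedPeriod_pos hT hγ hne)]; omega)
  exact h a b c (by omega) (by omega) (by omega)

lemma reducedSeq_eq_self {T : ℕ} (hT : 0 < T) {γ : ℤ → Plane} (hγ : ∀ t, γ (t + T) = γ t)
    (hne : ∀ t, forwardDiff γ t ≠ 0) : reducedPeriod T γ = T ∧ reducedSeq T γ = γ := by
  classical
  have hp : (fun n : ℕ => forwardDiff γ (n : ℤ) ≠ 0) = fun _ => True :=
    funext fun n => eq_true (hne n)
  have hc : reducedPeriod T γ = T := by
    rw [reducedPeriod]
    exact Nat.count_of_forall fun n _ => hne n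
  refine ⟨hc, funext fun j => ?_⟩
  rw [reducedSeq, hp, hc, Nat.nth_true]
  have hT' : (0 : ℤ) < T := by exact_mod_cast hT
  rw [Int.toNat_of_nonneg (Int.emod_nonneg j hT'.ne'), periodic_emod hγ]

/-! ### The characterizations -/

lemma isConvexContour_iff_exists_weaklyOriented {T : ℕ} (hT : 0 < T) {γ : ℤ → Plane}
    (hγ : ∀ t, γ (t + T) = γ t) (hspan : SpansPlane γ) :
    IsConvexContour T γ ↔ ∃ σ : ℝ, σ ≠ 0 ∧ WeaklyOriented σ T γ := by
  rw [isConvexContour_iff hT hγ]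
  exact ⟨exists_weaklyOriented_of_not_alternates hγ,
    fun ⟨σ, hσ, h⟩ α _ => h.not_alternates hσ hγ hspan α⟩

lemma hasConvexPolygon_iff_exists_weaklyOriented {T : ℕ} (hT : 0 < T) {γ : ℤ → Plane}
    (hγ : ∀ t, γ (t + T) = γ t) (hspan : SpansPlane γ) :
    HasConvexPolygon T γ ↔ ∃ σ : ℝ, σ ≠ 0 ∧ WeaklyOriented σ T γ :=
  ⟨fun h => exists_weaklyOriented_of_not_alternates hγ fun α _ => h.not_alternates hT hγ hspan α,
    fun ⟨_, hσ, h⟩ => h.hasConvexPolygon hσ hγ hT hspan⟩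

/-- A right-turning polygon is reflected in the first axis, which does not change the first
coordinate. -/
lemma exists_weaklyOriented_of_local {n : ℕ} (hn : 0 < n) {γ : ℤ → Plane}
    (hγ : ∀ t, γ (t + n) = γ t) (hspan : SpansPlane γ) (hne : ∀ t, γ t ≠ γ (t + 1))
    (hdet : (∀ t, 0 ≤ orient (γ t) (γ (t + 1)) (γ (t + 1 + 1))) ∨
      ∀ t, orient (γ t) (γ (t + 1)) (γ (t + 1 + 1)) ≤ 0)
    (hback : ∀ t, ∀ c : ℝ, 0 < c → forwardDiff γ (t + 1) ≠ -(c • forwardDiff γ t))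
    (hpm : ∀ c : ℝ, ¬ Alternates n (fun t => γ t 0 - c)) :
    ∃ σ : ℝ, σ ≠ 0 ∧ WeaklyOriented σ n γ := by
  rcases hdet with hdet | hdet
  · exact ⟨1, one_ne_zero,
      TurnsLeft.weaklyOriented hn hγ hspan (fun t => ⟨hne t, hdet t, hback t⟩) hpm⟩
  · set δ : ℤ → Plane := fun t => !₂[γ t 0, -γ t 1] with hδ
    have h0 : ∀ t, δ t 0 = γ t 0 := fun t => by simp [hδ]
    have h1 : ∀ t, δ t 1 = -γ t 1 := fun t => by simp [hδ]
    have hor : ∀ i j k, orient (δ i) (δ j) (δ k) = -orient (γ i) (γ j) (γ k) := fun i j k => by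
      simp only [orient, h0, h1]; ring
    have hspan' : SpansPlane δ := by
      intro α hα
      obtain ⟨t, ht⟩ := hspan ![α 0, -α 1, α 2] (fun hz => hα (by
        funext i
        have := congrFun hz i
        fin_cases i <;> simpa using this))
      refine ⟨t, ?_⟩
      simp only [affineForm, h0, h1]
      simpa [affineForm] using ht
    have hleft : TurnsLeft δ := by
      intro t
      refine ⟨fun heq => hne t (plane_ext ?_ ?_), by rw [hor]; linarith [hdet t],
        fun c hc heq => hback t c hc (plane_ext ?_ ?_)⟩
      · rw [← h0, ← h0, heq]
      · rw [← neg_inj, ← h1, ← h1, heq]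
      · have := congrArg (fun p : Plane => p 0) heq
        simpa [forwardDiff, h0] using this
      · have := congrArg (fun p : Plane => p 1) heq
        simp [forwardDiff, h1] at this ⊢
        linarith
    have hw := hleft.weaklyOriented hn (fun t => plane_ext (by rw [h0, h0, hγ])
      (by rw [h1, h1, hγ])) hspan' (by simpa only [h0] using hpm)
    refine ⟨-1, by norm_num, fun i j k hij hjk hki => ?_⟩
    have := hw i j k hij hjk hki
    rw [hor] at this
    linarith

/-- At a reversal, the weak orientation with respect to the two edges that overlap would put all
points on their common line. -/
lemma WeaklyOriented.not_reverse {σ : ℝ} (hσ : σ ≠ 0) {n : ℕ} (hn : 0 < n) {γ : ℤ → Plane}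
    (h : WeaklyOriented σ n γ) (hγ : ∀ t, γ (t + n) = γ t) (hspan : SpansPlane γ)
    {t : ℤ} (hne : γ t ≠ γ (t + 1)) {c : ℝ} (hc : 0 < c) :
    forwardDiff γ (t + 1) ≠ -(c • forwardDiff γ t) := by
  intro heq
  obtain ⟨e, he⟩ := hspan.exists_orient_ne_zero hne
  have h1 := h.orient_edge_nonneg hγ hn t e
  have h2 := h.orient_edge_nonneg hγ hn (t + 1) e
  have e0 := congrArg (fun p : Plane => p 0) heq
  have e1 := congrArg (fun p : Plane => p 1) heq
  simp only [forwardDiff, PiLp.sub_apply, PiLp.neg_apply, PiLp.smul_apply, smul_eq_mul] at e0 e1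
  have h3 : σ * orient (γ (t + 1)) (γ (t + 1 + 1)) (γ e) =
      -(c * (σ * orient (γ t) (γ (t + 1)) (γ e))) := by
    unfold orient
    rw [e0, e1]
    ring
  have h4 : c * (σ * orient (γ t) (γ (t + 1)) (γ e)) = 0 :=
    le_antisymm (by linarith) (mul_nonneg hc.le h1)
  exact he ((mul_eq_zero.1 ((mul_eq_zero.1 h4).resolve_left hc.ne')).resolve_left hσ)

lemma not_alternates_coord {n : ℕ} {γ : ℤ → Plane} (h : ∀ α : Fin 3 → ℝ, α ≠ 0 →
    ¬ Alternates n (fun t => affineForm α (γ t))) (i : Fin 2) (c : ℝ) :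
    ¬ Alternates n (fun t => γ t i - c) := by
  fin_cases i
  · simpa [affineForm, sub_eq_add_neg] using
      h ![1, 0, -c] (fun h0 => by simpa using congrFun h0 0)
  · simpa [affineForm, sub_eq_add_neg] using
      h ![0, 1, -c] (fun h0 => by simpa using congrFun h0 1)

lemma not_weaklyAlternates_coord {n : ℕ} {γ : ℤ → Plane} (h : ∀ α : Fin 3 → ℝ, α ≠ 0 →
    ¬ WeaklyAlternates n (fun t => affineForm α (γ t))) (i : Fin 2) (c : ℝ) :
    ¬ WeaklyAlternates n (fun t => γ t i - c) := by
  fin_cases i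
  · simpa [affineForm, sub_eq_add_neg] using
      h ![1, 0, -c] (fun h0 => by simpa using congrFun h0 0)
  · simpa [affineForm, sub_eq_add_neg] using
      h ![0, 1, -c] (fun h0 => by simpa using congrFun h0 1)

lemma forall_of_forall_period {n : ℕ} (hn : 0 < n) {P : ℤ → Prop} (hP : ∀ t, P (t % n) → P t)
    (h : ∀ t : ℤ, 0 ≤ t → t < n → P t) (t : ℤ) : P t := by
  have hn' : (0 : ℤ) < n := by exact_mod_cast hn
  exact hP t (h _ (Int.emod_nonneg t hn'.ne') (Int.emod_lt_of_pos t hn'))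

lemma consecutiveDet_periodic {n : ℕ} {γ : ℤ → Plane} (hγ : ∀ t, γ (t + n) = γ t) (t : ℤ) :
    consecutiveDet γ (t + n) = consecutiveDet γ t := by
  rw [consecutiveDet_eq_orient, consecutiveDet_eq_orient, add_right_comm, add_right_comm (t + 1),
    hγ, hγ, hγ]

/-- The local characterization for a periodic polygon without repeated consecutive points. -/
lemma local_iff_exists_weaklyOriented {n : ℕ} (hn : 0 < n) {γ : ℤ → Plane}
    (hγ : ∀ t, γ (t + n) = γ t) (hspan : SpansPlane γ) (hne : ∀ t, γ t ≠ γ (t + 1)) :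
    (((∀ t : ℤ, 0 ≤ t → t < n → 0 ≤ consecutiveDet γ t) ∨
        (∀ t : ℤ, 0 ≤ t → t < n → consecutiveDet γ t ≤ 0)) ∧
      (∀ t : ℤ, 0 ≤ t → t < n → ∀ c : ℝ, 0 < c →
        forwardDiff γ (t + 1) ≠ -(c • forwardDiff γ t)) ∧
      PeriodicallyMonotone n (fun t => γ t 0) ∧ PeriodicallyMonotone n (fun t => γ t 1)) ↔
    ∃ σ : ℝ, σ ≠ 0 ∧ WeaklyOriented σ n γ := by
  have hu : ∀ i : Fin 2, ∀ t, (fun t => γ t i) (t + n) = (fun t => γ t i) t := fun i t => by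
    simp only [hγ]
  have hdet : ∀ t, consecutiveDet γ (t % n) = consecutiveDet γ t :=
    periodic_emod (consecutiveDet_periodic hγ)
  constructor
  · rintro ⟨h1, h2, h3, -⟩
    refine exists_weaklyOriented_of_local hn hγ hspan hne ?_ ?_
      ((periodicallyMonotone_iff hn (hu 0)).1 h3)
    · refine h1.imp (fun h t => ?_) (fun h t => ?_) <;> rw [← consecutiveDet_eq_orient]
      · exact forall_of_forall_period hn (fun t ht => by rwa [hdet] at ht) h t
      · exact forall_of_forall_period hn (P := fun t => consecutiveDet γ t ≤ 0)
          (fun t ht => by rwa [hdet] at ht) h t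
    · refine forall_of_forall_period hn (fun t ht => ?_) h2
      have hd : ∀ t, forwardDiff γ (t + n) = forwardDiff γ t := forwardDiff_periodic hγ
      have hd' : ∀ t, forwardDiff γ (t + n + 1) = forwardDiff γ (t + 1) := fun t => by
        rw [add_right_comm, hd]
      have e1 := periodic_emod hd t
      have e2 := periodic_emod (u := fun t => forwardDiff γ (t + 1)) hd' t
      rwa [e1, e2] at ht
  · rintro ⟨σ, hσ, h⟩
    -- a period of one would make the polygon constant
    have hn2 : 2 ≤ n := by
      by_contra hcon
      obtain rfl : n = 1 := by omega
      exact hne 0 (by rw [← hγ 0]; simp)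
    have halt := fun α (_ : α ≠ 0) => h.not_alternates hσ hγ hspan α
    refine ⟨?_, fun t _ _ c hc => h.not_reverse hσ hn hγ hspan (hne t) hc,
      (periodicallyMonotone_iff hn (hu 0)).2 (not_alternates_coord halt 0),
      (periodicallyMonotone_iff hn (hu 1)).2 (not_alternates_coord halt 1)⟩
    have hc : ∀ t, 0 ≤ σ * consecutiveDet γ t := fun t => by
      rw [consecutiveDet_eq_orient]
      exact h _ _ _ (by omega) (by omega) (by omega)
    rcases lt_or_gt_of_ne hσ with hs | hs
    · exact Or.inr fun t _ _ => nonpos_of_mul_nonneg_right (hc t) hs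
    · exact Or.inl fun t _ _ => nonneg_of_mul_nonneg_right (hc t) hs

lemma exists_weaklyOriented_reducedSeq_iff {T : ℕ} (hT : 0 < T) {γ : ℤ → Plane}
    (hγ : ∀ t, γ (t + T) = γ t) (hspan : SpansPlane γ) :
    (∃ σ : ℝ, σ ≠ 0 ∧ WeaklyOriented σ (reducedPeriod T γ) (reducedSeq T γ)) ↔
      ∃ σ : ℝ, σ ≠ 0 ∧ WeaklyOriented σ T γ :=
  ⟨fun ⟨σ, hσ, h⟩ => ⟨σ, hσ, weaklyOriented_of_reducedSeq hT hγ hspan.exists_forwardDiff_ne_zero h⟩,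
    fun ⟨σ, hσ, h⟩ => ⟨σ, hσ, h.reducedSeq hT hγ hspan.exists_forwardDiff_ne_zero⟩⟩

/-! ### The strict characterizations -/

/-- All triples of points in cyclic order within one period have orientation of the sign of `σ`. -/
def StrictlyOriented (σ : ℝ) (T : ℕ) (γ : ℤ → Plane) : Prop :=
  ∀ i j k : ℤ, i < j → j < k → k < i + T → 0 < σ * orient (γ i) (γ j) (γ k)

lemma StrictlyOriented.weaklyOriented {σ : ℝ} {T : ℕ} {γ : ℤ → Plane}
    (h : StrictlyOriented σ T γ) (hγ : ∀ t, γ (t + T) = γ t) : WeaklyOriented σ T γ :=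
  weaklyOriented_of_lt hγ fun i j k h1 h2 h3 => (h i j k h1 h2 h3).le

lemma StrictlyOriented.ne_zero {σ : ℝ} {T : ℕ} (hT : 3 ≤ T) {γ : ℤ → Plane}
    (h : StrictlyOriented σ T γ) : σ ≠ 0 :=
  left_ne_zero_of_mul (h 0 1 2 (by omega) (by omega) (by omega)).ne'

lemma forall_tripleDet_iff_strictlyOriented {T : ℕ} (hT : 3 ≤ T) {γ : ℤ → Plane} :
    ((∀ t₁ t₂ t₃ : ℤ, t₁ < t₂ → t₂ < t₃ → t₃ < t₁ + T → 0 < tripleDet γ t₁ t₂ t₃) ∨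
      (∀ t₁ t₂ t₃ : ℤ, t₁ < t₂ → t₂ < t₃ → t₃ < t₁ + T → tripleDet γ t₁ t₂ t₃ < 0)) ↔
    ∃ σ : ℝ, StrictlyOriented σ T γ := by
  simp only [tripleDet_eq_orient]
  constructor
  · rintro (h | h)
    · exact ⟨1, fun i j k h1 h2 h3 => by linarith [h i j k h1 h2 h3]⟩
    · exact ⟨-1, fun i j k h1 h2 h3 => by linarith [h i j k h1 h2 h3]⟩
  · rintro ⟨σ, h⟩
    rcases lt_or_gt_of_ne (h.ne_zero hT) with hs | hs
    · right
      intro i j k h1 h2 h3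
      exact neg_of_mul_pos_right (h i j k h1 h2 h3) hs.le
    · left
      intro i j k h1 h2 h3
      exact pos_of_mul_pos_right (h i j k h1 h2 h3) hs.le

/-- Three zeros in a period of an affine form and one further point weakly alternate, whatever the
sign at the further point. -/
lemma weaklyAlternates_of_three_zeros {n : ℕ} {u : ℤ → ℝ} (hu : ∀ t, u (t + n) = u t)
    {a b c d : ℤ} (hab : a < b) (hbc : b < c) (hcd : c < d) (hda : d < a + n)
    (ha : u a = 0) (hb : u b = 0) (hc : u c = 0) : WeaklyAlternates n u := by
  rcases le_total (u d) 0 with hd | hd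
  · exact ⟨a, b, c, d, hab, hbc, hcd, hda, ha.ge, hb.le, hc.ge, hd⟩
  · exact ⟨b, c, d, a + n, hbc, hcd, hda, by omega, hb.ge, hc.le, hd, by rw [hu, ha]⟩

lemma isStrictConvexContour_iff_exists_strictlyOriented {T : ℕ} (hT : 4 ≤ T) {γ : ℤ → Plane}
    (hγ : ∀ t, γ (t + T) = γ t) :
    IsStrictConvexContour T γ ↔ ∃ σ : ℝ, StrictlyOriented σ T γ := by
  rw [isStrictConvexContour_iff (by omega) hγ]
  constructor
  · intro h
    obtain ⟨σ, hσ, hw⟩ := exists_weaklyOriented_of_not_alternates hγ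
      fun α hα halt => h α hα halt.weaklyAlternates
    refine ⟨σ, fun i j k hij hjk hki => lt_of_le_of_ne (hw i j k hij.le hjk.le hki.le) fun h0 => ?_⟩
    replace h0 := (mul_eq_zero.1 h0.symm).resolve_left hσ
    rw [← tripleDet_eq_orient, tripleDet] at h0
    obtain ⟨α, hα, hα0⟩ := Matrix.exists_mulVec_eq_zero_iff.2 h0
    have hrow : ∀ m, (!![γ i 0, γ i 1, 1; γ j 0, γ j 1, 1; γ k 0, γ k 1, 1].mulVec α) m = 0 :=
      fun m => congrFun hα0 m
    have hi : affineForm α (γ i) = 0 := by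
      have := hrow 0
      simp [Matrix.mulVec, dotProduct, Fin.sum_univ_three] at this
      unfold affineForm
      linarith
    have hj : affineForm α (γ j) = 0 := by
      have := hrow 1
      simp [Matrix.mulVec, dotProduct, Fin.sum_univ_three] at this
      unfold affineForm
      linarith
    have hk : affineForm α (γ k) = 0 := by
      have := hrow 2
      simp [Matrix.mulVec, dotProduct, Fin.sum_univ_three] at this
      unfold affineForm
      linarith
    have per := affineForm_periodic hγ α
    refine h α hα ?_
    -- as `T ≥ 4`, one of the three gaps contains a fourth index
    rcases (show i + 1 ≤ j by omega).lt_or_eq with h1 | h1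
    · exact weaklyAlternates_of_three_zeros per (a := j) (b := k) (c := i + T) (d := i + 1 + T)
        hjk hki (by omega) (by omega) hj hk (by rw [per, hi])
    rcases (show j + 1 ≤ k by omega).lt_or_eq with h2 | h2
    · exact weaklyAlternates_of_three_zeros per (a := k) (b := i + T) (c := j + T) (d := j + 1 + T)
        hki (by omega) (by omega) (by omega) hk (by rw [per, hi]) (by rw [per, hj])
    · exact weaklyAlternates_of_three_zeros per hij hjk (lt_add_one k) (by omega) hi hj hk
  · rintro ⟨σ, h⟩ α hα
    exact not_weaklyAlternates_of_orient_pos h hα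

lemma strictlySignConsistent_iff_exists_strictlyOriented {T : ℕ} (hT : 3 ≤ T) {γ : ℤ → Plane}
    (hγ : ∀ t, γ (t + T) = γ t) :
    StrictlySignConsistent 3 (contourMatrix T γ) ↔ ∃ σ : ℝ, StrictlyOriented σ T γ := by
  rw [StrictlySignConsistent, forall_minor_iff (fun r => 0 < r), forall_minor_iff (fun r => r < 0),
    forall_sorted_iff_forall_cyclic hγ (fun r => 0 < r),
    forall_sorted_iff_forall_cyclic hγ (fun r => r < 0),
    ← forall_tripleDet_iff_strictlyOriented hT]
  simp only [tripleDet_eq_orient]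

lemma signConsistent_iff_exists_weaklyOriented {T : ℕ} {γ : ℤ → Plane}
    (hγ : ∀ t, γ (t + T) = γ t) :
    SignConsistent 3 (contourMatrix T γ) ↔ ∃ σ : ℝ, σ ≠ 0 ∧ WeaklyOriented σ T γ := by
  rw [SignConsistent, forall_minor_iff (fun r => 0 ≤ r), forall_minor_iff (fun r => r ≤ 0),
    forall_sorted_iff_forall_cyclic hγ (fun r => 0 ≤ r),
    forall_sorted_iff_forall_cyclic hγ (fun r => r ≤ 0),
    ← forall_tripleDet_iff_weaklyOriented hγ]
  simp only [tripleDet_eq_orient]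

lemma collinear_iff_orient_eq_zero {p q r : Plane} : Collinear ℝ {p, q, r} ↔ orient p q r = 0 := by
  constructor
  · intro h
    obtain ⟨p₀, v, hv⟩ := (collinear_iff_exists_forall_eq_smul_vadd (k := ℝ) _).1 h
    obtain ⟨a, rfl⟩ := hv p (by simp)
    obtain ⟨b, rfl⟩ := hv q (by simp)
    obtain ⟨c, rfl⟩ := hv r (by simp)
    simp [orient]
    ring
  · intro h
    by_cases hpq : p = q
    · subst hpq
      simpa using collinear_pair ℝ p r
    · obtain ⟨s, hs0, hs1⟩ := exists_param_of_orient_eq_zero hpq h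
      refine (collinear_iff_of_mem (p₀ := p) (by simp)).2 ⟨q - p, ?_⟩
      rintro x (rfl | rfl | rfl)
      · exact ⟨0, by simp⟩
      · exact ⟨1, by simp⟩
      · exact ⟨s, plane_ext (by simp [hs0]; ring) (by simp [hs1]; ring)⟩

lemma strict_hasConvexPolygon_iff_exists_strictlyOriented {T : ℕ} (hT : 3 ≤ T) {γ : ℤ → Plane}
    (hγ : ∀ t, γ (t + T) = γ t) (hspan : SpansPlane γ) :
    (HasConvexPolygon T γ ∧ ∀ t₁ t₂ t₃ : ℤ, 0 ≤ t₁ → t₁ < t₂ → t₂ < t₃ → t₃ < T →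
      ¬ Collinear ℝ {γ t₁, γ t₂, γ t₃}) ↔ ∃ σ : ℝ, StrictlyOriented σ T γ := by
  rw [hasConvexPolygon_iff_exists_weaklyOriented (by omega) hγ hspan]
  simp only [collinear_iff_orient_eq_zero]
  constructor
  · rintro ⟨⟨σ, hσ, h⟩, hcol⟩
    refine ⟨σ, (forall_sorted_iff_forall_cyclic hγ (fun r => 0 < σ * r)).1 ?_⟩
    intro i j k hi hij hjk hk
    exact lt_of_le_of_ne (h i j k hij.le hjk.le (by omega))
      (mul_ne_zero hσ (hcol i j k hi hij hjk hk)).symm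
  · rintro ⟨σ, h⟩
    exact ⟨⟨σ, h.ne_zero hT, h.weaklyOriented hγ⟩, fun i j k hi hij hjk hk =>
      right_ne_zero_of_mul (h i j k hij hjk (by omega)).ne'⟩

lemma strict_local_iff_exists_strictlyOriented {T : ℕ} (hT : 3 ≤ T) {γ : ℤ → Plane}
    (hγ : ∀ t, γ (t + T) = γ t) (hspan : SpansPlane γ) :
    ((∀ t : ℤ, forwardDiff γ t ≠ 0) ∧
      ((∀ t : ℤ, 0 ≤ t → t < reducedPeriod T γ → 0 < consecutiveDet (reducedSeq T γ) t) ∨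
        (∀ t : ℤ, 0 ≤ t → t < reducedPeriod T γ → consecutiveDet (reducedSeq T γ) t < 0)) ∧
      StrictlyPeriodicallyMonotone (reducedPeriod T γ) (fun t => reducedSeq T γ t 0) ∧
      StrictlyPeriodicallyMonotone (reducedPeriod T γ) (fun t => reducedSeq T γ t 1)) ↔
    ∃ σ : ℝ, StrictlyOriented σ T γ := by
  have hT0 : 0 < T := by omega
  have hu : ∀ i : Fin 2, ∀ t, (fun t => γ t i) (t + T) = (fun t => γ t i) t := fun i t => by
    simp only [hγ]
  have hdet : ∀ t, consecutiveDet γ (t % T) = consecutiveDet γ t :=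
    periodic_emod (consecutiveDet_periodic hγ)
  constructor
  · rintro ⟨hne, hd, hpm, -⟩
    obtain ⟨hper, hseq⟩ := reducedSeq_eq_self hT0 hγ hne
    rw [hper, hseq] at hd
    rw [hper] at hpm
    simp only [hseq] at hpm
    rw [strictlyPeriodicallyMonotone_iff hT0 (hu 0)] at hpm
    have hd' : (∀ t, 0 < consecutiveDet γ t) ∨ ∀ t, consecutiveDet γ t < 0 := by
      refine hd.imp (fun h => ?_) (fun h => ?_)
      · exact forall_of_forall_period hT0 (fun t ht => by rwa [hdet] at ht) h
      · exact forall_of_forall_period hT0 (P := fun t => consecutiveDet γ t < 0)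
          (fun t ht => by rwa [hdet] at ht) h
    have hne0 : ∀ t, consecutiveDet γ t ≠ 0 := fun t =>
      hd'.elim (fun h => (h t).ne') (fun h => (h t).ne)
    obtain ⟨σ, hσ, hw⟩ := exists_weaklyOriented_of_local hT0 hγ hspan
      (fun t h0 => hne t (sub_eq_zero.2 h0.symm))
      (by
        simp only [← consecutiveDet_eq_orient]
        exact hd'.imp (fun h t => (h t).le) (fun h t => (h t).le))
      (fun t c _ h0 => hne0 t (by
        rw [consecutiveDet, Matrix.det_fin_two, h0]
        simp
        ring))
      (fun c halt => hpm c halt.weaklyAlternates)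
    refine ⟨σ, fun i j k hij hjk hki => hw.orient_pos hγ (fun t => ?_) hij hjk hki⟩
    refine lt_of_le_of_ne (hw _ _ _ (by omega) (by omega) (by omega)) (mul_ne_zero hσ ?_).symm
    rw [← consecutiveDet_eq_orient]
    exact hne0 t
  · rintro ⟨σ, h⟩
    have hc : ∀ t, 0 < σ * consecutiveDet γ t := fun t => by
      rw [consecutiveDet_eq_orient]
      exact h _ _ _ (by omega) (by omega) (by omega)
    have hne : ∀ t, forwardDiff γ t ≠ 0 := by
      intro t h0
      have := hc t
      rw [consecutiveDet, Matrix.det_fin_two, h0] at this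
      simp at this
    obtain ⟨hper, hseq⟩ := reducedSeq_eq_self hT0 hγ hne
    rw [hper, hseq]
    have halt := fun α (hα : α ≠ 0) => not_weaklyAlternates_of_orient_pos h hα
    refine ⟨hne, ?_, (strictlyPeriodicallyMonotone_iff hT0 (hu 0)).2
      (not_weaklyAlternates_coord halt 0), (strictlyPeriodicallyMonotone_iff hT0 (hu 1)).2
      (not_weaklyAlternates_coord halt 1)⟩
    rcases lt_or_gt_of_ne (h.ne_zero hT) with hs | hs
    · exact Or.inr fun t _ _ => neg_of_mul_pos_right (hc t) hs.le
    · exact Or.inl fun t _ _ => pos_of_mul_pos_right (hc t) hs.le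

/-! ### Contours on a line -/

/-- An alternation of an affine function of `v` is an alternation of `v` about a level. -/
lemma not_alternates_mul_add {n : ℕ} {v : ℤ → ℝ} (hv : ∀ t, v (t + n) = v t)
    (h : ∀ c : ℝ, ¬ Alternates n (fun t => v t - c)) (A B : ℝ) :
    ¬ Alternates n (fun t => A * v t + B) := by
  rintro ⟨a, b, c, d, hab, hbc, hcd, hda, ha, hb, hc, hd⟩
  have hA : A ≠ 0 := by
    rintro rfl
    linarith
  have hform : ∀ t, A * v t + B = A * (v t - -B / A) := fun t => by field_simp; ring
  simp only [hform] at ha hb hc hd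
  have hA2 : 0 < A ^ 2 := by positivity
  refine h (-B / A) (alternates_of_mul_neg (fun t => by rw [hv]) hab hbc hcd hda ?_ ?_ ?_)
  · nlinarith [mul_neg_of_pos_of_neg ha hb]
  · nlinarith [mul_neg_of_neg_of_pos hb hc]
  · nlinarith [mul_neg_of_pos_of_neg hc hd]

lemma isConvexContour_iff_periodicallyMonotone {T : ℕ} (hT : 0 < T) {γ : ℤ → Plane}
    (hγ : ∀ t, γ (t + T) = γ t) (hspan : ¬ SpansPlane γ) :
    IsConvexContour T γ ↔
      PeriodicallyMonotone T (fun t => γ t 0) ∧ PeriodicallyMonotone T (fun t => γ t 1) := by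
  have hu : ∀ i : Fin 2, ∀ t, (fun t => γ t i) (t + T) = (fun t => γ t i) t := fun i t => by
    simp only [hγ]
  rw [isConvexContour_iff hT hγ, periodicallyMonotone_iff hT (hu 0),
    periodicallyMonotone_iff hT (hu 1)]
  refine ⟨fun h => ⟨not_alternates_coord h 0, not_alternates_coord h 1⟩, fun ⟨h0, h1⟩ α _ => ?_⟩
  simp only [SpansPlane] at hspan
  push Not at hspan
  obtain ⟨β, hβ, hβ0⟩ := hspan
  simp only [affineForm] at hβ0 ⊢
  by_cases hb1 : β 1 = 0
  · by_cases hb0 : β 0 = 0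
    · refine absurd ?_ hβ
      funext i
      fin_cases i
      · exact hb0
      · exact hb1
      · simpa [hb0, hb1] using hβ0 0
    · -- the first coordinate is an affine function of the second one
      have hx : ∀ t, γ t 0 = -(β 1 / β 0) * γ t 1 - β 2 / β 0 := fun t => by
        field_simp
        linarith [hβ0 t]
      have := not_alternates_mul_add (hu 1) h1 (α 1 - α 0 * (β 1 / β 0)) (α 2 - α 0 * (β 2 / β 0))
      convert this using 3 with t
      rw [hx t]
      ring
  · -- the second coordinate is an affine function of the first one
    have hy : ∀ t, γ t 1 = -(β 0 / β 1) * γ t 0 - β 2 / β 1 := fun t => by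
      field_simp
      linarith [hβ0 t]
    have := not_alternates_mul_add (hu 0) h0 (α 0 - α 1 * (β 0 / β 1)) (α 2 - α 1 * (β 2 / β 1))
    convert this using 3 with t
    rw [hy t]
    ring
theorem mainTheorem1 (T : ℕ) (hT : 4 ≤ T) (γ : ℤ → Plane) (hγ : ∀ t : ℤ, γ (t + T) = γ t) :
    ((contourMatrix T γ).rank = 3 →
      List.TFAE [
        IsConvexContour T γ,
        SignConsistent 3 (contourMatrix T γ),
        (∀ t₁ t₂ t₃ : ℤ, t₁ < t₂ → t₂ < t₃ → t₃ < t₁ + T → 0 ≤ tripleDet γ t₁ t₂ t₃) ∨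
          (∀ t₁ t₂ t₃ : ℤ, t₁ < t₂ → t₂ < t₃ → t₃ < t₁ + T → tripleDet γ t₁ t₂ t₃ ≤ 0),
        HasConvexPolygon T γ,
        ((∀ t : ℤ, 0 ≤ t → t < reducedPeriod T γ → 0 ≤ consecutiveDet (reducedSeq T γ) t) ∨
          (∀ t : ℤ, 0 ≤ t → t < reducedPeriod T γ → consecutiveDet (reducedSeq T γ) t ≤ 0)) ∧
        (∀ t : ℤ, 0 ≤ t → t < reducedPeriod T γ → ∀ c : ℝ, 0 < c →
          forwardDiff (reducedSeq T γ) (t + 1) ≠ -(c • forwardDiff (reducedSeq T γ) t)) ∧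
        PeriodicallyMonotone (reducedPeriod T γ) (fun t => reducedSeq T γ t 0) ∧
        PeriodicallyMonotone (reducedPeriod T γ) (fun t => reducedSeq T γ t 1)] ∧
      List.TFAE [
        IsStrictConvexContour T γ,
        StrictlySignConsistent 3 (contourMatrix T γ),
        (∀ t₁ t₂ t₃ : ℤ, t₁ < t₂ → t₂ < t₃ → t₃ < t₁ + T → 0 < tripleDet γ t₁ t₂ t₃) ∨
          (∀ t₁ t₂ t₃ : ℤ, t₁ < t₂ → t₂ < t₃ → t₃ < t₁ + T → tripleDet γ t₁ t₂ t₃ < 0),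
        HasConvexPolygon T γ ∧
          (∀ t₁ t₂ t₃ : ℤ, 0 ≤ t₁ → t₁ < t₂ → t₂ < t₃ → t₃ < T →
            ¬ Collinear ℝ {γ t₁, γ t₂, γ t₃}),
        (∀ t : ℤ, forwardDiff γ t ≠ 0) ∧
        ((∀ t : ℤ, 0 ≤ t → t < reducedPeriod T γ → 0 < consecutiveDet (reducedSeq T γ) t) ∨
          (∀ t : ℤ, 0 ≤ t → t < reducedPeriod T γ → consecutiveDet (reducedSeq T γ) t < 0)) ∧
        StrictlyPeriodicallyMonotone (reducedPeriod T γ) (fun t => reducedSeq T γ t 0) ∧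
        StrictlyPeriodicallyMonotone (reducedPeriod T γ) (fun t => reducedSeq T γ t 1)]) ∧
    ((contourMatrix T γ).rank = 2 →
      (IsConvexContour T γ ↔
        PeriodicallyMonotone T (fun t => γ t 0) ∧ PeriodicallyMonotone T (fun t => γ t 1))) := by
  have hT0 : 0 < T := by omega
  refine ⟨fun hrank => ?_, fun hrank => ?_⟩
  · have hspan : SpansPlane γ := (spansPlane_iff_rank hT0 hγ).2 hrank
    have hred := fun t : ℤ => reducedSeq_ne_succ hT0 hγ hspan.exists_forwardDiff_ne_zero t
    constructor
    · tfae_have 1 ↔ 3 := (isConvexContour_iff_exists_weaklyOriented hT0 hγ hspan).trans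
        (forall_tripleDet_iff_weaklyOriented hγ).symm
      tfae_have 2 ↔ 3 := (signConsistent_iff_exists_weaklyOriented hγ).trans
        (forall_tripleDet_iff_weaklyOriented hγ).symm
      tfae_have 4 ↔ 3 := (hasConvexPolygon_iff_exists_weaklyOriented hT0 hγ hspan).trans
        (forall_tripleDet_iff_weaklyOriented hγ).symm
      tfae_have 5 ↔ 3 := (local_iff_exists_weaklyOriented
        (reducedPeriod_pos hT0 hγ hspan.exists_forwardDiff_ne_zero) reducedSeq_add_period
        (hspan.reducedSeq hT0 hγ) hred).trans
        ((exists_weaklyOriented_reducedSeq_iff hT0 hγ hspan).trans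
          (forall_tripleDet_iff_weaklyOriented hγ).symm)
      tfae_finish
    · have hT3 : 3 ≤ T := by omega
      have hY := forall_tripleDet_iff_strictlyOriented hT3 (γ := γ)
      tfae_have 1 ↔ 3 := (isStrictConvexContour_iff_exists_strictlyOriented hT hγ).trans hY.symm
      tfae_have 2 ↔ 3 := (strictlySignConsistent_iff_exists_strictlyOriented hT3 hγ).trans hY.symm
      tfae_have 4 ↔ 3 :=
        (strict_hasConvexPolygon_iff_exists_strictlyOriented hT3 hγ hspan).trans hY.symm
      tfae_have 5 ↔ 3 := (strict_local_iff_exists_strictlyOriented hT3 hγ hspan).trans hY.symm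
      tfae_finish
  · refine isConvexContour_iff_periodicallyMonotone hT0 hγ fun hspan => ?_
    have := (spansPlane_iff_rank hT0 hγ).1 hspan
    omega
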